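/- Let $K$ be a field whose characteristic is neither $2$ nor $3$ (that is, $\tfrac16\in K$), let $x=(x_1,x_2,x_3)$, and let $H=(H_1,H_2,H_3)\in K[x]^3$ be quartic homogeneous, i.e. $H\neq 0$ and each $H_i$ is zero or homogeneous of degree $4$. Suppose that the Jacobian matrix $\mathcal{J}H=\big(\partial H_i/\partial x_j\big)_{1\le i,j\le 3}$ is nilpotent. Then there exists a $T\in\operatorname{GL}_3(K)$ such that $\tilde H:=T^{-1}H(Tx)$ satisfies either $$\tilde H=\big(0,\ \tfrac14x_1^4,\ x_1^3x_2+u\,x_1^2x_2^2+v\,x_1x_2^3+w\,x_2^4\big)$$ for certain $u,v,w\in K$, or $$\tilde H=\big(0,\ \tfrac14x_1^4+u\,x_1^2x_3^2+v\,x_1x_3^3+w\,x_3^4,\ 0\big)$$ for certain $u,v,w\in K$. -/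

import Mathlib

open scoped MatrixGroups

namespace PolyMap

/-- The Jacobian matrix `(∂ H_i / ∂ x_j)_{i,j}` of a polynomial map `H = (H_1, …, H_m)` in the
variables `x_1, …, x_n`, with entries in `K[x_1, …, x_n]`. -/
noncomputable def jacobian {K : Type*} [CommSemiring K] {m n : ℕ}
    (H : Fin m → MvPolynomial (Fin n) K) : Matrix (Fin m) (Fin n) (MvPolynomial (Fin n) K) :=
  Matrix.of fun i j => MvPolynomial.pderiv j (H i)

/-- `H` is a homogeneous polynomial map of degree `d`: every component is a form of degree `d`
(components may vanish), and `H` itself is not zero, so that its degree is exactly `d`. -/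
def IsHomogeneousOfDegree {K : Type*} [CommSemiring K] {m n : ℕ}
    (H : Fin m → MvPolynomial (Fin n) K) (d : ℕ) : Prop :=
  H ≠ 0 ∧ ∀ i, (H i).IsHomogeneous d

/-- The linear conjugate `T⁻¹ H(T x)` of a polynomial map `H` by `T ∈ GL_n(K)`. -/
noncomputable def linConj {K : Type*} [CommRing K] {n : ℕ} (T : GL (Fin n) K)
    (H : Fin n → MvPolynomial (Fin n) K) : Fin n → MvPolynomial (Fin n) K :=
  fun i => ∑ j, MvPolynomial.C ((T⁻¹).val i j) *
    MvPolynomial.bind₁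
      (fun k => ∑ l, MvPolynomial.C (T.val k l) * MvPolynomial.X l) (H j)

end PolyMap

/-! Write N for the Jacobian matrix of H. Euler's identity gives N(a)a = 4H(a) at every point a, so
N(a)²a = 4(NH)(a). The behaviour of a under N(a) is therefore governed by H and NH, and a linear
change of coordinates replaces N(a) by a conjugate matrix. The proof normalises N at one well-chosen
point and lets nilpotency determine the remaining coefficients.

If N² = 0, then N has rank at most one, and by Euler any two components of H have vanishing
Wronskians. Moving a point a with H(a) ≠ 0 to e₀ and H(a) to a multiple of e₁ makes `H 0` and `H 2`
vanish at e₀ but not `H 1`, so `H 0 = H 2 = 0`. The trace then frees `H 1` of x₁, and a shear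
removes x₀³x₂. This is `hasNormalForm_of_jacobian_sq_eq_zero`, which produces the second family.

If N² ≠ 0, work first over an infinite extension field. There NH ≠ 0. Otherwise, at a general point
a, the vector a lies in ker N(a)² = im N(a), say a = N(a)f, and in the basis f, N(a)f, N(a)²f the
matrix at (0,1,0) is the shift. Together with NH = 0 and the trace condition this forces 12 = 0
(`false_of_shift_at_point_of_jacobian_mulVec_self_eq_zero`).

Since NH ≠ 0, some a is a cyclic vector of N(a), and in the basis a, N(a)a, N(a)²a the matrix at
(1,0,0) is the shift. Comparing the coefficients of the trace, the sum of principal minors and the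
determinant shows that one component is zero and one variable does not occur
(`coeffs_of_shift_at_point`). In invariant terms, the components are linearly dependent and some
directional derivative kills all of them. Both are linear conditions defined over K, so they have
nonzero solutions over K (`exists_sum_eq_zero_of_map`, `exists_relations`). Adapting coordinates to
the two relations either makes H triangular, giving the first family after a shear and a scaling, or
leads back to N² = 0. -/

namespace PolyMap

open MvPolynomial

/-! ### Linear conjugation and its effect on the Jacobian matrix -/

section Conjugation

variable {K : Type*} [CommRing K] {n : ℕ}

/-- The substitution `p ↦ p(T x)`. -/
noncomputable def substLin (T : Matrix (Fin n) (Fin n) K) :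
    MvPolynomial (Fin n) K →ₐ[K] MvPolynomial (Fin n) K :=
  bind₁ fun k => ∑ l, C (T k l) * X l

@[simp]
lemma substLin_X (T : Matrix (Fin n) (Fin n) K) (k : Fin n) :
    substLin T (X k) = ∑ l, C (T k l) * X l := by
  simp [substLin]

@[simp]
lemma substLin_C (T : Matrix (Fin n) (Fin n) K) (a : K) : substLin T (C a) = C a := by
  simp [substLin]

lemma linConj_apply (T : GL (Fin n) K) (H : Fin n → MvPolynomial (Fin n) K) (i : Fin n) :
    linConj T H i = ∑ j, C ((T⁻¹).val i j) * substLin T.val (H j) := rfl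

lemma substLin_comp (S T : Matrix (Fin n) (Fin n) K) (p : MvPolynomial (Fin n) K) :
    substLin T (substLin S p) = substLin (S * T) p := by
  suffices h : (substLin T).comp (substLin S) = substLin (S * T) from DFunLike.congr_fun h p
  refine algHom_ext fun k => ?_
  simp only [AlgHom.comp_apply, substLin_X, map_sum, map_mul, substLin_C, Matrix.mul_apply,
    Finset.sum_mul, Finset.mul_sum, mul_assoc]
  rw [Finset.sum_comm]

lemma substLin_one (p : MvPolynomial (Fin n) K) :
    substLin (1 : Matrix (Fin n) (Fin n) K) p = p := by
  suffices h : substLin (1 : Matrix (Fin n) (Fin n) K) = AlgHom.id K _ from DFunLike.congr_fun h p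
  refine algHom_ext fun k => ?_
  simp [Matrix.one_apply]

lemma eval_substLin (T : Matrix (Fin n) (Fin n) K) (a : Fin n → K) (p : MvPolynomial (Fin n) K) :
    eval a (substLin T p) = eval (T.mulVec a) p := by
  suffices h : (aeval a).comp (substLin T) = aeval (T.mulVec a) from DFunLike.congr_fun h p
  refine algHom_ext fun k => ?_
  simp [Matrix.mulVec, dotProduct]

lemma pderiv_substLin (T : Matrix (Fin n) (Fin n) K) (l : Fin n) (p : MvPolynomial (Fin n) K) :
    pderiv l (substLin T p) = ∑ k, substLin T (pderiv k p) * C (T k l) := by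
  induction p using MvPolynomial.induction_on with
  | C a => simp
  | add p q hp hq => simp [hp, hq, add_mul, Finset.sum_add_distrib]
  | mul_X p i hp =>
    simp only [map_mul, Derivation.leibniz, hp, substLin_X, smul_eq_mul, map_sum, map_add, pderiv_X,
      pderiv_C, Pi.single_apply, add_mul, Finset.sum_add_distrib, Finset.mul_sum, Finset.sum_mul]
    simp only [apply_ite, mul_one, mul_zero, map_one, map_zero]
    rw [add_comm, Finset.sum_comm]
    simp [mul_assoc, mul_comm, mul_left_comm, add_comm]

lemma sum_C_mul_linConj (T : GL (Fin n) K) (H : Fin n → MvPolynomial (Fin n) K) (i : Fin n) :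
    ∑ j, C (T.val i j) * linConj T H j = substLin T.val (H i) := by
  have h : ∀ k, ∑ j, T.val i j * (T⁻¹).val j k = if i = k then 1 else 0 := fun k => by
    rw [← Matrix.mul_apply, ← Units.val_mul, mul_inv_cancel]; simp [Matrix.one_apply]
  simp only [linConj_apply, Finset.mul_sum]
  rw [Finset.sum_comm]
  simp only [← mul_assoc, ← Finset.sum_mul, ← map_mul, ← map_sum, h]
  simp

/-- Clearing T⁻¹ turns a claimed normal form into the identity H(Tx) = T·G(x), which can be checked
without computing an inverse matrix. -/
lemma linConj_eq_iff (T : GL (Fin n) K) (H G : Fin n → MvPolynomial (Fin n) K) :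
    linConj T H = G ↔ ∀ i, substLin T.val (H i) = ∑ j, C (T.val i j) * G j := by
  constructor
  · rintro rfl i
    exact (sum_C_mul_linConj T H i).symm
  · intro h
    funext i
    have h' : ∀ k, ∑ j, (T⁻¹).val i j * T.val j k = if i = k then 1 else 0 := fun k => by
      rw [← Matrix.mul_apply, ← Units.val_mul, inv_mul_cancel]; simp [Matrix.one_apply]
    simp only [linConj_apply, h, Finset.mul_sum]
    rw [Finset.sum_comm]
    simp only [← mul_assoc, ← Finset.sum_mul, ← map_mul, ← map_sum, h']
    simp

lemma linConj_linConj (S T : GL (Fin n) K) (H : Fin n → MvPolynomial (Fin n) K) :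
    linConj S (linConj T H) = linConj (T * S) H := by
  symm
  rw [linConj_eq_iff]
  intro i
  simp only [Units.val_mul]
  rw [← substLin_comp, ← sum_C_mul_linConj, map_sum]
  simp only [map_mul, substLin_C, ← sum_C_mul_linConj S, Matrix.mul_apply, map_sum,
    Finset.sum_mul, Finset.mul_sum, mul_assoc]
  rw [Finset.sum_comm]

lemma jacobian_linConj (T : GL (Fin n) K) (H : Fin n → MvPolynomial (Fin n) K) :
    jacobian (linConj T H) =
      (T⁻¹).val.map C * (jacobian H).map (substLin T.val) * T.val.map C := by
  ext1 i j
  simp only [jacobian, Matrix.of_apply, linConj_apply, map_sum, pderiv_C_mul, pderiv_substLin,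
    Matrix.mul_apply, Matrix.map_apply, Finset.sum_mul, Finset.mul_sum, mul_assoc]
  rw [Finset.sum_comm]

/-- The chain rule at a point: choosing the columns of T both moves a given point to a coordinate
vector and puts the value of the Jacobian there into a prescribed form. -/
lemma eval_jacobian_linConj (T : GL (Fin n) K) (H : Fin n → MvPolynomial (Fin n) K)
    (a : Fin n → K) :
    (jacobian (linConj T H)).map (eval a) =
      (T⁻¹).val * (jacobian H).map (eval (T.val.mulVec a)) * T.val := by
  rw [jacobian_linConj, Matrix.map_mul, Matrix.map_mul]
  congr 2
  · ext; simp
  · ext; simp [eval_substLin]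
  · ext; simp

lemma isHomogeneous_substLin (T : Matrix (Fin n) (Fin n) K) {p : MvPolynomial (Fin n) K} {d : ℕ}
    (hp : p.IsHomogeneous d) : (substLin T p).IsHomogeneous d := by
  have := hp.aeval (fun k => ∑ l, C (T k l) * X l : Fin n → MvPolynomial (Fin n) K) (n := 1)
    (fun k => IsHomogeneous.sum _ _ _ fun l _ => by
      simpa using (isHomogeneous_C (Fin n) (T k l)).mul (isHomogeneous_X K l))
  simpa [substLin] using this

lemma isHomogeneous_linConj (T : GL (Fin n) K) {H : Fin n → MvPolynomial (Fin n) K} {d : ℕ}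
    (hH : ∀ i, (H i).IsHomogeneous d) (i : Fin n) : (linConj T H i).IsHomogeneous d := by
  rw [linConj_apply]
  refine IsHomogeneous.sum _ _ _ fun j _ => ?_
  simpa using (isHomogeneous_C (Fin n) ((T⁻¹).val i j)).mul (isHomogeneous_substLin T.val (hH j))

lemma map_inv_mul_map (T : GL (Fin n) K) :
    T.val.map (C : K →+* MvPolynomial (Fin n) K) * (T⁻¹).val.map C = 1 := by
  rw [← Matrix.map_mul, ← Units.val_mul, mul_inv_cancel, Units.val_one, Matrix.map_one _ C_0 C_1]

lemma jacobian_linConj_pow (T : GL (Fin n) K) (H : Fin n → MvPolynomial (Fin n) K) (k : ℕ) :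
    jacobian (linConj T H) ^ k =
      (T⁻¹).val.map C * (jacobian H ^ k).map (substLin T.val) * T.val.map C := by
  have h2 : (T⁻¹).val.map (C : K →+* MvPolynomial (Fin n) K) * T.val.map C = 1 := by
    simpa only [inv_inv] using map_inv_mul_map T⁻¹
  induction k with
  | zero =>
    have : (1 : Matrix (Fin n) (Fin n) (MvPolynomial (Fin n) K)).map (substLin T.val) = 1 :=
      Matrix.map_one _ (map_zero _) (map_one _)
    rw [pow_zero, pow_zero, this, mul_one, h2]
  | succ k ih =>
    rw [pow_succ, ih, jacobian_linConj, pow_succ, Matrix.map_mul]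
    simp only [Matrix.mul_assoc]
    rw [← Matrix.mul_assoc (T.val.map C) ((T⁻¹).val.map C), map_inv_mul_map, Matrix.one_mul]

lemma isNilpotent_jacobian_linConj (T : GL (Fin n) K) {H : Fin n → MvPolynomial (Fin n) K}
    (hH : IsNilpotent (jacobian H)) : IsNilpotent (jacobian (linConj T H)) := by
  obtain ⟨k, hk⟩ := hH
  refine ⟨k, ?_⟩
  rw [jacobian_linConj_pow, hk]
  have : (0 : Matrix (Fin n) (Fin n) (MvPolynomial (Fin n) K)).map (substLin T.val) = 0 := by
    ext i j; simp
  simp [this]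

lemma linConj_ne_zero (T : GL (Fin n) K) {H : Fin n → MvPolynomial (Fin n) K} (hH : H ≠ 0) :
    linConj T H ≠ 0 := by
  intro h
  refine hH (funext fun i => ?_)
  have h1 := (linConj_eq_iff T H 0).1 h i
  simp only [Pi.zero_apply, mul_zero, Finset.sum_const_zero] at h1
  have h2 := congrArg (substLin (T⁻¹).val) h1
  rwa [substLin_comp, ← Units.val_mul, mul_inv_cancel, Units.val_one, substLin_one, map_zero] at h2

lemma IsHomogeneousOfDegree.linConj (T : GL (Fin n) K) {H : Fin n → MvPolynomial (Fin n) K} {d : ℕ}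
    (hH : IsHomogeneousOfDegree H d) : IsHomogeneousOfDegree (linConj T H) d :=
  ⟨linConj_ne_zero T hH.1, isHomogeneous_linConj T hH.2⟩

end Conjugation

/-! ### Characteristic coefficients of a nilpotent matrix -/

section NilpotentThree

/-- For a nilpotent `3 × 3` matrix over a domain in which `2 ≠ 0`, the three nontrivial coefficients
of the characteristic polynomial vanish. -/
lemma charpoly_coeffs_of_isNilpotent {R : Type*} [CommRing R] [IsDomain R] (h2 : (2 : R) ≠ 0)
    {N : Matrix (Fin 3) (Fin 3) R} (hN : IsNilpotent N) :
    N 0 0 + N 1 1 + N 2 2 = 0 ∧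
    N 0 0 * N 1 1 - N 0 1 * N 1 0 + (N 0 0 * N 2 2 - N 0 2 * N 2 0)
      + (N 1 1 * N 2 2 - N 1 2 * N 2 1) = 0 ∧
    N.det = 0 := by
  have h1 : N.trace = 0 := (Matrix.isNilpotent_trace_of_isNilpotent hN).eq_zero
  have h3 : (N ^ 2).trace = 0 :=
    (Matrix.isNilpotent_trace_of_isNilpotent (hN.pow_of_pos two_ne_zero)).eq_zero
  have h4 : N.det = 0 := by
    obtain ⟨k, hk⟩ := hN
    have : N.det ^ k = 0 := by
      rw [← Matrix.det_pow, hk]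
      rcases k with _ | k
      · exact absurd hk (by simp)
      · simp
    exact eq_zero_of_pow_eq_zero this
  simp only [pow_two, Matrix.trace_fin_three, Matrix.mul_apply, Fin.sum_univ_three] at h1 h3
  -- Newton's identity 2e₂ = (tr N)² − tr N², which is where 2 ≠ 0 enters.
  refine ⟨h1, mul_left_cancel₀ h2 ?_, h4⟩
  linear_combination (N 0 0 + N 1 1 + N 2 2) * h1 - h3

end NilpotentThree

/-! ### Ternary quartics in coordinates -/

section ExplicitQuartics

/-- The ternary quartic with the given coefficients, in decreasing powers of `X 0`. -/
noncomputable def quartic {R : Type*} [CommSemiring R] (c : Fin 15 → R) : MvPolynomial (Fin 3) R :=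
  C (c 0) * X 0 ^ 4 + C (c 1) * (X 0 ^ 3 * X 1) + C (c 2) * (X 0 ^ 3 * X 2)
    + C (c 3) * (X 0 ^ 2 * X 1 ^ 2) + C (c 4) * (X 0 ^ 2 * X 1 * X 2)
    + C (c 5) * (X 0 ^ 2 * X 2 ^ 2)
    + C (c 6) * (X 0 * X 1 ^ 3) + C (c 7) * (X 0 * X 1 ^ 2 * X 2)
    + C (c 8) * (X 0 * X 1 * X 2 ^ 2) + C (c 9) * (X 0 * X 2 ^ 3)
    + C (c 10) * X 1 ^ 4 + C (c 11) * (X 1 ^ 3 * X 2) + C (c 12) * (X 1 ^ 2 * X 2 ^ 2)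
    + C (c 13) * (X 1 * X 2 ^ 3) + C (c 14) * X 2 ^ 4

/-- The value at `(x, y, z)` of a ternary quartic. -/
def quarticEval {R : Type*} [CommSemiring R] (c : Fin 15 → R) (x y z : R) : R :=
  c 0 * x ^ 4 + x ^ 3 * (c 1 * y + c 2 * z) + x ^ 2 * (c 3 * y ^ 2 + c 4 * y * z + c 5 * z ^ 2)
    + x * (c 6 * y ^ 3 + c 7 * y ^ 2 * z + c 8 * y * z ^ 2 + c 9 * z ^ 3)
    + (c 10 * y ^ 4 + c 11 * y ^ 3 * z + c 12 * y ^ 2 * z ^ 2 + c 13 * y * z ^ 3 + c 14 * z ^ 4)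

/-- The value at `(x, y, z)` of the derivative of a ternary quartic in the first variable. -/
def quarticDx {R : Type*} [CommSemiring R] (c : Fin 15 → R) (x y z : R) : R :=
  4 * c 0 * x ^ 3 + 3 * x ^ 2 * (c 1 * y + c 2 * z)
    + 2 * x * (c 3 * y ^ 2 + c 4 * y * z + c 5 * z ^ 2)
    + (c 6 * y ^ 3 + c 7 * y ^ 2 * z + c 8 * y * z ^ 2 + c 9 * z ^ 3)

/-- The value at `(x, y, z)` of the derivative of a ternary quartic in the second variable. -/
def quarticDy {R : Type*} [CommSemiring R] (c : Fin 15 → R) (x y z : R) : R :=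
  c 1 * x ^ 3 + x ^ 2 * (2 * c 3 * y + c 4 * z)
    + x * (3 * c 6 * y ^ 2 + 2 * c 7 * y * z + c 8 * z ^ 2)
    + (4 * c 10 * y ^ 3 + 3 * c 11 * y ^ 2 * z + 2 * c 12 * y * z ^ 2 + c 13 * z ^ 3)

/-- The value at `(x, y, z)` of the derivative of a ternary quartic in the third variable. -/
def quarticDz {R : Type*} [CommSemiring R] (c : Fin 15 → R) (x y z : R) : R :=
  c 2 * x ^ 3 + x ^ 2 * (c 4 * y + 2 * c 5 * z)
    + x * (c 7 * y ^ 2 + 2 * c 8 * y * z + 3 * c 9 * z ^ 2)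
    + (c 11 * y ^ 3 + 2 * c 12 * y ^ 2 * z + 3 * c 13 * y * z ^ 2 + 4 * c 14 * z ^ 3)

variable {R : Type*} [CommRing R] (c : Fin 15 → R) (x y z : R)

lemma eval_quartic : eval ![x, y, z] (quartic c) = quarticEval c x y z := by
  simp only [quartic, quarticEval, map_add, map_mul, map_pow, eval_C, eval_X, Matrix.cons_val]
  ring

lemma eval_pderiv_zero_quartic :
    eval ![x, y, z] (pderiv 0 (quartic c)) = quarticDx c x y z := by
  simp [quartic, quarticDx, pderiv_X]
  ring

lemma eval_pderiv_one_quartic :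
    eval ![x, y, z] (pderiv 1 (quartic c)) = quarticDy c x y z := by
  simp [quartic, quarticDy, pderiv_X]
  ring

lemma eval_pderiv_two_quartic :
    eval ![x, y, z] (pderiv 2 (quartic c)) = quarticDz c x y z := by
  simp [quartic, quarticDz, pderiv_X]
  ring

/-- The exponents of the monomials of a ternary quartic, in the order used by `quartic`. -/
noncomputable def quarticExp (k : Fin 15) : Fin 3 →₀ ℕ :=
  Finsupp.single 0 (![4, 3, 3, 2, 2, 2, 1, 1, 1, 1, 0, 0, 0, 0, 0] k)
    + Finsupp.single 1 (![0, 1, 0, 2, 1, 0, 3, 2, 1, 0, 4, 3, 2, 1, 0] k)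
    + Finsupp.single 2 (![0, 0, 1, 0, 1, 2, 0, 1, 2, 3, 0, 1, 2, 3, 4] k)

lemma quarticExp_injective : Function.Injective quarticExp := fun k l hkl => by
  have h1 := DFunLike.congr_fun hkl 1
  have h2 := DFunLike.congr_fun hkl 2
  simp [quarticExp] at h1 h2
  have key : ∀ k l : Fin 15,
      (![0, 1, 0, 2, 1, 0, 3, 2, 1, 0, 4, 3, 2, 1, 0] : Fin 15 → ℕ) k =
        (![0, 1, 0, 2, 1, 0, 3, 2, 1, 0, 4, 3, 2, 1, 0] : Fin 15 → ℕ) l →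
      (![0, 0, 1, 0, 1, 2, 0, 1, 2, 3, 0, 1, 2, 3, 4] : Fin 15 → ℕ) k =
        (![0, 0, 1, 0, 1, 2, 0, 1, 2, 3, 0, 1, 2, 3, 4] : Fin 15 → ℕ) l → k = l := by decide
  exact key k l h1 h2

lemma exists_quarticExp_eq {d : Fin 3 →₀ ℕ} (h : d 0 + d 1 + d 2 = 4) :
    ∃ k, quarticExp k = d := by
  have key : ∀ a b c : Fin 5, (a : ℕ) + b + c = 4 → ∃ k : Fin 15,
      (![4, 3, 3, 2, 2, 2, 1, 1, 1, 1, 0, 0, 0, 0, 0] : Fin 15 → ℕ) k = a ∧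
      (![0, 1, 0, 2, 1, 0, 3, 2, 1, 0, 4, 3, 2, 1, 0] : Fin 15 → ℕ) k = b ∧
      (![0, 0, 1, 0, 1, 2, 0, 1, 2, 3, 0, 1, 2, 3, 4] : Fin 15 → ℕ) k = c := by decide
  obtain ⟨k, h0, h1, h2⟩ := key ⟨d 0, by omega⟩ ⟨d 1, by omega⟩ ⟨d 2, by omega⟩ h
  refine ⟨k, ?_⟩
  ext i
  fin_cases i <;> simp [quarticExp, h0, h1, h2]

lemma sum_eq_of_isHomogeneous {p : MvPolynomial (Fin 3) R} {n : ℕ} (hp : p.IsHomogeneous n)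
    {d : Fin 3 →₀ ℕ} (hd : coeff d p ≠ 0) : d 0 + d 1 + d 2 = n := by
  have := hp hd
  simpa [Finsupp.weight_apply, Finsupp.sum_fintype, Fin.sum_univ_three] using this

/-- Reduces a form to fifteen scalars, so that nilpotency becomes a system of polynomial equations
in them. The table of exponents contains every monomial of degree 4 exactly once. -/
lemma eq_quartic {p : MvPolynomial (Fin 3) R} (hp : p.IsHomogeneous 4) :
    p = quartic fun k => coeff (quarticExp k) p := by
  have key : p = ∑ k, monomial (quarticExp k) (coeff (quarticExp k) p) := by
    rw [← Finset.sum_image (g := quarticExp) (f := fun d => monomial d (coeff d p))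
      quarticExp_injective.injOn]
    conv_lhs => rw [← support_sum_monomial_coeff p]
    refine Finset.sum_subset (fun d hd => ?_) fun d _ hd => ?_
    · obtain ⟨k, hk⟩ := exists_quarticExp_eq (sum_eq_of_isHomogeneous hp (mem_support_iff.1 hd))
      exact Finset.mem_image.2 ⟨k, Finset.mem_univ _, hk⟩
    · rw [notMem_support_iff.1 hd, monomial_zero]
  have hmon : ∀ k, ∀ r : R, monomial (quarticExp k) r = C r *
      (X 0 ^ (![4, 3, 3, 2, 2, 2, 1, 1, 1, 1, 0, 0, 0, 0, 0] : Fin 15 → ℕ) k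
        * X 1 ^ (![0, 1, 0, 2, 1, 0, 3, 2, 1, 0, 4, 3, 2, 1, 0] : Fin 15 → ℕ) k
        * X 2 ^ (![0, 0, 1, 0, 1, 2, 0, 1, 2, 3, 0, 1, 2, 3, 4] : Fin 15 → ℕ) k) := fun k r => by
    simp only [quarticExp, X_pow_eq_monomial, monomial_mul, C_mul_monomial, mul_one]
  conv_lhs => rw [key]
  simp only [hmon, Fin.sum_univ_castSucc]
  simp [quartic, Fin.castSucc, Fin.castAdd, Fin.castLE, Fin.last]
  try ring

/-- Differentiation multiplies a coefficient by its exponent in that variable, and the exponents 1,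
2, 3, 4 are invertible when 6 ≠ 0. -/
lemma coeff_eq_zero_of_pderiv_eq_zero {K : Type*} [Field K] (h6 : (6 : K) ≠ 0)
    {p : MvPolynomial (Fin 3) K} (hp : p.IsHomogeneous 4) {i : Fin 3} (h : pderiv i p = 0)
    {d : Fin 3 →₀ ℕ} (hd : d i ≠ 0) : coeff d p = 0 := by
  by_contra hc
  have hsum := sum_eq_of_isHomogeneous hp hc
  have hle : d i ≤ 4 := by fin_cases i <;> simp <;> omega
  have h1 := coeff_pderiv p (i := i) (d - Finsupp.single i 1)
  have h2 : d - Finsupp.single i 1 + Finsupp.single i 1 = d :=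
    tsub_add_cancel_of_le (by simpa using Nat.one_le_iff_ne_zero.2 hd)
  rw [h, h2, coeff_zero] at h1
  have h3 : ((d i : ℕ) : K) = 0 := by
    have := (mul_eq_zero.1 h1.symm).resolve_left hc
    rw [← this]
    have h4 : d i - 1 + 1 = d i := Nat.succ_pred_eq_of_ne_zero hd
    rw [← h4]
    simp
  generalize d i = e at hd hle h3
  interval_cases e
  · exact hd rfl
  · exact h6 (by linear_combination 6 * h3)
  · exact h6 (by push_cast at h3; linear_combination 3 * h3)
  · exact h6 (by push_cast at h3; linear_combination 2 * h3)
  · refine h6 ?_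
    have : (2 : K) = 0 := by
      push_cast at h3
      exact mul_self_eq_zero.1 (by linear_combination h3)
    linear_combination 3 * this

end ExplicitQuartics

/-! ### Comparing coefficients over an infinite field -/

section CoefficientExtraction

variable {F : Type*} [Field F] [Infinite F]

/-- Degree 8 suffices below: a 3 × 3 Jacobian determinant of quartics could have degree 9 in one
variable, but its top coefficient is the determinant of the shift matrix, which is zero. -/
lemma coeffs_eq_zero_of_forall {c0 c1 c2 c3 c4 c5 c6 c7 c8 : F}
    (h : ∀ x, c0 + c1 * x + c2 * x ^ 2 + c3 * x ^ 3 + c4 * x ^ 4 + c5 * x ^ 5 + c6 * x ^ 6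
      + c7 * x ^ 7 + c8 * x ^ 8 = 0) :
    c0 = 0 ∧ c1 = 0 ∧ c2 = 0 ∧ c3 = 0 ∧ c4 = 0 ∧ c5 = 0 ∧ c6 = 0 ∧ c7 = 0 ∧ c8 = 0 := by
  have hp : (∑ i : Fin 9, Polynomial.monomial (i : ℕ) (![c0, c1, c2, c3, c4, c5, c6, c7, c8] i))
      = 0 := by
    refine Polynomial.funext fun x => ?_
    simp [Fin.sum_univ_castSucc]
    linear_combination h x
  have hc : ∀ i : Fin 9, ![c0, c1, c2, c3, c4, c5, c6, c7, c8] i = 0 := fun i => by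
    have := congrArg (fun q => Polynomial.coeff q (i : ℕ)) hp
    simpa [Polynomial.finsetSum_coeff, Polynomial.coeff_monomial, Fin.val_inj] using this
  exact ⟨hc 0, hc 1, hc 2, hc 3, hc 4, hc 5, hc 6, hc 7, hc 8⟩

lemma binary1 {F : Type*} [Field F] (c0 c1 : F) (h : ∀ y z, c0 * y + c1 * z = 0) :
    c0 = 0 ∧ c1 = 0 :=
  ⟨by linear_combination h 1 0, by linear_combination h 0 1⟩

lemma binary2 (c0 c1 c2 : F) (h : ∀ y z, c0 * y ^ 2 + c1 * (y * z) + c2 * z ^ 2 = 0) :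
    c0 = 0 ∧ c1 = 0 ∧ c2 = 0 := by
  obtain ⟨h0, h1, h2, -⟩ := coeffs_eq_zero_of_forall (c0 := c0) (c1 := c1) (c2 := c2) (c3 := 0)
    (c4 := 0) (c5 := 0) (c6 := 0) (c7 := 0) (c8 := 0) fun x => by linear_combination h 1 x
  exact ⟨h0, h1, h2⟩

lemma binary3 (c0 c1 c2 c3 : F)
    (h : ∀ y z, c0 * y ^ 3 + c1 * (y ^ 2 * z) + c2 * (y * z ^ 2) + c3 * z ^ 3 = 0) :
    c0 = 0 ∧ c1 = 0 ∧ c2 = 0 ∧ c3 = 0 := by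
  obtain ⟨h0, h1, h2, h3, -⟩ := coeffs_eq_zero_of_forall (c0 := c0) (c1 := c1) (c2 := c2)
    (c3 := c3) (c4 := 0) (c5 := 0) (c6 := 0) (c7 := 0) (c8 := 0)
    fun x => by linear_combination h 1 x
  exact ⟨h0, h1, h2, h3⟩

lemma binary4 (c0 c1 c2 c3 c4 : F)
    (h : ∀ y z, c0 * y ^ 4 + c1 * (y ^ 3 * z) + c2 * (y ^ 2 * z ^ 2) + c3 * (y * z ^ 3)
      + c4 * z ^ 4 = 0) :
    c0 = 0 ∧ c1 = 0 ∧ c2 = 0 ∧ c3 = 0 ∧ c4 = 0 := by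
  obtain ⟨h0, h1, h2, h3, h4, -⟩ := coeffs_eq_zero_of_forall (c0 := c0) (c1 := c1) (c2 := c2)
    (c3 := c3) (c4 := c4) (c5 := 0) (c6 := 0) (c7 := 0) (c8 := 0)
    fun x => by linear_combination h 1 x
  exact ⟨h0, h1, h2, h3, h4⟩

end CoefficientExtraction

/-! ### Elimination when the Jacobian is the shift at (1, 0, 0) -/

/-- In this lemma and the next two, the Jacobian is x³E + x²S + xT + U with E the shift matrix and
the entries of S, T, U forms of degree 1, 2, 3 in y, z. The entries s₁₁ and s₂₁ are omitted because
they vanish for the maps in question. Each characteristic coefficient is split by powers of x. -/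
lemma trace_levels {F : Type*} [Field F] [Infinite F]
    {t11 u11 s22 t22 u22 s33 t33 u33 : F}
    (h : ∀ x : F, (u11 + t11 * x) + (u22 + s22 * x * x + t22 * x) +
      (u33 + s33 * x * x + t33 * x) = 0) :
    s22 + s33 = 0 ∧
    t11 + t22 + t33 = 0 ∧
    u11 + u22 + u33 = 0 := by
  have h' := coeffs_eq_zero_of_forall (F := F)
    (c0 := u11 + u22 + u33)
    (c1 := t11 + t22 + t33)
    (c2 := s22 + s33)
    (c3 := 0)
    (c4 := 0)
    (c5 := 0)
    (c6 := 0)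
    (c7 := 0)
    (c8 := 0)
    (fun x => by linear_combination h x)
  exact ⟨h'.2.2.1, h'.2.1, h'.1⟩

lemma minors_levels {F : Type*} [Field F] [Infinite F]
    {t11 u11 s12 t12 u12 s13 t13 u13 t21 u21 s22 t22 u22 s23 t23 u23 s31 t31 u31 s32 t32 u32 s33
      t33 u33 : F}
    (h : ∀ x : F, (u11 + t11 * x) * (u22 + s22 * x * x + t22 * x) - (u12 + s12 * x * x + t12 * x) *
      (u21 + x * x * x + t21 * x) + ((u11 + t11 * x) * (u33 + s33 * x * x + t33 * x) -
      (u13 + s13 * x * x + t13 * x) * (u31 + s31 * x * x + t31 * x))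
      + ((u22 + s22 * x * x + t22 * x) * (u33 + s33 * x * x + t33 * x) -
      (u23 + s23 * x * x + t23 * x) * (u32 + x * x * x + s32 * x * x + t32 * x)) = 0) :
    -s12 - s23 = 0 ∧
    -t12 - t23 - s13 * s31 + s22 * s33 - s23 * s32 = 0 ∧
    -u12 - u23 - s12 * t21 - s13 * t31 + s22 * t11 + s22 * t33 - s23 * t32 - s31 * t13 - s32 * t23
      + s33 * t11 + s33 * t22 = 0 ∧
    -s12 * u21 - s13 * u31 + s22 * u11 + s22 * u33 - s23 * u32 - s31 * u13 - s32 * u23 + s33 * u11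
      + s33 * u22 + t11 * t22 + t11 * t33 - t12 * t21 - t13 * t31 + t22 * t33 - t23 * t32 = 0 ∧
    t11 * u22 + t11 * u33 - t12 * u21 - t13 * u31 - t21 * u12 + t22 * u11 + t22 * u33 - t23 * u32
      - t31 * u13 - t32 * u23 + t33 * u11 + t33 * u22 = 0 ∧
    u11 * u22 + u11 * u33 - u12 * u21 - u13 * u31 + u22 * u33 - u23 * u32 = 0 := by
  have h' := coeffs_eq_zero_of_forall (F := F)
    (c0 := u11 * u22 + u11 * u33 - u12 * u21 - u13 * u31 + u22 * u33 - u23 * u32)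
    (c1 := t11 * u22 + t11 * u33 - t12 * u21 - t13 * u31 - t21 * u12 + t22 * u11 + t22 * u33 - t23
      * u32 - t31 * u13 - t32 * u23 + t33 * u11 + t33 * u22)
    (c2 := -s12 * u21 - s13 * u31 + s22 * u11 + s22 * u33 - s23 * u32 - s31 * u13 - s32 * u23 +
      s33 * u11 + s33 * u22 + t11 * t22 + t11 * t33 - t12 * t21 - t13 * t31 + t22 * t33 - t23 *
      t32)
    (c3 := -u12 - u23 - s12 * t21 - s13 * t31 + s22 * t11 + s22 * t33 - s23 * t32 - s31 * t13 -
      s32 * t23 + s33 * t11 + s33 * t22)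
    (c4 := -t12 - t23 - s13 * s31 + s22 * s33 - s23 * s32)
    (c5 := -s12 - s23)
    (c6 := 0)
    (c7 := 0)
    (c8 := 0)
    (fun x => by linear_combination h x)
  exact ⟨h'.2.2.2.2.2.1, h'.2.2.2.2.1, h'.2.2.2.1, h'.2.2.1, h'.2.1, h'.1⟩

/-- Only the coefficients of x⁸, x⁷, x⁶, x⁵, x⁴ and x² are kept, since the elimination needs no
others. -/
lemma det_levels {F : Type*} [Field F] [Infinite F]
    {t11 u11 s12 t12 u12 s13 t13 u13 t21 u21 s22 t22 u22 s23 t23 u23 s31 t31 u31 s32 t32 u32 s33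
      t33 u33 : F}
    (h : ∀ x : F, (u11 + t11 * x) * (u22 + s22 * x * x + t22 * x) * (u33 + s33 * x * x + t33 * x) -
      (u11 + t11 * x) * (u23 + s23 * x * x + t23 * x) * (u32 + x * x * x + s32 * x * x + t32 * x)
      - (u12 + s12 * x * x + t12 * x) * (u21 + x * x * x + t21 * x) * (u33 + s33 * x * x + t33 * x)
      + (u12 + s12 * x * x + t12 * x) * (u23 + s23 * x * x + t23 * x) *
      (u31 + s31 * x * x + t31 * x)
      + (u13 + s13 * x * x + t13 * x) * (u21 + x * x * x + t21 * x) *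
      (u32 + x * x * x + s32 * x * x + t32 * x) - (u13 + s13 * x * x + t13 * x) *
      (u22 + s22 * x * x + t22 * x) * (u31 + s31 * x * x + t31 * x) = 0) :
    s13 = 0 ∧
    t13 - s12 * s33 + s13 * s32 = 0 ∧
    u13 - s12 * t33 + s13 * t21 + s13 * t32 - s23 * t11 + s32 * t13 - s33 * t12 + s12 * s23 * s31
      - s13 * s22 * s31 = 0 ∧
    -s12 * u33 + s13 * u21 + s13 * u32 - s23 * u11 + s32 * u13 - s33 * u12 - t11 * t23 - t12 * t33
      + t13 * t21 + t13 * t32 + s12 * s23 * t31 + s12 * s31 * t23 - s12 * s33 * t21 - s13 * s22 *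
      t31 - s13 * s31 * t22 + s13 * s32 * t21 - s22 * s31 * t13 + s22 * s33 * t11 + s23 * s31 *
      t12 - s23 * s32 * t11 = 0 ∧
    -t11 * u23 - t12 * u33 + t13 * u21 + t13 * u32 + t21 * u13 - t23 * u11 + t32 * u13 - t33 * u12
      + s12 * s23 * u31 + s12 * s31 * u23 - s12 * s33 * u21 - s12 * t21 * t33 + s12 * t23 * t31 -
      s13 * s22 * u31 - s13 * s31 * u22 + s13 * s32 * u21 + s13 * t21 * t32 - s13 * t22 * t31 -
      s22 * s31 * u13 + s22 * s33 * u11 + s22 * t11 * t33 - s22 * t13 * t31 + s23 * s31 * u12 -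
      s23 * s32 * u11 - s23 * t11 * t32 + s23 * t12 * t31 + s31 * t12 * t23 - s31 * t13 * t22 -
      s32 * t11 * t23 + s32 * t13 * t21 + s33 * t11 * t22 - s33 * t12 * t21 = 0 ∧
    -s12 * u21 * u33 + s12 * u23 * u31 + s13 * u21 * u32 - s13 * u22 * u31 + s22 * u11 * u33 - s22
      * u13 * u31 - s23 * u11 * u32 + s23 * u12 * u31 + s31 * u12 * u23 - s31 * u13 * u22 - s32 *
      u11 * u23 + s32 * u13 * u21 + s33 * u11 * u22 - s33 * u12 * u21 + t11 * t22 * u33 - t11 *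
      t23 * u32 - t11 * t32 * u23 + t11 * t33 * u22 - t12 * t21 * u33 + t12 * t23 * u31 + t12 *
      t31 * u23 - t12 * t33 * u21 + t13 * t21 * u32 - t13 * t22 * u31 - t13 * t31 * u22 + t13 *
      t32 * u21 + t21 * t32 * u13 - t21 * t33 * u12 - t22 * t31 * u13 + t22 * t33 * u11 + t23 *
      t31 * u12 - t23 * t32 * u11 = 0 := by
  have h' := coeffs_eq_zero_of_forall (F := F)
    (c0 := u11 * u22 * u33 - u11 * u23 * u32 - u12 * u21 * u33 + u12 * u23 * u31 + u13 * u21 * u32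
      - u13 * u22 * u31)
    (c1 := t11 * u22 * u33 - t11 * u23 * u32 - t12 * u21 * u33 + t12 * u23 * u31 + t13 * u21 * u32
      - t13 * u22 * u31 - t21 * u12 * u33 + t21 * u13 * u32 + t22 * u11 * u33 - t22 * u13 * u31 -
      t23 * u11 * u32 + t23 * u12 * u31 + t31 * u12 * u23 - t31 * u13 * u22 - t32 * u11 * u23 +
      t32 * u13 * u21 + t33 * u11 * u22 - t33 * u12 * u21)
    (c2 := -s12 * u21 * u33 + s12 * u23 * u31 + s13 * u21 * u32 - s13 * u22 * u31 + s22 * u11 *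
      u33 - s22 * u13 * u31 - s23 * u11 * u32 + s23 * u12 * u31 + s31 * u12 * u23 - s31 * u13 *
      u22 - s32 * u11 * u23 + s32 * u13 * u21 + s33 * u11 * u22 - s33 * u12 * u21 + t11 * t22 *
      u33 - t11 * t23 * u32 - t11 * t32 * u23 + t11 * t33 * u22 - t12 * t21 * u33 + t12 * t23 *
      u31 + t12 * t31 * u23 - t12 * t33 * u21 + t13 * t21 * u32 - t13 * t22 * u31 - t13 * t31 *
      u22 + t13 * t32 * u21 + t21 * t32 * u13 - t21 * t33 * u12 - t22 * t31 * u13 + t22 * t33 *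
      u11 + t23 * t31 * u12 - t23 * t32 * u11)
    (c3 := -u11 * u23 - u12 * u33 + u13 * u21 + u13 * u32 - s12 * t21 * u33 + s12 * t23 * u31 +
      s12 * t31 * u23 - s12 * t33 * u21 + s13 * t21 * u32 - s13 * t22 * u31 - s13 * t31 * u22 +
      s13 * t32 * u21 + s22 * t11 * u33 - s22 * t13 * u31 - s22 * t31 * u13 + s22 * t33 * u11 -
      s23 * t11 * u32 + s23 * t12 * u31 + s23 * t31 * u12 - s23 * t32 * u11 + s31 * t12 * u23 -
      s31 * t13 * u22 - s31 * t22 * u13 + s31 * t23 * u12 - s32 * t11 * u23 + s32 * t13 * u21 +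
      s32 * t21 * u13 - s32 * t23 * u11 + s33 * t11 * u22 - s33 * t12 * u21 - s33 * t21 * u12 +
      s33 * t22 * u11 + t11 * t22 * t33 - t11 * t23 * t32 - t12 * t21 * t33 + t12 * t23 * t31 +
      t13 * t21 * t32 - t13 * t22 * t31)
    (c4 := -t11 * u23 - t12 * u33 + t13 * u21 + t13 * u32 + t21 * u13 - t23 * u11 + t32 * u13 -
      t33 * u12 + s12 * s23 * u31 + s12 * s31 * u23 - s12 * s33 * u21 - s12 * t21 * t33 + s12 *
      t23 * t31 - s13 * s22 * u31 - s13 * s31 * u22 + s13 * s32 * u21 + s13 * t21 * t32 - s13 *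
      t22 * t31 - s22 * s31 * u13 + s22 * s33 * u11 + s22 * t11 * t33 - s22 * t13 * t31 + s23 *
      s31 * u12 - s23 * s32 * u11 - s23 * t11 * t32 + s23 * t12 * t31 + s31 * t12 * t23 - s31 *
      t13 * t22 - s32 * t11 * t23 + s32 * t13 * t21 + s33 * t11 * t22 - s33 * t12 * t21)
    (c5 := -s12 * u33 + s13 * u21 + s13 * u32 - s23 * u11 + s32 * u13 - s33 * u12 - t11 * t23 -
      t12 * t33 + t13 * t21 + t13 * t32 + s12 * s23 * t31 + s12 * s31 * t23 - s12 * s33 * t21 -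
      s13 * s22 * t31 - s13 * s31 * t22 + s13 * s32 * t21 - s22 * s31 * t13 + s22 * s33 * t11 +
      s23 * s31 * t12 - s23 * s32 * t11)
    (c6 := u13 - s12 * t33 + s13 * t21 + s13 * t32 - s23 * t11 + s32 * t13 - s33 * t12 + s12 * s23
      * s31 - s13 * s22 * s31)
    (c7 := t13 - s12 * s33 + s13 * s32)
    (c8 := s13)
    (fun x => by linear_combination h x)
  exact ⟨h'.2.2.2.2.2.2.2.2, h'.2.2.2.2.2.2.2.1, h'.2.2.2.2.2.2.1, h'.2.2.2.2.2.1, h'.2.2.2.2.1,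
    h'.2.2.1⟩

set_option maxHeartbeats 1000000 in
-- Against the shift E, the linear part of the determinant reads off the entry (1,3), that of the
-- sum of principal minors the sum of the entries (1,2) and (2,3), and that of the trace the
-- diagonal. Applied to S, T and U in turn, these linear equations express every coefficient of a
-- monomial involving z through those of x²y², xy³ and y⁴. The lower levels then kill these for the
-- first two components, while c3, c6, c10 stay free as parameters of the normal form.
lemma coeffs_of_shift_at_point {F : Type*} [Field F] [Infinite F] (h6 : (6 : F) ≠ 0)
    {a3 a4 a5 a6 a7 a8 a9 a10 a11 a12 a13 a14 b3 b4 b5 b6 b7 b8 b9 b10 b11 b12 b13 b14 c3 c4 c5 c6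
      c7 c8 c9 c10 c11 c12 c13 c14 : F}
    {k : F} (hk : 4 * k = 1) {p q r : Fin 15 → F}
    (hp : p = ![0, 0, 0, a3, a4, a5, a6, a7, a8, a9, a10, a11, a12, a13, a14])
    (hq : q = ![k, 0, 0, b3, b4, b5, b6, b7, b8, b9, b10, b11, b12, b13, b14])
    (hr : r = ![0, 1, 0, c3, c4, c5, c6, c7, c8, c9, c10, c11, c12, c13, c14])
    (htr : ∀ x y z, quarticDx p x y z + quarticDy q x y z + quarticDz r x y z = 0)
    (he2 : ∀ x y z, quarticDx p x y z * quarticDy q x y z - quarticDy p x y z * quarticDx q x y z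
      + (quarticDx p x y z * quarticDz r x y z - quarticDz p x y z * quarticDx r x y z)
      + (quarticDy q x y z * quarticDz r x y z - quarticDz q x y z * quarticDy r x y z) = 0)
    (hdet : ∀ x y z, quarticDx p x y z * quarticDy q x y z * quarticDz r x y z
      - quarticDx p x y z * quarticDz q x y z * quarticDy r x y z
      - quarticDy p x y z * quarticDx q x y z * quarticDz r x y z
      + quarticDy p x y z * quarticDz q x y z * quarticDx r x y z
      + quarticDz p x y z * quarticDx q x y z * quarticDy r x y z
      - quarticDz p x y z * quarticDy q x y z * quarticDx r x y z = 0) :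
    a3 = 0 ∧ a4 = 0 ∧ a5 = 0 ∧ a6 = 0 ∧ a7 = 0 ∧ a8 = 0 ∧ a9 = 0 ∧ a10 = 0 ∧ a11 = 0 ∧ a12 = 0 ∧
      a13 = 0 ∧ a14 = 0 ∧ b4 = 0 ∧ b5 = 0 ∧ b7 = 0 ∧ b8 = 0 ∧ b9 = 0 ∧ b11 = 0 ∧ b12 = 0 ∧ b13 = 0
      ∧ b14 = 0 ∧ c4 = 0 ∧ c5 = 0 ∧ c7 = 0 ∧ c8 = 0 ∧ c9 = 0 ∧ c11 = 0 ∧ c12 = 0 ∧ c13 = 0 ∧ c14 =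
      0 := by
  have h2 : (2 : F) ≠ 0 := fun h => h6 (by linear_combination 3 * h)
  have h3 : (3 : F) ≠ 0 := fun h => h6 (by linear_combination 2 * h)
  have h4 : (4 : F) ≠ 0 := fun h => mul_ne_zero h2 h2 (by linear_combination h)
  have dtr := fun y z : F => trace_levels (F := F)
    (t11 := 2 * a3 * y * y + 2 * a5 * z * z + 2 * a4 * y * z)
    (u11 := a6 * y * y * y + a9 * z * z * z + a7 * y * y * z + a8 * y * z * z)
    (s22 := 2 * b3 * y + b4 * z)
    (t22 := 3 * b6 * y * y + b8 * z * z + 2 * b7 * y * z)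
    (u22 := 4 * b10 * y * y * y + b13 * z * z * z + 3 * b11 * y * y * z + 2 * b12 * y * z * z)
    (s33 := c4 * y + 2 * c5 * z)
    (t33 := c7 * y * y + 3 * c9 * z * z + 2 * c8 * y * z)
    (u33 := c11 * y * y * y + 4 * c14 * z * z * z + 2 * c12 * y * y * z + 3 * c13 * y * z * z)
    (fun x => by
      have h := htr x y z
      simp only [hp, hq, hr, quarticDx, quarticDy, quarticDz, Matrix.cons_val] at h
      linear_combination h)
  have de2 := fun y z : F => minors_levels (F := F)
    (t11 := 2 * a3 * y * y + 2 * a5 * z * z + 2 * a4 * y * z)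
    (u11 := a6 * y * y * y + a9 * z * z * z + a7 * y * y * z + a8 * y * z * z)
    (s12 := 2 * a3 * y + a4 * z)
    (t12 := 3 * a6 * y * y + a8 * z * z + 2 * a7 * y * z)
    (u12 := 4 * a10 * y * y * y + a13 * z * z * z + 3 * a11 * y * y * z + 2 * a12 * y * z * z)
    (s13 := a4 * y + 2 * a5 * z)
    (t13 := a7 * y * y + 3 * a9 * z * z + 2 * a8 * y * z)
    (u13 := a11 * y * y * y + 4 * a14 * z * z * z + 2 * a12 * y * y * z + 3 * a13 * y * z * z)
    (t21 := 2 * b3 * y * y + 2 * b5 * z * z + 2 * b4 * y * z)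
    (u21 := b6 * y * y * y + b9 * z * z * z + b7 * y * y * z + b8 * y * z * z)
    (s22 := 2 * b3 * y + b4 * z)
    (t22 := 3 * b6 * y * y + b8 * z * z + 2 * b7 * y * z)
    (u22 := 4 * b10 * y * y * y + b13 * z * z * z + 3 * b11 * y * y * z + 2 * b12 * y * z * z)
    (s23 := b4 * y + 2 * b5 * z)
    (t23 := b7 * y * y + 3 * b9 * z * z + 2 * b8 * y * z)
    (u23 := b11 * y * y * y + 4 * b14 * z * z * z + 2 * b12 * y * y * z + 3 * b13 * y * z * z)
    (s31 := 3 * y)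
    (t31 := 2 * c3 * y * y + 2 * c5 * z * z + 2 * c4 * y * z)
    (u31 := c6 * y * y * y + c9 * z * z * z + c7 * y * y * z + c8 * y * z * z)
    (s32 := 2 * c3 * y + c4 * z)
    (t32 := 3 * c6 * y * y + c8 * z * z + 2 * c7 * y * z)
    (u32 := 4 * c10 * y * y * y + c13 * z * z * z + 3 * c11 * y * y * z + 2 * c12 * y * z * z)
    (s33 := c4 * y + 2 * c5 * z)
    (t33 := c7 * y * y + 3 * c9 * z * z + 2 * c8 * y * z)
    (u33 := c11 * y * y * y + 4 * c14 * z * z * z + 2 * c12 * y * y * z + 3 * c13 * y * z * z)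
    (fun x => by
      have h := he2 x y z
      simp only [hp, hq, hr, quarticDx, quarticDy, quarticDz, Matrix.cons_val, hk, one_mul] at h
      linear_combination h)
  have ddet := fun y z : F => det_levels (F := F)
    (t11 := 2 * a3 * y * y + 2 * a5 * z * z + 2 * a4 * y * z)
    (u11 := a6 * y * y * y + a9 * z * z * z + a7 * y * y * z + a8 * y * z * z)
    (s12 := 2 * a3 * y + a4 * z)
    (t12 := 3 * a6 * y * y + a8 * z * z + 2 * a7 * y * z)
    (u12 := 4 * a10 * y * y * y + a13 * z * z * z + 3 * a11 * y * y * z + 2 * a12 * y * z * z)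
    (s13 := a4 * y + 2 * a5 * z)
    (t13 := a7 * y * y + 3 * a9 * z * z + 2 * a8 * y * z)
    (u13 := a11 * y * y * y + 4 * a14 * z * z * z + 2 * a12 * y * y * z + 3 * a13 * y * z * z)
    (t21 := 2 * b3 * y * y + 2 * b5 * z * z + 2 * b4 * y * z)
    (u21 := b6 * y * y * y + b9 * z * z * z + b7 * y * y * z + b8 * y * z * z)
    (s22 := 2 * b3 * y + b4 * z)
    (t22 := 3 * b6 * y * y + b8 * z * z + 2 * b7 * y * z)
    (u22 := 4 * b10 * y * y * y + b13 * z * z * z + 3 * b11 * y * y * z + 2 * b12 * y * z * z)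
    (s23 := b4 * y + 2 * b5 * z)
    (t23 := b7 * y * y + 3 * b9 * z * z + 2 * b8 * y * z)
    (u23 := b11 * y * y * y + 4 * b14 * z * z * z + 2 * b12 * y * y * z + 3 * b13 * y * z * z)
    (s31 := 3 * y)
    (t31 := 2 * c3 * y * y + 2 * c5 * z * z + 2 * c4 * y * z)
    (u31 := c6 * y * y * y + c9 * z * z * z + c7 * y * y * z + c8 * y * z * z)
    (s32 := 2 * c3 * y + c4 * z)
    (t32 := 3 * c6 * y * y + c8 * z * z + 2 * c7 * y * z)
    (u32 := 4 * c10 * y * y * y + c13 * z * z * z + 3 * c11 * y * y * z + 2 * c12 * y * z * z)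
    (s33 := c4 * y + 2 * c5 * z)
    (t33 := c7 * y * y + 3 * c9 * z * z + 2 * c8 * y * z)
    (u33 := c11 * y * y * y + 4 * c14 * z * z * z + 2 * c12 * y * y * z + 3 * c13 * y * z * z)
    (fun x => by
      have h := hdet x y z
      simp only [hp, hq, hr, quarticDx, quarticDy, quarticDz, Matrix.cons_val, hk, one_mul] at h
      linear_combination h)
  clear htr he2 hdet hp hq hr p q r
  -- Three rounds follow, for S, T and U. Each uses the highest levels of the determinant, the
  -- minors and the trace not yet exploited, which are linear in the new unknowns modulo those
  -- already solved for.
  obtain ⟨e0, e1⟩ := binary1 (F := F)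
    (a4)
    (2 * a5)
    (fun y z => by linear_combination (ddet y z).1)
  obtain rfl : a4 = 0 := by linear_combination e0
  obtain rfl : a5 = 0 :=
    mul_left_cancel₀ h2 (by linear_combination e1)
  obtain ⟨e2, e3⟩ := binary1 (F := F)
    (-2 * a3 - b4)
    (-2 * b5)
    (fun y z => by linear_combination (de2 y z).1)
  obtain rfl : b4 = -2 * a3 := by linear_combination -e2
  obtain rfl : b5 = 0 :=
    mul_left_cancel₀ h2 (by linear_combination -e3)
  obtain ⟨e4, e5⟩ := binary1 (F := F)
    (2 * b3 + c4)
    (-2 * a3 + 2 * c5)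
    (fun y z => by linear_combination (dtr y z).1)
  obtain rfl : c4 = -2 * b3 := by linear_combination e4
  obtain rfl : a3 = c5 :=
    mul_left_cancel₀ h2 (by linear_combination -e5)
  obtain ⟨e6, e7, e8⟩ := binary2 (F := F)
    (a7 + 4 * a3 * b3)
    (-4 * a3 * a3 + 2 * a8)
    (3 * a9)
    (fun y z => by linear_combination (ddet y z).2.1)
  obtain rfl : a7 = -4 * a3 * b3 := by linear_combination e6
  obtain rfl : a8 = 2 * a3 * a3 :=
    mul_left_cancel₀ h2 (by linear_combination e7)
  obtain rfl : a9 = 0 :=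
    mul_left_cancel₀ h3 (by linear_combination e8)
  obtain ⟨e9, e10, e11⟩ := binary2 (F := F)
    (-3 * a6 - 4 * b3 * b3 - b7 + 4 * a3 * c3)
    (-2 * b8 + 12 * a3 * b3)
    (-6 * a3 * a3 - 3 * b9)
    (fun y z => by linear_combination (de2 y z).2.1)
  obtain rfl : b7 = -3 * a6 - 4 * b3 * b3 + 4 * a3 * c3 := by linear_combination -e9
  obtain rfl : b8 = 6 * a3 * b3 :=
    mul_left_cancel₀ h2 (by linear_combination -e10)
  obtain rfl : b9 = -2 * a3 * a3 :=
    mul_left_cancel₀ h3 (by linear_combination -e11)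
  obtain ⟨e12, e13, e14⟩ := binary2 (F := F)
    (2 * a3 + 3 * b6 + c7)
    (-6 * a6 - 8 * b3 * b3 + 2 * c8 + 8 * a3 * c3)
    (3 * c9 + 6 * a3 * b3)
    (fun y z => by linear_combination (dtr y z).2.1)
  obtain rfl : c7 = -2 * a3 - 3 * b6 := by linear_combination e12
  obtain rfl : c8 = 3 * a6 + 4 * b3 * b3 - 4 * a3 * c3 :=
    mul_left_cancel₀ h2 (by linear_combination e13)
  obtain rfl : c9 = -2 * a3 * b3 :=
    mul_left_cancel₀ h3 (by linear_combination e14)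
  obtain ⟨e15, e16, e17, e18⟩ := binary3 (F := F)
    (a11 - 4 * a3 * a3 + 6 * a3 * b6 + 6 * a6 * b3 - 8 * a3 * b3 * c3)
    (2 * a12 - 18 * a3 * a6 - 24 * a3 * b3 * b3 + 24 * a3 * a3 * c3)
    (3 * a13 + 24 * a3 * a3 * b3)
    (4 * a14 - 4 * a3 * a3 * a3)
    (fun y z => by linear_combination (ddet y z).2.2.1)
  obtain rfl : a11 = 4 * a3 * a3 - 6 * a3 * b6 - 6 * a6 * b3 + 8 * a3 * b3 * c3 := by
    linear_combination e15
  obtain rfl : a12 = 9 * a3 * a6 + 12 * a3 * b3 * b3 - 12 * a3 * a3 * c3 :=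
    mul_left_cancel₀ h2 (by linear_combination e16)
  obtain rfl : a13 = -8 * a3 * a3 * b3 :=
    mul_left_cancel₀ h3 (by linear_combination e17)
  obtain rfl : a14 = a3 * a3 * a3 :=
    mul_left_cancel₀ h4 (by linear_combination e18)
  obtain ⟨e19, e20, e21, e22⟩ := binary3 (F := F)
    (-4 * a10 - b11 + 4 * a3 * b3 - 8 * a3 * c3 * c3 + 6 * a3 * c6 + 6 * a6 * c3 - 12 * b3 * b6 +
      8 * b3 * b3 * c3)
    (-20 * a3 * a3 - 2 * b12 + 24 * b3 * b3 * b3 + 18 * a3 * b6 + 36 * a6 * b3 - 72 * a3 * b3 *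
      c3)
    (-3 * b13 - 36 * a3 * a6 - 48 * a3 * b3 * b3 + 60 * a3 * a3 * c3)
    (-4 * b14 + 20 * a3 * a3 * b3)
    (fun y z => by linear_combination (de2 y z).2.2.1)
  obtain rfl : b11 = -4 * a10 + 4 * a3 * b3 - 8 * a3 * c3 * c3 + 6 * a3 * c6 + 6 * a6 * c3 - 12 *
    b3 * b6 + 8 * b3 * b3 * c3 := by linear_combination -e19
  obtain rfl : b12 = -10 * a3 * a3 + 12 * b3 * b3 * b3 + 9 * a3 * b6 + 18 * a6 * b3 - 36 * a3 * b3
    * c3 :=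
    mul_left_cancel₀ h2 (by linear_combination -e20)
  obtain rfl : b13 = -12 * a3 * a6 - 16 * a3 * b3 * b3 + 20 * a3 * a3 * c3 :=
    mul_left_cancel₀ h3 (by linear_combination -e21)
  obtain rfl : b14 = 5 * a3 * a3 * b3 :=
    mul_left_cancel₀ h4 (by linear_combination -e22)
  obtain ⟨e23, e24, e25, e26⟩ := binary3 (F := F)
    (a6 + 4 * b10 + c11)
    (-12 * a10 + 2 * c12 + 8 * a3 * b3 - 24 * a3 * c3 * c3 + 18 * a3 * c6 + 18 * a6 * c3 - 36 * b3
      * b6 + 24 * b3 * b3 * c3)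
    (-18 * a3 * a3 + 24 * b3 * b3 * b3 + 3 * c13 + 18 * a3 * b6 + 36 * a6 * b3 - 72 * a3 * b3 *
      c3)
    (4 * c14 - 12 * a3 * a6 - 16 * a3 * b3 * b3 + 20 * a3 * a3 * c3)
    (fun y z => by linear_combination (dtr y z).2.2)
  obtain rfl : c11 = -a6 - 4 * b10 := by linear_combination e23
  obtain rfl : c12 = 6 * a10 - 4 * a3 * b3 + 12 * a3 * c3 * c3 - 9 * a3 * c6 - 9 * a6 * c3 + 18 *
    b3 * b6 - 12 * b3 * b3 * c3 :=
    mul_left_cancel₀ h2 (by linear_combination e24)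
  obtain rfl : c13 = 6 * a3 * a3 - 8 * b3 * b3 * b3 - 6 * a3 * b6 - 12 * a6 * b3 + 24 * a3 * b3 *
    c3 :=
    mul_left_cancel₀ h3 (by linear_combination e25)
  obtain rfl : c14 = 3 * a3 * a6 + 4 * a3 * b3 * b3 - 5 * a3 * a3 * c3 :=
    mul_left_cancel₀ h4 (by linear_combination e26)
  -- Only the coefficients with index 3, 6, 10 are left, and all further equations are nonlinear. If
  -- a3 ≠ 0, then b3, c3 and a6 are forced to vanish, and two equations linear in b6 become
  -- incompatible.
  obtain rfl : a3 = 0 := by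
    by_contra ha
    have f1 : 96 * a3 * a3 * a3 * a3 * a3 * b3 = 0 := by linear_combination (ddet 0 1).2.2.2.2.2
    obtain rfl : b3 = 0 := by simpa [ha, h2, h3, show (96 : F) = 2 ^ 5 * 3 by norm_num] using f1
    have f2 : -12 * a3 * a3 * a3 * a6 + 24 * a3 * a3 * a3 * a3 * c3 = 0 := by
      linear_combination (ddet 0 1).2.2.2.2.1
    obtain rfl : a6 = 2 * a3 * c3 :=
      mul_left_cancel₀ (a := 2 ^ 2 * 3 * a3 ^ 3) (by simp [ha, h2, h3])
        (by linear_combination -f2)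
    have f3 : -4 * a3 * a3 * a3 * c3 = 0 := by linear_combination (de2 0 1).2.2.2.1
    obtain rfl : c3 = 0 := by simpa [ha, h4] using f3
    have f4 : 32 * a3 * a3 * a3 * a3 - 36 * a3 * a3 * a3 * b6 = 0 := by
      linear_combination (de2 0 1).2.2.2.2.1
    obtain ⟨-, -, e29, -, -⟩ := binary4 (F := F)
      (8 * a3 * b10)
      (-32 * a10 * a3 + 48 * a3 * a3 * c6)
      (-96 * a3 * a3 * a3 + 54 * a3 * a3 * b6)
      (0)
      (0)
      (fun y z => by linear_combination (ddet y z).2.2.2.1)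
    -- The multipliers are chosen to cancel b6.
    have f5 : (2 ^ 5 * 3) * a3 ^ 4 = 0 := by linear_combination -3 * f4 - 2 * a3 * e29
    simp [ha, h2, h3] at f5
  obtain ⟨-, -, e34, -, -⟩ := binary4 (F := F)
    (-9 * b6 * b6 + 8 * a10 * c3 + 10 * a6 * b3 - 12 * a6 * c3 * c3 + 9 * a6 * c6 - 16 * b10 * b3
      - 16 * b3 * b3 * c3 * c3 + 12 * b3 * b3 * c6 + 24 * b3 * b6 * c3)
    (40 * a10 * b3 + 18 * a6 * b6 + 144 * b3 * b3 * b6 - 128 * b3 * b3 * b3 * c3 - 132 * a6 * b3 *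
      c3)
    (-27 * a6 * a6 - 96 * b3 * b3 * b3 * b3 - 144 * a6 * b3 * b3)
    (0)
    (0)
    (fun y z => by linear_combination (de2 y z).2.2.2.1)
  obtain ⟨-, e38, -, -, -⟩ := binary4 (F := F)
    (8 * a10 * b3 + 9 * a6 * b6 - 12 * a6 * b3 * c3)
    (-18 * a6 * a6 - 48 * a6 * b3 * b3)
    (0)
    (0)
    (0)
    (fun y z => by linear_combination (ddet y z).2.2.2.1)
  -- Eliminating a6² between the two relations leaves 48·b3²(4b3² + 3a6) = 0. Substituting this back
  -- first gives a6 = 0 and then b3 = 0.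
  obtain rfl : b3 = 0 := by
    by_contra hb
    have g3 : 3 * a6 = -4 * b3 ^ 2 :=
      mul_left_cancel₀ (a := 2 ^ 4 * 3 * b3 ^ 2) (by simp [hb, h2, h3])
        (by linear_combination -2 * e34 + 3 * e38)
    have g4 : a6 = 0 := by
      have : (2 ^ 3 * 3) * b3 ^ 2 * a6 = 0 := by linear_combination -e38 - 6 * a6 * g3
      simpa [hb, h2, h3] using this
    rw [g4] at g3
    have g5 : 4 * b3 ^ 2 = 0 := by linear_combination g3
    simp [hb, h4] at g5
  -- Each remaining unknown now satisfies an equation saying that a unit times its square is zero.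
  obtain rfl : a6 = 0 := by
    have : (2 * 3 ^ 2) * a6 ^ 2 = 0 := by linear_combination -e38
    simpa [h2, h3] using this
  obtain rfl : a10 = 0 := by
    have : (2 ^ 4 * 3) * a10 ^ 2 = 0 := by linear_combination -(ddet 1 0).2.2.2.2.2
    simpa [h2, h3] using this
  obtain rfl : b6 = 0 := by
    have : (3 ^ 2) * b6 ^ 2 = 0 := by linear_combination -(de2 1 0).2.2.2.1
    simpa [h2, h3] using this
  obtain rfl : b10 = 0 := by
    have : (2 ^ 4) * b10 ^ 2 = 0 := by linear_combination -(de2 1 0).2.2.2.2.2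
    simpa [h2, h3] using this
  simp

/-! ### Elimination when the Jacobian is the shift at (0, 1, 0) and kills the map -/

set_option maxHeartbeats 1000000 in
-- The rows of NH = 0 are expanded in powers of y. Because r contains k·y⁴ with k = 1/4, the high
-- powers of y give, row by row, equations linear in coefficients of decreasing y-degree. Besides
-- the three rows, only the vanishing trace is needed: it fixes a3 = 1/2, which a remaining equation
-- of the first row excludes.
lemma false_of_shift_at_point_of_jacobian_mulVec_self_eq_zero {F : Type*} [Field F] [Infinite F]
    (h6 : (6 : F) ≠ 0)
    {a0 a1 a2 a3 a4 a5 a7 a8 a9 a12 a13 a14 b0 b1 b2 b3 b4 b5 b7 b8 b9 b12 b13 b14 c0 c1 c2 c3 c4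
      c5 c7 c8 c9 c12 c13 c14 k : F} (hk : 4 * k = 1)
    {p q r : Fin 15 → F}
    (hp : p = ![a0, a1, a2, a3, a4, a5, 0, a7, a8, a9, 0, 0, a12, a13, a14])
    (hq : q = ![b0, b1, b2, b3, b4, b5, 1, b7, b8, b9, 0, 0, b12, b13, b14])
    (hr : r = ![c0, c1, c2, c3, c4, c5, 0, c7, c8, c9, k, 0, c12, c13, c14])
    (htr : ∀ x y z, quarticDx p x y z + quarticDy q x y z + quarticDz r x y z = 0)
    (h0 : ∀ x y z, quarticDx p x y z * quarticEval p x y z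
      + quarticDy p x y z * quarticEval q x y z + quarticDz p x y z * quarticEval r x y z = 0)
    (h1 : ∀ x y z, quarticDx q x y z * quarticEval p x y z
      + quarticDy q x y z * quarticEval q x y z + quarticDz q x y z * quarticEval r x y z = 0)
    (h2n : ∀ x y z, quarticDx r x y z * quarticEval p x y z
      + quarticDy r x y z * quarticEval q x y z + quarticDz r x y z * quarticEval r x y z = 0) :
    False := by
  have h2 : (2 : F) ≠ 0 := fun h => h6 (by linear_combination 3 * h)
  have h3 : (3 : F) ≠ 0 := fun h => h6 (by linear_combination 2 * h)
  have h4 : (4 : F) ≠ 0 := fun h => mul_ne_zero h2 h2 (by linear_combination h)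
  subst hp hq hr
  have d := fun x z : F => coeffs_eq_zero_of_forall (F := F)
    (c0 := 4 * a0 * a0 * x * x * x * x * x * x * x + a1 * b0 * x * x * x * x * x * x * x + a13 *
      b14 * z * z * z * z * z * z * z + a14 * a9 * z * z * z * z * z * z * z + 4 * a14 * c14 * z *
      z * z * z * z * z * z + a2 * c0 * x * x * x * x * x * x * x + 3 * a2 * a2 * x * x * x * x *
      x * z * z + 2 * a5 * a5 * x * x * x * z * z * z * z + a9 * a9 * x * z * z * z * z * z * z +
      4 * a0 * a14 * x * x * x * z * z * z * z + 7 * a0 * a2 * x * x * x * x * x * x * z + 6 * a0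
      * a5 * x * x * x * x * x * z * z + 5 * a0 * a9 * x * x * x * x * z * z * z + a1 * b14 * x *
      x * x * z * z * z * z + a1 * b2 * x * x * x * x * x * x * z + a1 * b5 * x * x * x * x * x *
      z * z + a1 * b9 * x * x * x * x * z * z * z + a13 * b0 * x * x * x * x * z * z * z + a13 *
      b2 * x * x * x * z * z * z * z + a13 * b5 * x * x * z * z * z * z * z + a13 * b9 * x * z * z
      * z * z * z * z + 3 * a14 * a2 * x * x * z * z * z * z * z + 2 * a14 * a5 * x * z * z * z *
      z * z * z + 4 * a14 * c0 * x * x * x * x * z * z * z + 4 * a14 * c2 * x * x * x * z * z * z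
      * z + 4 * a14 * c5 * x * x * z * z * z * z * z + 4 * a14 * c9 * x * z * z * z * z * z * z +
      5 * a2 * a5 * x * x * x * x * z * z * z + 4 * a2 * a9 * x * x * x * z * z * z * z + a2 * c14
      * x * x * x * z * z * z * z + a2 * c2 * x * x * x * x * x * x * z + a2 * c5 * x * x * x * x
      * x * z * z + a2 * c9 * x * x * x * x * z * z * z + a4 * b0 * x * x * x * x * x * x * z + a4
      * b14 * x * x * z * z * z * z * z + a4 * b2 * x * x * x * x * x * z * z + a4 * b5 * x * x *
      x * x * z * z * z + a4 * b9 * x * x * x * z * z * z * z + 3 * a5 * a9 * x * x * z * z * z *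
      z * z + 2 * a5 * c0 * x * x * x * x * x * x * z + 2 * a5 * c14 * x * x * z * z * z * z * z +
      2 * a5 * c2 * x * x * x * x * x * z * z + 2 * a5 * c5 * x * x * x * x * z * z * z + 2 * a5 *
      c9 * x * x * x * z * z * z * z + a8 * b0 * x * x * x * x * x * z * z + a8 * b14 * x * z * z
      * z * z * z * z + a8 * b2 * x * x * x * x * z * z * z + a8 * b5 * x * x * x * z * z * z * z
      + a8 * b9 * x * x * z * z * z * z * z + 3 * a9 * c0 * x * x * x * x * x * z * z + 3 * a9 *
      c14 * x * z * z * z * z * z * z + 3 * a9 * c2 * x * x * x * x * z * z * z + 3 * a9 * c5 * x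
      * x * x * z * z * z * z + 3 * a9 * c9 * x * x * z * z * z * z * z)
    (c1 := 7 * a0 * a1 * x * x * x * x * x * x + a1 * b1 * x * x * x * x * x * x + 2 * a12 * b14 *
      z * z * z * z * z * z + a13 * a9 * z * z * z * z * z * z + a13 * b13 * z * z * z * z * z * z
      + 3 * a13 * c14 * z * z * z * z * z * z + a14 * a8 * z * z * z * z * z * z + 4 * a14 * c13 *
      z * z * z * z * z * z + a2 * c1 * x * x * x * x * x * x + 2 * a3 * b0 * x * x * x * x * x *
      x + a4 * c0 * x * x * x * x * x * x + 4 * a0 * a13 * x * x * x * z * z * z + 6 * a0 * a4 * x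
      * x * x * x * x * z + 5 * a0 * a8 * x * x * x * x * z * z + 3 * a1 * a14 * x * x * z * z * z
      * z + 6 * a1 * a2 * x * x * x * x * x * z + 5 * a1 * a5 * x * x * x * x * z * z + 4 * a1 *
      a9 * x * x * x * z * z * z + a1 * b13 * x * x * x * z * z * z + a1 * b4 * x * x * x * x * x
      * z + a1 * b8 * x * x * x * x * z * z + 2 * a12 * b0 * x * x * x * x * z * z + 2 * a12 * b2
      * x * x * x * z * z * z + 2 * a12 * b5 * x * x * z * z * z * z + 2 * a12 * b9 * x * z * z *
      z * z * z + 3 * a13 * a2 * x * x * z * z * z * z + 2 * a13 * a5 * x * z * z * z * z * z +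
      a13 * b1 * x * x * x * z * z * z + a13 * b4 * x * x * z * z * z * z + a13 * b8 * x * z * z *
      z * z * z + 3 * a13 * c0 * x * x * x * x * z * z + 3 * a13 * c2 * x * x * x * z * z * z + 3
      * a13 * c5 * x * x * z * z * z * z + 3 * a13 * c9 * x * z * z * z * z * z + 2 * a14 * a4 * x
      * z * z * z * z * z + 4 * a14 * c1 * x * x * x * z * z * z + 4 * a14 * c4 * x * x * z * z *
      z * z + 4 * a14 * c8 * x * z * z * z * z * z + 5 * a2 * a4 * x * x * x * x * z * z + 4 * a2
      * a8 * x * x * x * z * z * z + a2 * c13 * x * x * x * z * z * z + a2 * c4 * x * x * x * x *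
      x * z + a2 * c8 * x * x * x * x * z * z + 2 * a3 * b14 * x * x * z * z * z * z + 2 * a3 * b2
      * x * x * x * x * x * z + 2 * a3 * b5 * x * x * x * x * z * z + 2 * a3 * b9 * x * x * x * z
      * z * z + 4 * a4 * a5 * x * x * x * z * z * z + 3 * a4 * a9 * x * x * z * z * z * z + a4 *
      b1 * x * x * x * x * x * z + a4 * b13 * x * x * z * z * z * z + a4 * b4 * x * x * x * x * z
      * z + a4 * b8 * x * x * x * z * z * z + a4 * c14 * x * x * z * z * z * z + a4 * c2 * x * x *
      x * x * x * z + a4 * c5 * x * x * x * x * z * z + a4 * c9 * x * x * x * z * z * z + 3 * a5 *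
      a8 * x * x * z * z * z * z + 2 * a5 * c1 * x * x * x * x * x * z + 2 * a5 * c13 * x * x * z
      * z * z * z + 2 * a5 * c4 * x * x * x * x * z * z + 2 * a5 * c8 * x * x * x * z * z * z + 2
      * a7 * b0 * x * x * x * x * x * z + 2 * a7 * b14 * x * z * z * z * z * z + 2 * a7 * b2 * x *
      x * x * x * z * z + 2 * a7 * b5 * x * x * x * z * z * z + 2 * a7 * b9 * x * x * z * z * z *
      z + 2 * a8 * a9 * x * z * z * z * z * z + a8 * b1 * x * x * x * x * z * z + a8 * b13 * x * z
      * z * z * z * z + a8 * b4 * x * x * x * z * z * z + a8 * b8 * x * x * z * z * z * z + 2 * a8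
      * c0 * x * x * x * x * x * z + 2 * a8 * c14 * x * z * z * z * z * z + 2 * a8 * c2 * x * x *
      x * x * z * z + 2 * a8 * c5 * x * x * x * z * z * z + 2 * a8 * c9 * x * x * z * z * z * z +
      3 * a9 * c1 * x * x * x * x * z * z + 3 * a9 * c13 * x * z * z * z * z * z + 3 * a9 * c4 * x
      * x * x * z * z * z + 3 * a9 * c8 * x * x * z * z * z * z)
    (c2 := 3 * a1 * a1 * x * x * x * x * x + 6 * a0 * a3 * x * x * x * x * x + a1 * b3 * x * x * x
      * x * x + a12 * a9 * z * z * z * z * z + 2 * a12 * b13 * z * z * z * z * z + 2 * a12 * c14 *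
      z * z * z * z * z + a13 * a8 * z * z * z * z * z + a13 * b12 * z * z * z * z * z + 3 * a13 *
      c13 * z * z * z * z * z + a14 * a7 * z * z * z * z * z + 4 * a14 * c12 * z * z * z * z * z +
      a2 * c3 * x * x * x * x * x + 2 * a3 * b1 * x * x * x * x * x + a4 * c1 * x * x * x * x * x
      + 2 * a4 * a4 * x * x * x * z * z + a7 * c0 * x * x * x * x * x + a8 * a8 * x * z * z * z *
      z + 4 * a0 * a12 * x * x * x * z * z + 5 * a0 * a7 * x * x * x * x * z + 3 * a1 * a13 * x *
      x * z * z * z + 5 * a1 * a4 * x * x * x * x * z + 4 * a1 * a8 * x * x * x * z * z + a1 * b12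
      * x * x * x * z * z + a1 * b7 * x * x * x * x * z + 3 * a12 * a2 * x * x * z * z * z + 2 *
      a12 * a5 * x * z * z * z * z + 2 * a12 * b1 * x * x * x * z * z + 2 * a12 * b4 * x * x * z *
      z * z + 2 * a12 * b8 * x * z * z * z * z + 2 * a12 * c0 * x * x * x * x * z + 2 * a12 * c2 *
      x * x * x * z * z + 2 * a12 * c5 * x * x * z * z * z + 2 * a12 * c9 * x * z * z * z * z + 2
      * a13 * a4 * x * z * z * z * z + a13 * b3 * x * x * z * z * z + a13 * b7 * x * z * z * z * z
      + 3 * a13 * c1 * x * x * x * z * z + 3 * a13 * c4 * x * x * z * z * z + 3 * a13 * c8 * x * z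
      * z * z * z + 2 * a14 * a3 * x * z * z * z * z + 4 * a14 * c3 * x * x * z * z * z + 4 * a14
      * c7 * x * z * z * z * z + 5 * a2 * a3 * x * x * x * x * z + 4 * a2 * a7 * x * x * x * z * z
      + a2 * c12 * x * x * x * z * z + a2 * c7 * x * x * x * x * z + 4 * a3 * a5 * x * x * x * z *
      z + 3 * a3 * a9 * x * x * z * z * z + 2 * a3 * b13 * x * x * z * z * z + 2 * a3 * b4 * x * x
      * x * x * z + 2 * a3 * b8 * x * x * x * z * z + 3 * a4 * a8 * x * x * z * z * z + a4 * b12 *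
      x * x * z * z * z + a4 * b3 * x * x * x * x * z + a4 * b7 * x * x * x * z * z + a4 * c13 * x
      * x * z * z * z + a4 * c4 * x * x * x * x * z + a4 * c8 * x * x * x * z * z + 3 * a5 * a7 *
      x * x * z * z * z + 2 * a5 * c12 * x * x * z * z * z + 2 * a5 * c3 * x * x * x * x * z + 2 *
      a5 * c7 * x * x * x * z * z + 2 * a7 * a9 * x * z * z * z * z + 2 * a7 * b1 * x * x * x * x
      * z + 2 * a7 * b13 * x * z * z * z * z + 2 * a7 * b4 * x * x * x * z * z + 2 * a7 * b8 * x *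
      x * z * z * z + a7 * c14 * x * z * z * z * z + a7 * c2 * x * x * x * x * z + a7 * c5 * x * x
      * x * z * z + a7 * c9 * x * x * z * z * z + a8 * b12 * x * z * z * z * z + a8 * b3 * x * x *
      x * z * z + a8 * b7 * x * x * z * z * z + 2 * a8 * c1 * x * x * x * x * z + 2 * a8 * c13 * x
      * z * z * z * z + 2 * a8 * c4 * x * x * x * z * z + 2 * a8 * c8 * x * x * z * z * z + 3 * a9
      * c12 * x * z * z * z * z + 3 * a9 * c3 * x * x * x * z * z + 3 * a9 * c7 * x * x * z * z *
      z)
    (c3 := a1 * x * x * x * x + 5 * a1 * a3 * x * x * x * x + a12 * a8 * z * z * z * z + 2 * a12 *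
      b12 * z * z * z * z + 2 * a12 * c13 * z * z * z * z + a13 * a7 * z * z * z * z + 3 * a13 *
      c12 * z * z * z * z + a13 * x * z * z * z + 2 * a3 * b3 * x * x * x * x + a4 * c3 * x * x *
      x * x + a4 * x * x * x * z + a7 * c1 * x * x * x * x + a8 * x * x * z * z + 3 * a1 * a12 * x
      * x * z * z + 4 * a1 * a7 * x * x * x * z + 2 * a12 * a4 * x * z * z * z + 2 * a12 * b3 * x
      * x * z * z + 2 * a12 * b7 * x * z * z * z + 2 * a12 * c1 * x * x * x * z + 2 * a12 * c4 * x
      * x * z * z + 2 * a12 * c8 * x * z * z * z + 2 * a13 * a3 * x * z * z * z + 3 * a13 * c3 * x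
      * x * z * z + 3 * a13 * c7 * x * z * z * z + 4 * a3 * a4 * x * x * x * z + 3 * a3 * a8 * x *
      x * z * z + 2 * a3 * b12 * x * x * z * z + 2 * a3 * b7 * x * x * x * z + 3 * a4 * a7 * x * x
      * z * z + a4 * c12 * x * x * z * z + a4 * c7 * x * x * x * z + 2 * a7 * a8 * x * z * z * z +
      2 * a7 * b12 * x * z * z * z + 2 * a7 * b3 * x * x * x * z + 2 * a7 * b7 * x * x * z * z +
      a7 * c13 * x * z * z * z + a7 * c4 * x * x * x * z + a7 * c8 * x * x * z * z + 2 * a8 * c12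
      * x * z * z * z + 2 * a8 * c3 * x * x * x * z + 2 * a8 * c7 * x * x * z * z)
    (c4 := 2 * a3 * x * x * x + 2 * a3 * a3 * x * x * x + a12 * a7 * z * z * z + 2 * a12 * c12 * z
      * z * z + 2 * a12 * x * z * z + 4 * a14 * k * z * z * z + a2 * k * x * x * x + a7 * c3 * x *
      x * x + 2 * a7 * x * x * z + a7 * a7 * x * z * z + 2 * a12 * a3 * x * z * z + 2 * a12 * c3 *
      x * x * z + 2 * a12 * c7 * x * z * z + 3 * a3 * a7 * x * x * z + 2 * a5 * k * x * x * z + a7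
      * c12 * x * z * z + a7 * c7 * x * x * z + 3 * a9 * k * x * z * z)
    (c5 := 3 * a13 * k * z * z + a4 * k * x * x + 2 * a8 * k * x * z)
    (c6 := 2 * a12 * k * z + a7 * k * x)
    (c7 := 0)
    (c8 := 0)
    (fun y => by
      have h := h0 x y z
      simp only [quarticDx, quarticDy, quarticDz, quarticEval, Matrix.cons_val] at h
      linear_combination h)
  -- First row, coefficients of y⁶ and y⁵. Multiplying by 4 undoes the factor k, here and below.
  obtain ⟨e0, e1⟩ := binary1 (F := F)
    (a7 * k)
    (2 * a12 * k)
    (fun x z => by linear_combination (d x z).2.2.2.2.2.2.1)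
  obtain rfl : a7 = 0 :=
    by linear_combination 4 * e0 - (a7) * hk
  clear e0
  obtain rfl : a12 = 0 :=
    mul_left_cancel₀ h2 (by linear_combination 4 * e1 - (2 * a12) * hk)
  clear e1
  obtain ⟨e2, e3, e4⟩ := binary2 (F := F)
    (a4 * k)
    (2 * a8 * k)
    (3 * a13 * k)
    (fun x z => by linear_combination (d x z).2.2.2.2.2.1)
  clear d
  obtain rfl : a4 = 0 :=
    by linear_combination 4 * e2 - (a4) * hk
  clear e2
  obtain rfl : a8 = 0 :=
    mul_left_cancel₀ h2 (by linear_combination 4 * e3 - (2 * a8) * hk)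
  clear e3
  obtain rfl : a13 = 0 :=
    mul_left_cancel₀ h3 (by linear_combination 4 * e4 - (3 * a13) * hk)
  clear e4
  have d := fun x z : F => coeffs_eq_zero_of_forall (F := F)
    (c0 := 4 * c14 * c14 * z * z * z * z * z * z * z + 4 * a0 * c0 * x * x * x * x * x * x * x +
      a14 * c9 * z * z * z * z * z * z * z + b0 * c1 * x * x * x * x * x * x * x + b14 * c13 * z *
      z * z * z * z * z * z + c0 * c2 * x * x * x * x * x * x * x + c2 * c2 * x * x * x * x * x *
      x * z + 2 * c5 * c5 * x * x * x * x * z * z * z + 3 * c9 * c9 * x * x * z * z * z * z * z +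
      3 * a0 * c2 * x * x * x * x * x * x * z + 2 * a0 * c5 * x * x * x * x * x * z * z + a0 * c9
      * x * x * x * x * z * z * z + 4 * a14 * c0 * x * x * x * z * z * z * z + 3 * a14 * c2 * x *
      x * z * z * z * z * z + 2 * a14 * c5 * x * z * z * z * z * z * z + 4 * a2 * c0 * x * x * x *
      x * x * x * z + 3 * a2 * c2 * x * x * x * x * x * z * z + 2 * a2 * c5 * x * x * x * x * z *
      z * z + a2 * c9 * x * x * x * z * z * z * z + 4 * a5 * c0 * x * x * x * x * x * z * z + 3 *
      a5 * c2 * x * x * x * x * z * z * z + 2 * a5 * c5 * x * x * x * z * z * z * z + a5 * c9 * x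
      * x * z * z * z * z * z + 4 * a9 * c0 * x * x * x * x * z * z * z + 3 * a9 * c2 * x * x * x
      * z * z * z * z + 2 * a9 * c5 * x * x * z * z * z * z * z + a9 * c9 * x * z * z * z * z * z
      * z + b0 * c13 * x * x * x * x * z * z * z + b0 * c4 * x * x * x * x * x * x * z + b0 * c8 *
      x * x * x * x * x * z * z + b14 * c1 * x * x * x * z * z * z * z + b14 * c4 * x * x * z * z
      * z * z * z + b14 * c8 * x * z * z * z * z * z * z + b2 * c1 * x * x * x * x * x * x * z +
      b2 * c13 * x * x * x * z * z * z * z + b2 * c4 * x * x * x * x * x * z * z + b2 * c8 * x * x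
      * x * x * z * z * z + b5 * c1 * x * x * x * x * x * z * z + b5 * c13 * x * x * z * z * z * z
      * z + b5 * c4 * x * x * x * x * z * z * z + b5 * c8 * x * x * x * z * z * z * z + b9 * c1 *
      x * x * x * x * z * z * z + b9 * c13 * x * z * z * z * z * z * z + b9 * c4 * x * x * x * z *
      z * z * z + b9 * c8 * x * x * z * z * z * z * z + 4 * c0 * c14 * x * x * x * x * z * z * z +
      2 * c0 * c5 * x * x * x * x * x * x * z + 3 * c0 * c9 * x * x * x * x * x * z * z + 5 * c14
      * c2 * x * x * x * z * z * z * z + 6 * c14 * c5 * x * x * z * z * z * z * z + 7 * c14 * c9 *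
      x * z * z * z * z * z * z + 3 * c2 * c5 * x * x * x * x * x * z * z + 4 * c2 * c9 * x * x *
      x * x * z * z * z + 5 * c5 * c9 * x * x * x * z * z * z * z)
    (c1 := 3 * a0 * c1 * x * x * x * x * x * x + 4 * a1 * c0 * x * x * x * x * x * x + a14 * c8 *
      z * z * z * z * z * z + 2 * b0 * c3 * x * x * x * x * x * x + b1 * c1 * x * x * x * x * x *
      x + b13 * c13 * z * z * z * z * z * z + 2 * b14 * c12 * z * z * z * z * z * z + c0 * c4 * x
      * x * x * x * x * x + c1 * c2 * x * x * x * x * x * x + 7 * c13 * c14 * z * z * z * z * z *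
      z + 2 * a0 * c4 * x * x * x * x * x * z + a0 * c8 * x * x * x * x * z * z + 3 * a1 * c2 * x
      * x * x * x * x * z + 2 * a1 * c5 * x * x * x * x * z * z + a1 * c9 * x * x * x * z * z * z
      + 3 * a14 * c1 * x * x * z * z * z * z + 2 * a14 * c4 * x * z * z * z * z * z + 3 * a2 * c1
      * x * x * x * x * x * z + 2 * a2 * c4 * x * x * x * x * z * z + a2 * c8 * x * x * x * z * z
      * z + 3 * a5 * c1 * x * x * x * x * z * z + 2 * a5 * c4 * x * x * x * z * z * z + a5 * c8 *
      x * x * z * z * z * z + 3 * a9 * c1 * x * x * x * z * z * z + 2 * a9 * c4 * x * x * z * z *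
      z * z + a9 * c8 * x * z * z * z * z * z + 2 * b0 * c12 * x * x * x * x * z * z + 2 * b0 * c7
      * x * x * x * x * x * z + b1 * c13 * x * x * x * z * z * z + b1 * c4 * x * x * x * x * x * z
      + b1 * c8 * x * x * x * x * z * z + b13 * c1 * x * x * x * z * z * z + b13 * c4 * x * x * z
      * z * z * z + b13 * c8 * x * z * z * z * z * z + 2 * b14 * c3 * x * x * z * z * z * z + 2 *
      b14 * c7 * x * z * z * z * z * z + 2 * b2 * c12 * x * x * x * z * z * z + 2 * b2 * c3 * x *
      x * x * x * x * z + 2 * b2 * c7 * x * x * x * x * z * z + b4 * c1 * x * x * x * x * x * z +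
      b4 * c13 * x * x * z * z * z * z + b4 * c4 * x * x * x * x * z * z + b4 * c8 * x * x * x * z
      * z * z + 2 * b5 * c12 * x * x * z * z * z * z + 2 * b5 * c3 * x * x * x * x * z * z + 2 *
      b5 * c7 * x * x * x * z * z * z + b8 * c1 * x * x * x * x * z * z + b8 * c13 * x * z * z * z
      * z * z + b8 * c4 * x * x * x * z * z * z + b8 * c8 * x * x * z * z * z * z + 2 * b9 * c12 *
      x * z * z * z * z * z + 2 * b9 * c3 * x * x * x * z * z * z + 2 * b9 * c7 * x * x * z * z *
      z * z + 3 * c0 * c13 * x * x * x * x * z * z + 2 * c0 * c8 * x * x * x * x * x * z + 4 * c1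
      * c14 * x * x * x * z * z * z + 2 * c1 * c5 * x * x * x * x * x * z + 3 * c1 * c9 * x * x *
      x * x * z * z + 4 * c13 * c2 * x * x * x * z * z * z + 5 * c13 * c5 * x * x * z * z * z * z
      + 6 * c13 * c9 * x * z * z * z * z * z + 5 * c14 * c4 * x * x * z * z * z * z + 6 * c14 * c8
      * x * z * z * z * z * z + 2 * c2 * c4 * x * x * x * x * x * z + 3 * c2 * c8 * x * x * x * x
      * z * z + 3 * c4 * c5 * x * x * x * x * z * z + 4 * c4 * c9 * x * x * x * z * z * z + 4 * c5
      * c8 * x * x * x * z * z * z + 5 * c8 * c9 * x * x * z * z * z * z)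
    (c2 := 3 * c13 * c13 * z * z * z * z * z + 2 * a0 * c3 * x * x * x * x * x + 3 * a1 * c1 * x *
      x * x * x * x + a14 * c7 * z * z * z * z * z + 4 * a3 * c0 * x * x * x * x * x + 2 * b1 * c3
      * x * x * x * x * x + b12 * c13 * z * z * z * z * z + 2 * b13 * c12 * z * z * z * z * z + b3
      * c1 * x * x * x * x * x + c0 * c7 * x * x * x * x * x + c1 * c4 * x * x * x * x * x + 6 *
      c12 * c14 * z * z * z * z * z + c2 * c3 * x * x * x * x * x + c4 * c4 * x * x * x * x * z +
      2 * c8 * c8 * x * x * z * z * z + a0 * c7 * x * x * x * x * z + 2 * a1 * c4 * x * x * x * x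
      * z + a1 * c8 * x * x * x * z * z + 2 * a14 * c3 * x * z * z * z * z + 2 * a2 * c3 * x * x *
      x * x * z + a2 * c7 * x * x * x * z * z + 3 * a3 * c2 * x * x * x * x * z + 2 * a3 * c5 * x
      * x * x * z * z + a3 * c9 * x * x * z * z * z + 2 * a5 * c3 * x * x * x * z * z + a5 * c7 *
      x * x * z * z * z + 2 * a9 * c3 * x * x * z * z * z + a9 * c7 * x * z * z * z * z + 2 * b1 *
      c12 * x * x * x * z * z + 2 * b1 * c7 * x * x * x * x * z + b12 * c1 * x * x * x * z * z +
      b12 * c4 * x * x * z * z * z + b12 * c8 * x * z * z * z * z + 2 * b13 * c3 * x * x * z * z *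
      z + 2 * b13 * c7 * x * z * z * z * z + b3 * c13 * x * x * z * z * z + b3 * c4 * x * x * x *
      x * z + b3 * c8 * x * x * x * z * z + 2 * b4 * c12 * x * x * z * z * z + 2 * b4 * c3 * x * x
      * x * x * z + 2 * b4 * c7 * x * x * x * z * z + b7 * c1 * x * x * x * x * z + b7 * c13 * x *
      z * z * z * z + b7 * c4 * x * x * x * z * z + b7 * c8 * x * x * z * z * z + 2 * b8 * c12 * x
      * z * z * z * z + 2 * b8 * c3 * x * x * x * z * z + 2 * b8 * c7 * x * x * z * z * z + 2 * c0
      * c12 * x * x * x * x * z + 3 * c1 * c13 * x * x * x * z * z + 2 * c1 * c8 * x * x * x * x *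
      z + 3 * c12 * c2 * x * x * x * z * z + 4 * c12 * c5 * x * x * z * z * z + 5 * c12 * c9 * x *
      z * z * z * z + 4 * c13 * c4 * x * x * z * z * z + 5 * c13 * c8 * x * z * z * z * z + 4 *
      c14 * c3 * x * x * z * z * z + 5 * c14 * c7 * x * z * z * z * z + 2 * c2 * c7 * x * x * x *
      x * z + 2 * c3 * c5 * x * x * x * x * z + 3 * c3 * c9 * x * x * x * z * z + 3 * c4 * c8 * x
      * x * x * z * z + 3 * c5 * c7 * x * x * x * z * z + 4 * c7 * c9 * x * x * z * z * z)
    (c3 := b0 * x * x * x * x + b14 * z * z * z * z + c1 * x * x * x * x + 2 * a1 * c3 * x * x * x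
      * x + 3 * a3 * c1 * x * x * x * x + 2 * b12 * c12 * z * z * z * z + b2 * x * x * x * z + 2 *
      b3 * c3 * x * x * x * x + b5 * x * x * z * z + b9 * x * z * z * z + c1 * c7 * x * x * x * x
      + 5 * c12 * c13 * z * z * z * z + c13 * x * z * z * z + c3 * c4 * x * x * x * x + c4 * x * x
      * x * z + c8 * x * x * z * z + a1 * c7 * x * x * x * z + 2 * a3 * c4 * x * x * x * z + a3 *
      c8 * x * x * z * z + 2 * b12 * c3 * x * x * z * z + 2 * b12 * c7 * x * z * z * z + 2 * b3 *
      c12 * x * x * z * z + 2 * b3 * c7 * x * x * x * z + 2 * b7 * c12 * x * z * z * z + 2 * b7 *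
      c3 * x * x * x * z + 2 * b7 * c7 * x * x * z * z + 2 * c1 * c12 * x * x * x * z + 3 * c12 *
      c4 * x * x * z * z + 4 * c12 * c8 * x * z * z * z + 3 * c13 * c3 * x * x * z * z + 4 * c13 *
      c7 * x * z * z * z + 2 * c3 * c8 * x * x * x * z + 2 * c4 * c7 * x * x * x * z + 3 * c7 * c8
      * x * x * z * z)
    (c4 := b1 * x * x * x + b13 * z * z * z + 2 * c12 * c12 * z * z * z + 2 * c3 * x * x * x + 2 *
      a3 * c3 * x * x * x + b4 * x * x * z + b8 * x * z * z + 2 * c12 * x * z * z + 4 * c14 * k *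
      z * z * z + c2 * k * x * x * x + c3 * c7 * x * x * x + 2 * c7 * x * x * z + c7 * c7 * x * x
      * z + a3 * c7 * x * x * z + 2 * c12 * c3 * x * x * z + 3 * c12 * c7 * x * z * z + 2 * c5 * k
      * x * x * z + 3 * c9 * k * x * z * z)
    (c5 := b12 * z * z + b3 * x * x + b7 * x * z + 3 * c13 * k * z * z + c4 * k * x * x + 2 * c8 *
      k * x * z)
    (c6 := x + 2 * c12 * k * z + c7 * k * x)
    (c7 := 0)
    (c8 := 0)
    (fun y => by
      have h := h2n x y z
      simp only [quarticDx, quarticDy, quarticDz, quarticEval, Matrix.cons_val, hk, one_mul] at h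
      linear_combination h)
  -- Third row, coefficient of y⁶. The constant −4 arises because q contains x·y³ with coefficient
  -- 1, while z-derivatives are weighted by k = 1/4.
  obtain ⟨e5, e6⟩ := binary1 (F := F)
    (1 + c7 * k)
    (2 * c12 * k)
    (fun x z => by linear_combination (d x z).2.2.2.2.2.2.1)
  clear d
  obtain rfl : c7 = -4 :=
    by linear_combination 4 * e5 - (c7) * hk
  clear e5
  obtain rfl : c12 = 0 :=
    mul_left_cancel₀ h2 (by linear_combination 4 * e6 - (2 * c12) * hk)
  clear e6
  have d := fun x z : F => coeffs_eq_zero_of_forall (F := F)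
    (c0 := 4 * a0 * b0 * x * x * x * x * x * x * x + a14 * b9 * z * z * z * z * z * z * z + b0 *
      b1 * x * x * x * x * x * x * x + b13 * b14 * z * z * z * z * z * z * z + 4 * b14 * c14 * z *
      z * z * z * z * z * z + b2 * c0 * x * x * x * x * x * x * x + 3 * a0 * b2 * x * x * x * x *
      x * x * z + 2 * a0 * b5 * x * x * x * x * x * z * z + a0 * b9 * x * x * x * x * z * z * z +
      4 * a14 * b0 * x * x * x * z * z * z * z + 3 * a14 * b2 * x * x * z * z * z * z * z + 2 *
      a14 * b5 * x * z * z * z * z * z * z + 4 * a2 * b0 * x * x * x * x * x * x * z + 3 * a2 * b2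
      * x * x * x * x * x * z * z + 2 * a2 * b5 * x * x * x * x * z * z * z + a2 * b9 * x * x * x
      * z * z * z * z + 4 * a5 * b0 * x * x * x * x * x * z * z + 3 * a5 * b2 * x * x * x * x * z
      * z * z + 2 * a5 * b5 * x * x * x * z * z * z * z + a5 * b9 * x * x * z * z * z * z * z + 4
      * a9 * b0 * x * x * x * x * z * z * z + 3 * a9 * b2 * x * x * x * z * z * z * z + 2 * a9 *
      b5 * x * x * z * z * z * z * z + a9 * b9 * x * z * z * z * z * z * z + b0 * b13 * x * x * x
      * x * z * z * z + b0 * b4 * x * x * x * x * x * x * z + b0 * b8 * x * x * x * x * x * z * z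
      + b1 * b14 * x * x * x * z * z * z * z + b1 * b2 * x * x * x * x * x * x * z + b1 * b5 * x *
      x * x * x * x * z * z + b1 * b9 * x * x * x * x * z * z * z + b13 * b2 * x * x * x * z * z *
      z * z + b13 * b5 * x * x * z * z * z * z * z + b13 * b9 * x * z * z * z * z * z * z + b14 *
      b4 * x * x * z * z * z * z * z + b14 * b8 * x * z * z * z * z * z * z + 4 * b14 * c0 * x * x
      * x * x * z * z * z + 4 * b14 * c2 * x * x * x * z * z * z * z + 4 * b14 * c5 * x * x * z *
      z * z * z * z + 4 * b14 * c9 * x * z * z * z * z * z * z + b2 * b4 * x * x * x * x * x * z *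
      z + b2 * b8 * x * x * x * x * z * z * z + b2 * c14 * x * x * x * z * z * z * z + b2 * c2 * x
      * x * x * x * x * x * z + b2 * c5 * x * x * x * x * x * z * z + b2 * c9 * x * x * x * x * z
      * z * z + b4 * b5 * x * x * x * x * z * z * z + b4 * b9 * x * x * x * z * z * z * z + b5 *
      b8 * x * x * x * z * z * z * z + 2 * b5 * c0 * x * x * x * x * x * x * z + 2 * b5 * c14 * x
      * x * z * z * z * z * z + 2 * b5 * c2 * x * x * x * x * x * z * z + 2 * b5 * c5 * x * x * x
      * x * z * z * z + 2 * b5 * c9 * x * x * x * z * z * z * z + b8 * b9 * x * x * z * z * z * z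
      * z + 3 * b9 * c0 * x * x * x * x * x * z * z + 3 * b9 * c14 * x * z * z * z * z * z * z + 3
      * b9 * c2 * x * x * x * x * z * z * z + 3 * b9 * c5 * x * x * x * z * z * z * z + 3 * b9 *
      c9 * x * x * z * z * z * z * z)
    (c1 := b1 * b1 * x * x * x * x * x * x + b13 * b13 * z * z * z * z * z * z + 3 * a0 * b1 * x *
      x * x * x * x * x + 4 * a1 * b0 * x * x * x * x * x * x + a14 * b8 * z * z * z * z * z * z +
      2 * b0 * b3 * x * x * x * x * x * x + 2 * b12 * b14 * z * z * z * z * z * z + 3 * b13 * c14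
      * z * z * z * z * z * z + 4 * b14 * c13 * z * z * z * z * z * z + b2 * c1 * x * x * x * x *
      x * x + b4 * c0 * x * x * x * x * x * x + b4 * b4 * x * x * x * x * z * z + b8 * b8 * x * x
      * z * z * z * z + 2 * a0 * b4 * x * x * x * x * x * z + a0 * b8 * x * x * x * x * z * z + 3
      * a1 * b2 * x * x * x * x * x * z + 2 * a1 * b5 * x * x * x * x * z * z + a1 * b9 * x * x *
      x * z * z * z + 3 * a14 * b1 * x * x * z * z * z * z + 2 * a14 * b4 * x * z * z * z * z * z
      + 3 * a2 * b1 * x * x * x * x * x * z + 2 * a2 * b4 * x * x * x * x * z * z + a2 * b8 * x *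
      x * x * z * z * z + 3 * a5 * b1 * x * x * x * x * z * z + 2 * a5 * b4 * x * x * x * z * z *
      z + a5 * b8 * x * x * z * z * z * z + 3 * a9 * b1 * x * x * x * z * z * z + 2 * a9 * b4 * x
      * x * z * z * z * z + a9 * b8 * x * z * z * z * z * z + 2 * b0 * b12 * x * x * x * x * z * z
      + 2 * b0 * b7 * x * x * x * x * x * z + 2 * b1 * b13 * x * x * x * z * z * z + 2 * b1 * b4 *
      x * x * x * x * x * z + 2 * b1 * b8 * x * x * x * x * z * z + 2 * b12 * b2 * x * x * x * z *
      z * z + 2 * b12 * b5 * x * x * z * z * z * z + 2 * b12 * b9 * x * z * z * z * z * z + 2 *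
      b13 * b4 * x * x * z * z * z * z + 2 * b13 * b8 * x * z * z * z * z * z + 3 * b13 * c0 * x *
      x * x * x * z * z + 3 * b13 * c2 * x * x * x * z * z * z + 3 * b13 * c5 * x * x * z * z * z
      * z + 3 * b13 * c9 * x * z * z * z * z * z + 2 * b14 * b3 * x * x * z * z * z * z + 2 * b14
      * b7 * x * z * z * z * z * z + 4 * b14 * c1 * x * x * x * z * z * z + 4 * b14 * c4 * x * x *
      z * z * z * z + 4 * b14 * c8 * x * z * z * z * z * z + 2 * b2 * b3 * x * x * x * x * x * z +
      2 * b2 * b7 * x * x * x * x * z * z + b2 * c13 * x * x * x * z * z * z + b2 * c4 * x * x * x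
      * x * x * z + b2 * c8 * x * x * x * x * z * z + 2 * b3 * b5 * x * x * x * x * z * z + 2 * b3
      * b9 * x * x * x * z * z * z + 2 * b4 * b8 * x * x * x * z * z * z + b4 * c14 * x * x * z *
      z * z * z + b4 * c2 * x * x * x * x * x * z + b4 * c5 * x * x * x * x * z * z + b4 * c9 * x
      * x * x * z * z * z + 2 * b5 * b7 * x * x * x * z * z * z + 2 * b5 * c1 * x * x * x * x * x
      * z + 2 * b5 * c13 * x * x * z * z * z * z + 2 * b5 * c4 * x * x * x * x * z * z + 2 * b5 *
      c8 * x * x * x * z * z * z + 2 * b7 * b9 * x * x * z * z * z * z + 2 * b8 * c0 * x * x * x *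
      x * x * z + 2 * b8 * c14 * x * z * z * z * z * z + 2 * b8 * c2 * x * x * x * x * z * z + 2 *
      b8 * c5 * x * x * x * z * z * z + 2 * b8 * c9 * x * x * z * z * z * z + 3 * b9 * c1 * x * x
      * x * x * z * z + 3 * b9 * c13 * x * z * z * z * z * z + 3 * b9 * c4 * x * x * x * z * z * z
      + 3 * b9 * c8 * x * x * z * z * z * z)
    (c2 := 3 * b0 * x * x * x * x * x + 2 * a0 * b3 * x * x * x * x * x + 3 * a1 * b1 * x * x * x
      * x * x + a14 * b7 * z * z * z * z * z + 4 * a3 * b0 * x * x * x * x * x + 3 * b1 * b3 * x *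
      x * x * x * x + 3 * b12 * b13 * z * z * z * z * z + 2 * b12 * c14 * z * z * z * z * z + 3 *
      b13 * c13 * z * z * z * z * z - 13 * b14 * x * z * z * z * z + b2 * c3 * x * x * x * x * x -
      b2 * x * x * x * x * z + b4 * c1 * x * x * x * x * x - 5 * b5 * x * x * x * z * z + b7 * c0
      * x * x * x * x * x - 9 * b9 * x * x * z * z * z + a0 * b7 * x * x * x * x * z + 2 * a1 * b4
      * x * x * x * x * z + a1 * b8 * x * x * x * z * z + 2 * a14 * b3 * x * z * z * z * z + 2 *
      a2 * b3 * x * x * x * x * z + a2 * b7 * x * x * x * z * z + 3 * a3 * b2 * x * x * x * x * z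
      + 2 * a3 * b5 * x * x * x * z * z + a3 * b9 * x * x * z * z * z + 2 * a5 * b3 * x * x * x *
      z * z + a5 * b7 * x * x * z * z * z + 2 * a9 * b3 * x * x * z * z * z + a9 * b7 * x * z * z
      * z * z + 3 * b1 * b12 * x * x * x * z * z + 3 * b1 * b7 * x * x * x * x * z + 3 * b12 * b4
      * x * x * z * z * z + 3 * b12 * b8 * x * z * z * z * z + 2 * b12 * c0 * x * x * x * x * z +
      2 * b12 * c2 * x * x * x * z * z + 2 * b12 * c5 * x * x * z * z * z + 2 * b12 * c9 * x * z *
      z * z * z + 3 * b13 * b3 * x * x * z * z * z + 3 * b13 * b7 * x * z * z * z * z + 3 * b13 *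
      c1 * x * x * x * z * z + 3 * b13 * c4 * x * x * z * z * z + 3 * b13 * c8 * x * z * z * z * z
      + 4 * b14 * c3 * x * x * z * z * z + 3 * b3 * b4 * x * x * x * x * z + 3 * b3 * b8 * x * x *
      x * z * z + 3 * b4 * b7 * x * x * x * z * z + b4 * c13 * x * x * z * z * z + b4 * c4 * x * x
      * x * x * z + b4 * c8 * x * x * x * z * z + 2 * b5 * c3 * x * x * x * x * z + 3 * b7 * b8 *
      x * x * z * z * z + b7 * c14 * x * z * z * z * z + b7 * c2 * x * x * x * x * z + b7 * c5 * x
      * x * x * z * z + b7 * c9 * x * x * z * z * z + 2 * b8 * c1 * x * x * x * x * z + 2 * b8 *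
      c13 * x * z * z * z * z + 2 * b8 * c4 * x * x * x * z * z + 2 * b8 * c8 * x * x * z * z * z
      + 3 * b9 * c3 * x * x * x * z * z)
    (c3 := a0 * x * x * x * x + a14 * z * z * z * z + 4 * b1 * x * x * x * x + 2 * b12 * b12 * z *
      z * z * z + 2 * b3 * b3 * x * x * x * x + 2 * a1 * b3 * x * x * x * x + a2 * x * x * x * z +
      3 * a3 * b1 * x * x * x * x + a5 * x * x * z * z + a9 * x * z * z * z + 2 * b12 * c13 * z *
      z * z * z - 8 * b13 * x * z * z * z + b4 * c3 * x * x * x * x + b7 * c1 * x * x * x * x + 2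
      * b7 * b7 * x * x * z * z - 4 * b8 * x * x * z * z + a1 * b7 * x * x * x * z + 2 * a3 * b4 *
      x * x * x * z + a3 * b8 * x * x * z * z + 4 * b12 * b3 * x * x * z * z + 4 * b12 * b7 * x *
      z * z * z + 2 * b12 * c1 * x * x * x * z + 2 * b12 * c4 * x * x * z * z + 2 * b12 * c8 * x *
      z * z * z + 3 * b13 * c3 * x * x * z * z + 4 * b3 * b7 * x * x * x * z + b7 * c13 * x * z *
      z * z + b7 * c4 * x * x * x * z + b7 * c8 * x * x * z * z + 2 * b8 * c3 * x * x * x * z)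
    (c4 := a1 * x * x * x + 5 * b3 * x * x * x + 2 * a3 * b3 * x * x * x - 3 * b12 * x * z * z + 4
      * b14 * k * z * z * z + b2 * k * x * x * x + b7 * c3 * x * x * x + b7 * x * x * z + a3 * b7
      * x * x * z + 2 * b12 * c3 * x * x * z + 2 * b5 * k * x * x * z + 3 * b9 * k * x * z * z)
    (c5 := 3 * x * x + a3 * x * x + 3 * b13 * k * z * z + b4 * k * x * x + 2 * b8 * k * x * z)
    (c6 := 2 * b12 * k * z + b7 * k * x)
    (c7 := 0)
    (c8 := 0)
    (fun y => by
      have h := h1 x y z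
      simp only [quarticDx, quarticDy, quarticDz, quarticEval, Matrix.cons_val] at h
      linear_combination h)
  -- Second row, coefficients of y⁶ and y⁵.
  obtain ⟨e7, e8⟩ := binary1 (F := F)
    (b7 * k)
    (2 * b12 * k)
    (fun x z => by linear_combination (d x z).2.2.2.2.2.2.1)
  obtain rfl : b7 = 0 :=
    by linear_combination 4 * e7 - (b7) * hk
  clear e7
  obtain rfl : b12 = 0 :=
    mul_left_cancel₀ h2 (by linear_combination 4 * e8 - (2 * b12) * hk)
  clear e8
  obtain ⟨e9, e10, e11⟩ := binary2 (F := F)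
    (3 + a3 + b4 * k)
    (2 * b8 * k)
    (3 * b13 * k)
    (fun x z => by linear_combination (d x z).2.2.2.2.2.1)
  clear d
  obtain rfl : b4 = -12 - 4 * a3 :=
    by linear_combination 4 * e9 - (b4) * hk
  clear e9
  obtain rfl : b8 = 0 :=
    mul_left_cancel₀ h2 (by linear_combination 4 * e10 - (2 * b8) * hk)
  clear e10
  obtain rfl : b13 = 0 :=
    mul_left_cancel₀ h3 (by linear_combination 4 * e11 - (3 * b13) * hk)
  clear e11
  have d := fun x z : F => coeffs_eq_zero_of_forall (F := F)
    (c0 := 4 * c14 * c14 * z * z * z * z * z * z * z + 4 * a0 * c0 * x * x * x * x * x * x * x +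
      a14 * c9 * z * z * z * z * z * z * z + b0 * c1 * x * x * x * x * x * x * x + b14 * c13 * z *
      z * z * z * z * z * z + c0 * c2 * x * x * x * x * x * x * x + c2 * c2 * x * x * x * x * x *
      x * z + 2 * c5 * c5 * x * x * x * x * z * z * z + 3 * c9 * c9 * x * x * z * z * z * z * z +
      3 * a0 * c2 * x * x * x * x * x * x * z + 2 * a0 * c5 * x * x * x * x * x * z * z + a0 * c9
      * x * x * x * x * z * z * z + 4 * a14 * c0 * x * x * x * z * z * z * z + 3 * a14 * c2 * x *
      x * z * z * z * z * z + 2 * a14 * c5 * x * z * z * z * z * z * z + 4 * a2 * c0 * x * x * x *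
      x * x * x * z + 3 * a2 * c2 * x * x * x * x * x * z * z + 2 * a2 * c5 * x * x * x * x * z *
      z * z + a2 * c9 * x * x * x * z * z * z * z + 4 * a5 * c0 * x * x * x * x * x * z * z + 3 *
      a5 * c2 * x * x * x * x * z * z * z + 2 * a5 * c5 * x * x * x * z * z * z * z + a5 * c9 * x
      * x * z * z * z * z * z + 4 * a9 * c0 * x * x * x * x * z * z * z + 3 * a9 * c2 * x * x * x
      * z * z * z * z + 2 * a9 * c5 * x * x * z * z * z * z * z + a9 * c9 * x * z * z * z * z * z
      * z + b0 * c13 * x * x * x * x * z * z * z + b0 * c4 * x * x * x * x * x * x * z + b0 * c8 *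
      x * x * x * x * x * z * z + b14 * c1 * x * x * x * z * z * z * z + b14 * c4 * x * x * z * z
      * z * z * z + b14 * c8 * x * z * z * z * z * z * z + b2 * c1 * x * x * x * x * x * x * z +
      b2 * c13 * x * x * x * z * z * z * z + b2 * c4 * x * x * x * x * x * z * z + b2 * c8 * x * x
      * x * x * z * z * z + b5 * c1 * x * x * x * x * x * z * z + b5 * c13 * x * x * z * z * z * z
      * z + b5 * c4 * x * x * x * x * z * z * z + b5 * c8 * x * x * x * z * z * z * z + b9 * c1 *
      x * x * x * x * z * z * z + b9 * c13 * x * z * z * z * z * z * z + b9 * c4 * x * x * x * z *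
      z * z * z + b9 * c8 * x * x * z * z * z * z * z + 4 * c0 * c14 * x * x * x * x * z * z * z +
      2 * c0 * c5 * x * x * x * x * x * x * z + 3 * c0 * c9 * x * x * x * x * x * z * z + 5 * c14
      * c2 * x * x * x * z * z * z * z + 6 * c14 * c5 * x * x * z * z * z * z * z + 7 * c14 * c9 *
      x * z * z * z * z * z * z + 3 * c2 * c5 * x * x * x * x * x * z * z + 4 * c2 * c9 * x * x *
      x * x * z * z * z + 5 * c5 * c9 * x * x * x * z * z * z * z)
    (c1 := 3 * a0 * c1 * x * x * x * x * x * x + 4 * a1 * c0 * x * x * x * x * x * x + a14 * c8 *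
      z * z * z * z * z * z + 2 * b0 * c3 * x * x * x * x * x * x - 8 * b0 * x * x * x * x * x * z
      + b1 * c1 * x * x * x * x * x * x - 8 * b14 * x * z * z * z * z * z - 8 * b2 * x * x * x * x
      * z * z - 8 * b5 * x * x * x * z * z * z - 8 * b9 * x * x * z * z * z * z + c0 * c4 * x * x
      * x * x * x * x + c1 * c2 * x * x * x * x * x * x - 12 * c1 * x * x * x * x * x * z + 7 *
      c13 * c14 * z * z * z * z * z * z - 12 * c13 * x * x * z * z * z * z - 12 * c4 * x * x * x *
      x * z * z - 12 * c8 * x * x * x * z * z * z + 2 * a0 * c4 * x * x * x * x * x * z + a0 * c8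
      * x * x * x * x * z * z + 3 * a1 * c2 * x * x * x * x * x * z + 2 * a1 * c5 * x * x * x * x
      * z * z + a1 * c9 * x * x * x * z * z * z + 3 * a14 * c1 * x * x * z * z * z * z + 2 * a14 *
      c4 * x * z * z * z * z * z + 3 * a2 * c1 * x * x * x * x * x * z + 2 * a2 * c4 * x * x * x *
      x * z * z + a2 * c8 * x * x * x * z * z * z - 4 * a3 * c1 * x * x * x * x * x * z - 4 * a3 *
      c13 * x * x * z * z * z * z - 4 * a3 * c4 * x * x * x * x * z * z - 4 * a3 * c8 * x * x * x
      * z * z * z + 3 * a5 * c1 * x * x * x * x * z * z + 2 * a5 * c4 * x * x * x * z * z * z + a5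
      * c8 * x * x * z * z * z * z + 3 * a9 * c1 * x * x * x * z * z * z + 2 * a9 * c4 * x * x * z
      * z * z * z + a9 * c8 * x * z * z * z * z * z + b1 * c13 * x * x * x * z * z * z + b1 * c4 *
      x * x * x * x * x * z + b1 * c8 * x * x * x * x * z * z + 2 * b14 * c3 * x * x * z * z * z *
      z + 2 * b2 * c3 * x * x * x * x * x * z + 2 * b5 * c3 * x * x * x * x * z * z + 2 * b9 * c3
      * x * x * x * z * z * z + 3 * c0 * c13 * x * x * x * x * z * z + 2 * c0 * c8 * x * x * x * x
      * x * z + 4 * c1 * c14 * x * x * x * z * z * z + 2 * c1 * c5 * x * x * x * x * x * z + 3 *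
      c1 * c9 * x * x * x * x * z * z + 4 * c13 * c2 * x * x * x * z * z * z + 5 * c13 * c5 * x *
      x * z * z * z * z + 6 * c13 * c9 * x * z * z * z * z * z + 5 * c14 * c4 * x * x * z * z * z
      * z + 6 * c14 * c8 * x * z * z * z * z * z + 2 * c2 * c4 * x * x * x * x * x * z + 3 * c2 *
      c8 * x * x * x * x * z * z + 3 * c4 * c5 * x * x * x * x * z * z + 4 * c4 * c9 * x * x * x *
      z * z * z + 4 * c5 * c8 * x * x * x * z * z * z + 5 * c8 * c9 * x * x * z * z * z * z)
    (c2 := -4 * a14 * z * z * z * z * z - 4 * c0 * x * x * x * x * x + 3 * c13 * c13 * z * z * z *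
      z * z + 96 * x * x * x * z * z + 2 * a0 * c3 * x * x * x * x * x - 4 * a0 * x * x * x * x *
      z + 3 * a1 * c1 * x * x * x * x * x - 4 * a2 * x * x * x * z * z + 4 * a3 * c0 * x * x * x *
      x * x + 32 * a3 * x * x * x * z * z - 4 * a5 * x * x * z * z * z - 4 * a9 * x * z * z * z *
      z + 2 * b1 * c3 * x * x * x * x * x - 8 * b1 * x * x * x * x * z + b3 * c1 * x * x * x * x *
      x + c1 * c4 * x * x * x * x * x - 20 * c14 * x * z * z * z * z + c2 * c3 * x * x * x * x * x
      - 8 * c2 * x * x * x * x * z - 24 * c3 * x * x * x * x * z + c4 * c4 * x * x * x * x * z -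
      12 * c5 * x * x * x * z * z + 2 * c8 * c8 * x * x * z * z * z - 16 * c9 * x * x * z * z * z
      + 2 * a1 * c4 * x * x * x * x * z + a1 * c8 * x * x * x * z * z + 2 * a14 * c3 * x * z * z *
      z * z + 2 * a2 * c3 * x * x * x * x * z + 3 * a3 * c2 * x * x * x * x * z - 8 * a3 * c3 * x
      * x * x * x * z + 2 * a3 * c5 * x * x * x * z * z + a3 * c9 * x * x * z * z * z + 2 * a5 *
      c3 * x * x * x * z * z + 2 * a9 * c3 * x * x * z * z * z + b3 * c13 * x * x * z * z * z + b3
      * c4 * x * x * x * x * z + b3 * c8 * x * x * x * z * z + 3 * c1 * c13 * x * x * x * z * z +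
      2 * c1 * c8 * x * x * x * x * z + 4 * c13 * c4 * x * x * z * z * z + 5 * c13 * c8 * x * z *
      z * z * z + 4 * c14 * c3 * x * x * z * z * z + 2 * c3 * c5 * x * x * x * x * z + 3 * c3 * c9
      * x * x * x * z * z + 3 * c4 * c8 * x * x * x * z * z)
    (c3 := b0 * x * x * x * x + b14 * z * z * z * z - 3 * c1 * x * x * x * x + 2 * a1 * c3 * x * x
      * x * x - 4 * a1 * x * x * x * z + 3 * a3 * c1 * x * x * x * x + b2 * x * x * x * z + 2 * b3
      * c3 * x * x * x * x - 8 * b3 * x * x * x * z + b5 * x * x * z * z + b9 * x * z * z * z - 15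
      * c13 * x * z * z * z + c3 * c4 * x * x * x * x - 7 * c4 * x * x * x * z - 11 * c8 * x * x *
      z * z + 2 * a3 * c4 * x * x * x * z + a3 * c8 * x * x * z * z + 3 * c13 * c3 * x * x * z * z
      + 2 * c3 * c8 * x * x * x * z)
    (c4 := b1 * x * x * x - 2 * c3 * x * x * x - 4 * x * x * z + 2 * a3 * c3 * x * x * x - 8 * a3
      * x * x * z + 4 * c14 * k * z * z * z + c2 * k * x * x * x + 2 * c5 * k * x * x * z + 3 * c9
      * k * x * z * z)
    (c5 := b3 * x * x + 3 * c13 * k * z * z + c4 * k * x * x + 2 * c8 * k * x * z)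
    (c6 := x - 4 * k * x)
    (c7 := 0)
    (c8 := 0)
    (fun y => by
      have h := h2n x y z
      simp only [quarticDx, quarticDy, quarticDz, quarticEval, Matrix.cons_val, hk, one_mul] at h
      linear_combination h)
  -- Third row again, now the coefficient of y⁵.
  obtain ⟨e12, e13, e14⟩ := binary2 (F := F)
    (b3 + c4 * k)
    (2 * c8 * k)
    (3 * c13 * k)
    (fun x z => by linear_combination (d x z).2.2.2.2.2.1)
  clear d
  obtain rfl : c4 = -4 * b3 :=
    by linear_combination 4 * e12 - (c4) * hk
  clear e12
  obtain rfl : c8 = 0 :=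
    mul_left_cancel₀ h2 (by linear_combination 4 * e13 - (2 * c8) * hk)
  clear e13
  obtain rfl : c13 = 0 :=
    mul_left_cancel₀ h3 (by linear_combination 4 * e14 - (3 * c13) * hk)
  clear e14
  have d := fun x z : F => coeffs_eq_zero_of_forall (F := F)
    (c0 := 4 * a0 * a0 * x * x * x * x * x * x * x + a1 * b0 * x * x * x * x * x * x * x + a14 *
      a9 * z * z * z * z * z * z * z + 4 * a14 * c14 * z * z * z * z * z * z * z + a2 * c0 * x * x
      * x * x * x * x * x + 3 * a2 * a2 * x * x * x * x * x * z * z + 2 * a5 * a5 * x * x * x * z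
      * z * z * z + a9 * a9 * x * z * z * z * z * z * z + 4 * a0 * a14 * x * x * x * z * z * z * z
      + 7 * a0 * a2 * x * x * x * x * x * x * z + 6 * a0 * a5 * x * x * x * x * x * z * z + 5 * a0
      * a9 * x * x * x * x * z * z * z + a1 * b14 * x * x * x * z * z * z * z + a1 * b2 * x * x *
      x * x * x * x * z + a1 * b5 * x * x * x * x * x * z * z + a1 * b9 * x * x * x * x * z * z *
      z + 3 * a14 * a2 * x * x * z * z * z * z * z + 2 * a14 * a5 * x * z * z * z * z * z * z + 4
      * a14 * c0 * x * x * x * x * z * z * z + 4 * a14 * c2 * x * x * x * z * z * z * z + 4 * a14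
      * c5 * x * x * z * z * z * z * z + 4 * a14 * c9 * x * z * z * z * z * z * z + 5 * a2 * a5 *
      x * x * x * x * z * z * z + 4 * a2 * a9 * x * x * x * z * z * z * z + a2 * c14 * x * x * x *
      z * z * z * z + a2 * c2 * x * x * x * x * x * x * z + a2 * c5 * x * x * x * x * x * z * z +
      a2 * c9 * x * x * x * x * z * z * z + 3 * a5 * a9 * x * x * z * z * z * z * z + 2 * a5 * c0
      * x * x * x * x * x * x * z + 2 * a5 * c14 * x * x * z * z * z * z * z + 2 * a5 * c2 * x * x
      * x * x * x * z * z + 2 * a5 * c5 * x * x * x * x * z * z * z + 2 * a5 * c9 * x * x * x * z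
      * z * z * z + 3 * a9 * c0 * x * x * x * x * x * z * z + 3 * a9 * c14 * x * z * z * z * z * z
      * z + 3 * a9 * c2 * x * x * x * x * z * z * z + 3 * a9 * c5 * x * x * x * z * z * z * z + 3
      * a9 * c9 * x * x * z * z * z * z * z)
    (c1 := 7 * a0 * a1 * x * x * x * x * x * x + a1 * b1 * x * x * x * x * x * x - 12 * a1 * x * x
      * x * x * x * z + a2 * c1 * x * x * x * x * x * x + 2 * a3 * b0 * x * x * x * x * x * x + 3
      * a1 * a14 * x * x * z * z * z * z + 6 * a1 * a2 * x * x * x * x * x * z - 4 * a1 * a3 * x *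
      x * x * x * x * z + 5 * a1 * a5 * x * x * x * x * z * z + 4 * a1 * a9 * x * x * x * z * z *
      z - 16 * a14 * b3 * x * x * z * z * z * z + 4 * a14 * c1 * x * x * x * z * z * z - 4 * a2 *
      b3 * x * x * x * x * x * z + 2 * a3 * b14 * x * x * z * z * z * z + 2 * a3 * b2 * x * x * x
      * x * x * z + 2 * a3 * b5 * x * x * x * x * z * z + 2 * a3 * b9 * x * x * x * z * z * z - 8
      * a5 * b3 * x * x * x * x * z * z + 2 * a5 * c1 * x * x * x * x * x * z - 12 * a9 * b3 * x *
      x * x * z * z * z + 3 * a9 * c1 * x * x * x * x * z * z)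
    (c2 := 3 * a1 * a1 * x * x * x * x * x + 6 * a0 * a3 * x * x * x * x * x + a1 * b3 * x * x * x
      * x * x - 16 * a14 * x * z * z * z * z + a2 * c3 * x * x * x * x * x - 4 * a2 * x * x * x *
      x * z + 2 * a3 * b1 * x * x * x * x * x - 24 * a3 * x * x * x * x * z - 8 * a3 * a3 * x * x
      * x * x * z - 8 * a5 * x * x * x * z * z - 12 * a9 * x * x * z * z * z + 2 * a14 * a3 * x *
      z * z * z * z + 4 * a14 * c3 * x * x * z * z * z + 5 * a2 * a3 * x * x * x * x * z + 4 * a3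
      * a5 * x * x * x * z * z + 3 * a3 * a9 * x * x * z * z * z + 2 * a5 * c3 * x * x * x * x * z
      + 3 * a9 * c3 * x * x * x * z * z)
    (c3 := a1 * x * x * x * x + 5 * a1 * a3 * x * x * x * x + 2 * a3 * b3 * x * x * x * x)
    (c4 := 2 * a3 * x * x * x + 2 * a3 * a3 * x * x * x + 4 * a14 * k * z * z * z + a2 * k * x * x
      * x + 2 * a5 * k * x * x * z + 3 * a9 * k * x * z * z)
    (c5 := 0)
    (c6 := 0)
    (c7 := 0)
    (c8 := 0)
    (fun y => by
      have h := h0 x y z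
      simp only [quarticDx, quarticDy, quarticDz, quarticEval, Matrix.cons_val] at h
      linear_combination h)
  -- Here and in the next two rounds, the coefficient of y⁴ in the first, second and third row
  -- determines the coefficients of degree at most one in y that occur linearly.
  obtain ⟨e15, e16, e17, e18⟩ := binary3 (F := F)
    (2 * a3 + 2 * a3 * a3 + a2 * k)
    (2 * a5 * k)
    (3 * a9 * k)
    (4 * a14 * k)
    (fun x z => by linear_combination (d x z).2.2.2.2.1)
  clear d
  obtain rfl : a2 = -8 * a3 - 8 * a3 * a3 :=
    by linear_combination 4 * e15 - (a2) * hk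
  clear e15
  obtain rfl : a5 = 0 :=
    mul_left_cancel₀ h2 (by linear_combination 4 * e16 - (2 * a5) * hk)
  clear e16
  obtain rfl : a9 = 0 :=
    mul_left_cancel₀ h3 (by linear_combination 4 * e17 - (3 * a9) * hk)
  clear e17
  obtain rfl : a14 = 0 :=
    mul_left_cancel₀ h4 (by linear_combination 4 * e18 - (4 * a14) * hk)
  clear e18
  have d := fun x z : F => coeffs_eq_zero_of_forall (F := F)
    (c0 := 4 * a0 * b0 * x * x * x * x * x * x * x + b0 * b1 * x * x * x * x * x * x * x - 12 * b0
      * x * x * x * x * x * x * z + 4 * b14 * c14 * z * z * z * z * z * z * z - 12 * b14 * x * x *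
      z * z * z * z * z + b2 * c0 * x * x * x * x * x * x * x - 12 * b2 * x * x * x * x * x * z *
      z - 12 * b5 * x * x * x * x * z * z * z - 12 * b9 * x * x * x * z * z * z * z + 3 * a0 * b2
      * x * x * x * x * x * x * z + 2 * a0 * b5 * x * x * x * x * x * z * z + a0 * b9 * x * x * x
      * x * z * z * z - 36 * a3 * b0 * x * x * x * x * x * x * z - 4 * a3 * b14 * x * x * z * z *
      z * z * z - 28 * a3 * b2 * x * x * x * x * x * z * z - 20 * a3 * b5 * x * x * x * x * z * z
      * z - 12 * a3 * b9 * x * x * x * z * z * z * z - 32 * a3 * a3 * b0 * x * x * x * x * x * x *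
      z - 24 * a3 * a3 * b2 * x * x * x * x * x * z * z - 16 * a3 * a3 * b5 * x * x * x * x * z *
      z * z - 8 * a3 * a3 * b9 * x * x * x * z * z * z * z + b1 * b14 * x * x * x * z * z * z * z
      + b1 * b2 * x * x * x * x * x * x * z + b1 * b5 * x * x * x * x * x * z * z + b1 * b9 * x *
      x * x * x * z * z * z + 4 * b14 * c0 * x * x * x * x * z * z * z + 4 * b14 * c2 * x * x * x
      * z * z * z * z + 4 * b14 * c5 * x * x * z * z * z * z * z + 4 * b14 * c9 * x * z * z * z *
      z * z * z + b2 * c14 * x * x * x * z * z * z * z + b2 * c2 * x * x * x * x * x * x * z + b2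
      * c5 * x * x * x * x * x * z * z + b2 * c9 * x * x * x * x * z * z * z + 2 * b5 * c0 * x * x
      * x * x * x * x * z + 2 * b5 * c14 * x * x * z * z * z * z * z + 2 * b5 * c2 * x * x * x * x
      * x * z * z + 2 * b5 * c5 * x * x * x * x * z * z * z + 2 * b5 * c9 * x * x * x * z * z * z
      * z + 3 * b9 * c0 * x * x * x * x * x * z * z + 3 * b9 * c14 * x * z * z * z * z * z * z + 3
      * b9 * c2 * x * x * x * x * z * z * z + 3 * b9 * c5 * x * x * x * z * z * z * z + 3 * b9 *
      c9 * x * x * z * z * z * z * z)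
    (c1 := b1 * b1 * x * x * x * x * x * x - 12 * c0 * x * x * x * x * x * x + 144 * x * x * x * x
      * z * z + 3 * a0 * b1 * x * x * x * x * x * x - 24 * a0 * x * x * x * x * x * z + 4 * a1 *
      b0 * x * x * x * x * x * x - 4 * a3 * c0 * x * x * x * x * x * x + 288 * a3 * x * x * x * x
      * z * z + 272 * a3 * a3 * x * x * x * x * z * z + 64 * a3 * a3 * a3 * x * x * x * x * z * z
      + 2 * b0 * b3 * x * x * x * x * x * x - 24 * b1 * x * x * x * x * x * z + b2 * c1 * x * x *
      x * x * x * x - 12 * c14 * x * x * z * z * z * z - 12 * c2 * x * x * x * x * x * z - 12 * c5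
      * x * x * x * x * z * z - 12 * c9 * x * x * x * z * z * z - 8 * a0 * a3 * x * x * x * x * x
      * z + 3 * a1 * b2 * x * x * x * x * x * z + 2 * a1 * b5 * x * x * x * x * z * z + a1 * b9 *
      x * x * x * z * z * z - 32 * a3 * b1 * x * x * x * x * x * z - 4 * a3 * c14 * x * x * z * z
      * z * z - 4 * a3 * c2 * x * x * x * x * x * z - 4 * a3 * c5 * x * x * x * x * z * z - 4 * a3
      * c9 * x * x * x * z * z * z - 24 * a3 * a3 * b1 * x * x * x * x * x * z - 14 * b14 * b3 * x
      * x * z * z * z * z + 4 * b14 * c1 * x * x * x * z * z * z - 2 * b2 * b3 * x * x * x * x * x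
      * z - 6 * b3 * b5 * x * x * x * x * z * z - 10 * b3 * b9 * x * x * x * z * z * z + 2 * b5 *
      c1 * x * x * x * x * x * z + 3 * b9 * c1 * x * x * x * x * z * z)
    (c2 := 3 * b0 * x * x * x * x * x - 12 * c1 * x * x * x * x * x + 2 * a0 * b3 * x * x * x * x
      * x + 3 * a1 * b1 * x * x * x * x * x - 24 * a1 * x * x * x * x * z + 4 * a3 * b0 * x * x *
      x * x * x - 4 * a3 * c1 * x * x * x * x * x + 3 * b1 * b3 * x * x * x * x * x - 13 * b14 * x
      * z * z * z * z + b2 * c3 * x * x * x * x * x - b2 * x * x * x * x * z + 12 * b3 * x * x * x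
      * x * z - 5 * b5 * x * x * x * z * z - 9 * b9 * x * x * z * z * z - 8 * a1 * a3 * x * x * x
      * x * z + 3 * a3 * b2 * x * x * x * x * z - 12 * a3 * b3 * x * x * x * x * z + 2 * a3 * b5 *
      x * x * x * z * z + a3 * b9 * x * x * z * z * z - 16 * a3 * a3 * b3 * x * x * x * x * z + 4
      * b14 * c3 * x * x * z * z * z + 2 * b5 * c3 * x * x * x * x * z + 3 * b9 * c3 * x * x * x *
      z * z)
    (c3 := a0 * x * x * x * x + 4 * b1 * x * x * x * x + 2 * b3 * b3 * x * x * x * x - 12 * c3 * x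
      * x * x * x + 2 * a1 * b3 * x * x * x * x + 3 * a3 * b1 * x * x * x * x - 4 * a3 * c3 * x *
      x * x * x - 32 * a3 * x * x * x * z - 16 * a3 * a3 * x * x * x * z)
    (c4 := a1 * x * x * x + 5 * b3 * x * x * x + 2 * a3 * b3 * x * x * x + 4 * b14 * k * z * z * z
      + b2 * k * x * x * x + 2 * b5 * k * x * x * z + 3 * b9 * k * x * z * z)
    (c5 := 3 * x * x + a3 * x * x - 12 * k * x * x - 4 * a3 * k * x * x)
    (c6 := 0)
    (c7 := 0)
    (c8 := 0)
    (fun y => by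
      have h := h1 x y z
      simp only [quarticDx, quarticDy, quarticDz, quarticEval, Matrix.cons_val] at h
      linear_combination h)
  obtain ⟨e19, e20, e21, e22⟩ := binary3 (F := F)
    (a1 + 5 * b3 + 2 * a3 * b3 + b2 * k)
    (2 * b5 * k)
    (3 * b9 * k)
    (4 * b14 * k)
    (fun x z => by linear_combination (d x z).2.2.2.2.1)
  clear d
  obtain rfl : b2 = -4 * a1 - 20 * b3 - 8 * a3 * b3 :=
    by linear_combination 4 * e19 - (b2) * hk
  clear e19
  obtain rfl : b5 = 0 :=
    mul_left_cancel₀ h2 (by linear_combination 4 * e20 - (2 * b5) * hk)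
  clear e20
  obtain rfl : b9 = 0 :=
    mul_left_cancel₀ h3 (by linear_combination 4 * e21 - (3 * b9) * hk)
  clear e21
  obtain rfl : b14 = 0 :=
    mul_left_cancel₀ h4 (by linear_combination 4 * e22 - (4 * b14) * hk)
  clear e22
  have d := fun x z : F => coeffs_eq_zero_of_forall (F := F)
    (c0 := 4 * c14 * c14 * z * z * z * z * z * z * z + 4 * a0 * c0 * x * x * x * x * x * x * x +
      b0 * c1 * x * x * x * x * x * x * x + 80 * b3 * b3 * x * x * x * x * x * z * z + c0 * c2 * x
      * x * x * x * x * x * x + c2 * c2 * x * x * x * x * x * x * z + 2 * c5 * c5 * x * x * x * x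
      * z * z * z + 3 * c9 * c9 * x * x * z * z * z * z * z + 3 * a0 * c2 * x * x * x * x * x * x
      * z + 2 * a0 * c5 * x * x * x * x * x * z * z + a0 * c9 * x * x * x * x * z * z * z + 16 *
      a1 * b3 * x * x * x * x * x * z * z - 4 * a1 * c1 * x * x * x * x * x * x * z + 32 * a3 * b3
      * b3 * x * x * x * x * x * z * z - 32 * a3 * c0 * x * x * x * x * x * x * z - 24 * a3 * c2 *
      x * x * x * x * x * z * z - 16 * a3 * c5 * x * x * x * x * z * z * z - 8 * a3 * c9 * x * x *
      x * z * z * z * z - 32 * a3 * a3 * c0 * x * x * x * x * x * x * z - 24 * a3 * a3 * c2 * x *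
      x * x * x * x * z * z - 16 * a3 * a3 * c5 * x * x * x * x * z * z * z - 8 * a3 * a3 * c9 * x
      * x * x * z * z * z * z - 4 * b0 * b3 * x * x * x * x * x * x * z - 20 * b3 * c1 * x * x * x
      * x * x * x * z + 4 * c0 * c14 * x * x * x * x * z * z * z + 2 * c0 * c5 * x * x * x * x * x
      * x * z + 3 * c0 * c9 * x * x * x * x * x * z * z + 5 * c14 * c2 * x * x * x * z * z * z * z
      + 6 * c14 * c5 * x * x * z * z * z * z * z + 7 * c14 * c9 * x * z * z * z * z * z * z + 3 *
      c2 * c5 * x * x * x * x * x * z * z + 4 * c2 * c9 * x * x * x * x * z * z * z + 5 * c5 * c9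
      * x * x * x * z * z * z * z - 8 * a3 * b3 * c1 * x * x * x * x * x * x * z)
    (c1 := 3 * a0 * c1 * x * x * x * x * x * x + 4 * a1 * c0 * x * x * x * x * x * x + 32 * a1 * x
      * x * x * x * z * z + 2 * b0 * c3 * x * x * x * x * x * x - 8 * b0 * x * x * x * x * x * z +
      b1 * c1 * x * x * x * x * x * x - 4 * b3 * c0 * x * x * x * x * x * x + 208 * b3 * x * x * x
      * x * z * z + c1 * c2 * x * x * x * x * x * x - 12 * c1 * x * x * x * x * x * z - 8 * a0 *
      b3 * x * x * x * x * x * z + 3 * a1 * c2 * x * x * x * x * x * z - 8 * a1 * c3 * x * x * x *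
      x * x * z + 2 * a1 * c5 * x * x * x * x * z * z + a1 * c9 * x * x * x * z * z * z + 144 * a3
      * b3 * x * x * x * x * z * z - 28 * a3 * c1 * x * x * x * x * x * z + 64 * a3 * a3 * b3 * x
      * x * x * x * z * z - 24 * a3 * a3 * c1 * x * x * x * x * x * z - 4 * b1 * b3 * x * x * x *
      x * x * z - 20 * b3 * c14 * x * x * z * z * z * z - 8 * b3 * c2 * x * x * x * x * x * z - 40
      * b3 * c3 * x * x * x * x * x * z - 12 * b3 * c5 * x * x * x * x * z * z - 16 * b3 * c9 * x
      * x * x * z * z * z + 4 * c1 * c14 * x * x * x * z * z * z + 2 * c1 * c5 * x * x * x * x * x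
      * z + 3 * c1 * c9 * x * x * x * x * z * z - 16 * a3 * b3 * c3 * x * x * x * x * x * z)
    (c2 := -4 * c0 * x * x * x * x * x + 96 * x * x * x * z * z + 2 * a0 * c3 * x * x * x * x * x
      - 4 * a0 * x * x * x * x * z + 3 * a1 * c1 * x * x * x * x * x + 4 * a3 * c0 * x * x * x * x
      * x + 64 * a3 * x * x * x * z * z + 32 * a3 * a3 * x * x * x * z * z + 2 * b1 * c3 * x * x *
      x * x * x - 8 * b1 * x * x * x * x * z - 3 * b3 * c1 * x * x * x * x * x + 12 * b3 * b3 * x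
      * x * x * x * z - 20 * c14 * x * z * z * z * z + c2 * c3 * x * x * x * x * x - 8 * c2 * x *
      x * x * x * z - 24 * c3 * x * x * x * x * z - 12 * c5 * x * x * x * z * z - 16 * c9 * x * x
      * z * z * z - 8 * a1 * b3 * x * x * x * x * z + 3 * a3 * c2 * x * x * x * x * z - 24 * a3 *
      c3 * x * x * x * x * z + 2 * a3 * c5 * x * x * x * z * z + a3 * c9 * x * x * z * z * z - 16
      * a3 * a3 * c3 * x * x * x * x * z + 4 * c14 * c3 * x * x * z * z * z + 2 * c3 * c5 * x * x
      * x * x * z + 3 * c3 * c9 * x * x * x * z * z)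
    (c3 := b0 * x * x * x * x - 3 * c1 * x * x * x * x + 2 * a1 * c3 * x * x * x * x - 8 * a1 * x
      * x * x * z + 3 * a3 * c1 * x * x * x * x - 2 * b3 * c3 * x * x * x * x - 16 * a3 * b3 * x *
      x * x * z)
    (c4 := b1 * x * x * x - 2 * c3 * x * x * x - 4 * x * x * z + 2 * a3 * c3 * x * x * x - 8 * a3
      * x * x * z + 4 * c14 * k * z * z * z + c2 * k * x * x * x + 2 * c5 * k * x * x * z + 3 * c9
      * k * x * z * z)
    (c5 := b3 * x * x - 4 * b3 * k * x * x)
    (c6 := x - 4 * k * x)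
    (c7 := 0)
    (c8 := 0)
    (fun y => by
      have h := h2n x y z
      simp only [quarticDx, quarticDy, quarticDz, quarticEval, Matrix.cons_val, hk, one_mul] at h
      linear_combination h)
  obtain ⟨e23, e24, e25, e26⟩ := binary3 (F := F)
    (b1 - 2 * c3 + 2 * a3 * c3 + c2 * k)
    (-4 - 8 * a3 + 2 * c5 * k)
    (3 * c9 * k)
    (4 * c14 * k)
    (fun x z => by linear_combination (d x z).2.2.2.2.1)
  clear d
  obtain rfl : c2 = -4 * b1 + 8 * c3 - 8 * a3 * c3 :=
    by linear_combination 4 * e23 - (c2) * hk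
  clear e23
  obtain rfl : c5 = 8 + 16 * a3 :=
    mul_left_cancel₀ h2 (by linear_combination 4 * e24 - (2 * c5) * hk)
  clear e24
  obtain rfl : c9 = 0 :=
    mul_left_cancel₀ h3 (by linear_combination 4 * e25 - (3 * c9) * hk)
  clear e25
  obtain rfl : c14 = 0 :=
    mul_left_cancel₀ h4 (by linear_combination 4 * e26 - (4 * c14) * hk)
  clear e26
  -- The coefficient of x·y² in the trace is 2a3 + 3 − 4.
  have hc : 2 * a3 = 1 := by
    have ht := fun y => htr 1 y 0
    simp only [quarticDx, quarticDy, quarticDz, Matrix.cons_val] at ht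
    have := coeffs_eq_zero_of_forall (F := F)
      (c0 := 4 * a0 - 3 * b1 + 8 * c3 - 8 * a3 * c3)
      (c1 := 3 * a1 - 2 * b3)
      (c2 := -1 + 2 * a3)
      (c3 := 0)
      (c4 := 0)
      (c5 := 0)
      (c6 := 0)
      (c7 := 0)
      (c8 := 0)
      (fun y => by linear_combination ht y)
    linear_combination this.2.2.1
  have hf := coeffs_eq_zero_of_forall (F := F)
    (c0 := 4 * a0 * a0 + a1 * b0 - 8 * a3 * c0 - 8 * a3 * a3 * c0)
    (c1 := -4 * a1 * a1 - 56 * a0 * a3 - 56 * a0 * a3 * a3 - 20 * a1 * b3 + 32 * a3 * b1 - 64 * a3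
      * c3 + 32 * a3 * a3 * b1 + 64 * a3 * a3 * a3 * c3 - 8 * a1 * a3 * b3)
    (c2 := -64 * a3 + 256 * a3 * a3 * a3 + 192 * a3 * a3 * a3 * a3)
    (c3 := 0)
    (c4 := 0)
    (c5 := 0)
    (c6 := 0)
    (c7 := 0)
    (c8 := 0)
    (fun z => by
      have h := h0 1 0 z
      simp only [quarticDx, quarticDy, quarticDz, quarticEval, Matrix.cons_val] at h
      linear_combination h)
  -- At a3 = 1/2 the z²-coefficient −64a3 + 256a3³ + 192a3⁴ of the first row at (1, 0, z) equals 12.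
  -- The cubic cofactor below is the quotient on division by 2a3 − 1.
  refine mul_ne_zero h2 h6 ?_
  linear_combination hf.2.2.1 - (96 * a3 ^ 3 + 176 * a3 ^ 2 + 88 * a3 + 12) * hc

/-! ### Consequences for quartic maps normalised at a point -/

section PointwiseNormalForm

variable {F : Type*} [Field F]

lemma eval_jacobian_identities (h6 : (6 : F) ≠ 0) {H : Fin 3 → MvPolynomial (Fin 3) F}
    (hnil : IsNilpotent (jacobian H)) (a : Fin 3 → F) :
    let N := (jacobian H).map (eval a)
    N 0 0 + N 1 1 + N 2 2 = 0 ∧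
    N 0 0 * N 1 1 - N 0 1 * N 1 0 + (N 0 0 * N 2 2 - N 0 2 * N 2 0)
      + (N 1 1 * N 2 2 - N 1 2 * N 2 1) = 0 ∧
    N 0 0 * N 1 1 * N 2 2 - N 0 0 * N 1 2 * N 2 1 - N 0 1 * N 1 0 * N 2 2
      + N 0 1 * N 1 2 * N 2 0 + N 0 2 * N 1 0 * N 2 1 - N 0 2 * N 1 1 * N 2 0 = 0 := by
  intro N
  have hN : IsNilpotent N := hnil.map (eval a).mapMatrix
  have h2 : (2 : F) ≠ 0 := fun h => h6 (by linear_combination 3 * h)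
  have h := charpoly_coeffs_of_isNilpotent h2 hN
  rwa [Matrix.det_fin_three] at h

lemma quartic_eq_zero_of_forall [Infinite F] {c : Fin 15 → F}
    (h : ∀ x y z, quarticEval c x y z = 0) : quartic c = 0 := by
  refine MvPolynomial.funext fun a => ?_
  have ha : a = ![a 0, a 1, a 2] := by ext i; fin_cases i <;> rfl
  rw [ha, eval_quartic, h, map_zero]

/-- A quartic map with nilpotent Jacobian matrix which is the shift matrix at `(1, 0, 0)` has
vanishing first component and does not involve the last variable. -/
theorem eq_zero_and_pderiv_eq_zero_of_jacobian_eq_shift [Infinite F] (h6 : (6 : F) ≠ 0)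
    {H : Fin 3 → MvPolynomial (Fin 3) F} (hH : ∀ i, (H i).IsHomogeneous 4)
    (hnil : IsNilpotent (jacobian H))
    (hJ : (jacobian H).map (eval ![1, 0, 0]) = !![0, 0, 0; 1, 0, 0; 0, 1, 0]) :
    H 0 = 0 ∧ ∀ i, pderiv 2 (H i) = 0 := by
  have h4 : (4 : F) ≠ 0 := fun h => by
    have : (2 : F) = 0 := mul_self_eq_zero.1 (by linear_combination h)
    exact h6 (by linear_combination 3 * this)
  have hc : ∃ c : Fin 3 → Fin 15 → F, ∀ i, H i = quartic (c i) :=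
    ⟨_, fun i => eq_quartic (hH i)⟩
  obtain ⟨c, hc⟩ := hc
  have hN : ∀ x y z : F, (jacobian H).map (eval ![x, y, z]) = Matrix.of fun i j =>
      ![quarticDx (c i) x y z, quarticDy (c i) x y z, quarticDz (c i) x y z] j := fun x y z => by
    ext i j
    fin_cases j <;> simp [jacobian, hc, eval_pderiv_zero_quartic, eval_pderiv_one_quartic,
      eval_pderiv_two_quartic]
  have hid := fun x y z => eval_jacobian_identities h6 hnil ![x, y, z]
  simp only [hN, Matrix.of_apply, Matrix.cons_val] at hid
  have h0 : ∀ i j, ![4 * c i 0, c i 1, c i 2] j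
      = (!![0, 0, 0; 1, 0, 0; 0, 1, 0] : Matrix (Fin 3) (Fin 3) F) i j := fun i j => by
    rw [← hJ, hN]
    fin_cases j <;> simp [quarticDx, quarticDy, quarticDz]
  have e00 := h0 0 0
  have e01 := h0 0 1
  have e02 := h0 0 2
  have e10 := h0 1 0
  have e11 := h0 1 1
  have e12 := h0 1 2
  have e20 := h0 2 0
  have e21 := h0 2 1
  have e22 := h0 2 2
  simp [h4] at e00 e01 e02 e10 e11 e12 e20 e21 e22
  have hp : c 0 = ![0, 0, 0, c 0 3, c 0 4, c 0 5, c 0 6, c 0 7, c 0 8, c 0 9, c 0 10, c 0 11,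
      c 0 12, c 0 13, c 0 14] := by ext i; fin_cases i <;> first | rfl | assumption
  have hq : c 1 = ![c 1 0, 0, 0, c 1 3, c 1 4, c 1 5, c 1 6, c 1 7, c 1 8, c 1 9, c 1 10, c 1 11,
      c 1 12, c 1 13, c 1 14] := by ext i; fin_cases i <;> first | rfl | assumption
  have hr : c 2 = ![0, 1, 0, c 2 3, c 2 4, c 2 5, c 2 6, c 2 7, c 2 8, c 2 9, c 2 10, c 2 11,
      c 2 12, c 2 13, c 2 14] := by ext i; fin_cases i <;> first | rfl | assumption
  obtain ⟨a3, a4, a5, a6, a7, a8, a9, a10, a11, a12, a13, a14, b4, b5, b7, b8, b9, b11, b12, b13,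
    b14, c4, c5, c7, c8, c9, c11, c12, c13, c14⟩ := coeffs_of_shift_at_point h6 e10 hp hq hr
    (fun x y z => (hid x y z).1) (fun x y z => (hid x y z).2.1) (fun x y z => (hid x y z).2.2)
  clear hp hq hr hid h0 hN
  have z0 : H 0 = 0 := by
    rw [hc]
    simp [quartic, *]
  refine ⟨z0, fun i => ?_⟩
  fin_cases i
  · simp [z0]
  · simp [quartic, pderiv_X, *]
  · simp [quartic, pderiv_X, *]

/-- A nilpotent Jacobian matrix of a quartic map which is the shift matrix at `(0, 1, 0)` does not
annihilate the map itself. -/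
theorem jacobian_mulVec_self_ne_zero_of_jacobian_eq_shift [Infinite F] (h6 : (6 : F) ≠ 0)
    {H : Fin 3 → MvPolynomial (Fin 3) F} (hH : ∀ i, (H i).IsHomogeneous 4)
    (hnil : IsNilpotent (jacobian H))
    (hJ : (jacobian H).map (eval ![0, 1, 0]) = !![0, 0, 0; 1, 0, 0; 0, 1, 0]) :
    (jacobian H).mulVec H ≠ 0 := by
  intro hNH
  have h4 : (4 : F) ≠ 0 := fun h => by
    have : (2 : F) = 0 := mul_self_eq_zero.1 (by linear_combination h)
    exact h6 (by linear_combination 3 * this)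
  have hc : ∃ c : Fin 3 → Fin 15 → F, ∀ i, H i = quartic (c i) :=
    ⟨_, fun i => eq_quartic (hH i)⟩
  obtain ⟨c, hc⟩ := hc
  have hN : ∀ x y z : F, (jacobian H).map (eval ![x, y, z]) = Matrix.of fun i j =>
      ![quarticDx (c i) x y z, quarticDy (c i) x y z, quarticDz (c i) x y z] j := fun x y z => by
    ext i j
    fin_cases j <;> simp [jacobian, hc, eval_pderiv_zero_quartic, eval_pderiv_one_quartic,
      eval_pderiv_two_quartic]
  have hid := fun x y z => eval_jacobian_identities h6 hnil ![x, y, z]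
  simp only [hN, Matrix.of_apply, Matrix.cons_val] at hid
  have hself : ∀ i x y z, quarticDx (c i) x y z * quarticEval (c 0) x y z
      + quarticDy (c i) x y z * quarticEval (c 1) x y z
      + quarticDz (c i) x y z * quarticEval (c 2) x y z = 0 := fun i x y z => by
    have := congrArg (eval ![x, y, z]) (congrFun hNH i)
    simpa [Matrix.mulVec, dotProduct, Fin.sum_univ_three, jacobian, hc, eval_pderiv_zero_quartic,
      eval_pderiv_one_quartic, eval_pderiv_two_quartic, eval_quartic] using this
  have h0 : ∀ i j, ![c i 6, 4 * c i 10, c i 11] j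
      = (!![0, 0, 0; 1, 0, 0; 0, 1, 0] : Matrix (Fin 3) (Fin 3) F) i j := fun i j => by
    rw [← hJ, hN]
    fin_cases j <;> simp [quarticDx, quarticDy, quarticDz]
  have e00 := h0 0 0
  have e01 := h0 0 1
  have e02 := h0 0 2
  have e10 := h0 1 0
  have e11 := h0 1 1
  have e12 := h0 1 2
  have e20 := h0 2 0
  have e21 := h0 2 1
  have e22 := h0 2 2
  simp [h4] at e00 e01 e02 e10 e11 e12 e20 e21 e22
  exact false_of_shift_at_point_of_jacobian_mulVec_self_eq_zero h6 e21
    (p := c 0) (q := c 1) (r := c 2)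
    (by ext i; fin_cases i <;> first | rfl | assumption)
    (by ext i; fin_cases i <;> first | rfl | assumption)
    (by ext i; fin_cases i <;> first | rfl | assumption)
    (fun x y z => (hid x y z).1) (hself 0) (hself 1) (hself 2)

/-- A ternary quartic without `X 0 ^ 4` whose Wronskian with a quartic containing `X 0 ^ 4`
vanishes is zero. -/
theorem eq_zero_of_wronskian_eq_zero [Infinite F] (h6 : (6 : F) ≠ 0)
    {f g : MvPolynomial (Fin 3) F} (hf : f.IsHomogeneous 4) (hg : g.IsHomogeneous 4)
    (hf1 : eval ![1, 0, 0] f = 0) (hg1 : eval ![1, 0, 0] g ≠ 0)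
    (h : g * pderiv 0 f = f * pderiv 0 g) : f = 0 := by
  have h2 : (2 : F) ≠ 0 := fun h => h6 (by linear_combination 3 * h)
  have h3 : (3 : F) ≠ 0 := fun h => h6 (by linear_combination 2 * h)
  obtain ⟨p, rfl⟩ : ∃ p, f = quartic p := ⟨_, eq_quartic hf⟩
  obtain ⟨q, rfl⟩ : ∃ q, g = quartic q := ⟨_, eq_quartic hg⟩
  rw [eval_quartic] at hf1 hg1
  have hp0 : p 0 = 0 := by simpa [quarticEval] using hf1
  have hq0 : q 0 ≠ 0 := by simpa [quarticEval] using hg1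
  refine quartic_eq_zero_of_forall fun x y z => ?_
  -- With y and z frozen, both forms are polynomials in x.
  have hW : ∀ x, quarticEval q x y z * quarticDx p x y z
      = quarticEval p x y z * quarticDx q x y z := fun x => by
    have := congrArg (eval ![x, y, z]) h
    simpa [eval_quartic, eval_pderiv_zero_quartic] using this
  simp only [quarticEval, quarticDx, hp0] at hW ⊢
  generalize p 1 * y + p 2 * z = p1 at hW ⊢
  generalize p 3 * y ^ 2 + p 4 * y * z + p 5 * z ^ 2 = p2 at hW ⊢
  generalize p 6 * y ^ 3 + p 7 * y ^ 2 * z + p 8 * y * z ^ 2 + p 9 * z ^ 3 = p3 at hW ⊢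
  generalize p 10 * y ^ 4 + p 11 * y ^ 3 * z + p 12 * y ^ 2 * z ^ 2 + p 13 * y * z ^ 3
    + p 14 * z ^ 4 = p4 at hW ⊢
  generalize q 1 * y + q 2 * z = q1 at hW
  generalize q 3 * y ^ 2 + q 4 * y * z + q 5 * z ^ 2 = q2 at hW
  generalize q 6 * y ^ 3 + q 7 * y ^ 2 * z + q 8 * y * z ^ 2 + q 9 * z ^ 3 = q3 at hW
  generalize q 10 * y ^ 4 + q 11 * y ^ 3 * z + q 12 * y ^ 2 * z ^ 2 + q 13 * y * z ^ 3
    + q 14 * z ^ 4 = q4 at hW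
  generalize q 0 = k at hW hq0
  -- If pᵢ denotes the coefficient of x⁴⁻ⁱ in f, the coefficient of x⁷⁻ⁱ in the Wronskian is −i·pᵢ·k
  -- plus terms containing some pⱼ with j < i. So p1, …, p4 vanish one after another.
  obtain ⟨w0, w1, w2, w3, w4, w5, w6, -⟩ := coeffs_eq_zero_of_forall (F := F)
    (c0 := q4 * p3 - p4 * q3)
    (c1 := 2 * (q4 * p2 - p4 * q2))
    (c2 := 3 * (q4 * p1 - p4 * q1) + (q3 * p2 - p3 * q2))
    (c3 := 2 * (q3 * p1 - p3 * q1) - 4 * p4 * k)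
    (c4 := (q2 * p1 - p2 * q1) - 3 * p3 * k)
    (c5 := -2 * p2 * k)
    (c6 := -(p1 * k)) (c7 := 0) (c8 := 0) (fun x => by linear_combination hW x)
  obtain rfl : p1 = 0 := by simpa [hq0] using w6
  obtain rfl : p2 = 0 := by simpa [hq0, h2] using w5
  obtain rfl : p3 = 0 := by simpa [hq0, h3] using w4
  obtain rfl : p4 = 0 := by
    have : (2 * 2) * p4 * k = 0 := by linear_combination -w3
    simpa [hq0, h2] using this
  ring

end PointwiseNormalForm

/-! ### Adapted bases and nilpotent 3 × 3 matrices -/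

section LinearAlgebra

variable {K : Type*} [Field K]

/-- Some coordinate k of the cross product a × b is nonzero. It is the determinant of the matrix
with columns a, b and the k-th standard vector. -/
lemma exists_gl_of_linearIndependent {a b : Fin 3 → K} (hab : LinearIndependent K ![a, b]) :
    ∃ T : GL (Fin 3) K, T.val.mulVec ![1, 0, 0] = a ∧ T.val.mulVec ![0, 1, 0] = b := by
  have hcr := crossProduct_ne_zero_iff_linearIndependent.2 hab
  obtain ⟨k, hk⟩ := Function.ne_iff.1 hcr
  rw [Pi.zero_apply] at hk
  have hdet : (Matrix.of ![a, b, Pi.single k 1]).transpose.det ≠ 0 := by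
    rw [Matrix.det_transpose]
    convert hk using 1
    rw [Matrix.det_fin_three]
    fin_cases k <;> simp [cross_apply] <;> ring
  refine ⟨Matrix.GeneralLinearGroup.mkOfDetNeZero _ hdet, ?_, ?_⟩
  · ext i
    simp [Matrix.GeneralLinearGroup.mkOfDetNeZero, Matrix.mulVec, dotProduct, Fin.sum_univ_three]
  · ext i
    simp [Matrix.GeneralLinearGroup.mkOfDetNeZero, Matrix.mulVec, dotProduct, Fin.sum_univ_three]

/-- Used to turn a direction in which all derivatives vanish into the last coordinate axis. -/
lemma exists_gl_mulVec_last {v : Fin 3 → K} (hv : v ≠ 0) :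
    ∃ T : GL (Fin 3) K, ∀ i, T.val i 2 = v i := by
  suffices h : ∃ T : Matrix (Fin 3) (Fin 3) K, T.det ≠ 0 ∧ ∀ i, T i 2 = v i by
    obtain ⟨T, hT, h⟩ := h
    exact ⟨Matrix.GeneralLinearGroup.mkOfDetNeZero T hT, h⟩
  obtain ⟨k, hk⟩ := Function.ne_iff.1 hv
  simp only [Pi.zero_apply] at hk
  fin_cases k
  · exact ⟨!![0, 0, v 0; 1, 0, v 1; 0, 1, v 2], by simpa [Matrix.det_fin_three] using hk,
      fun i => by fin_cases i <;> rfl⟩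
  · exact ⟨!![1, 0, v 0; 0, 0, v 1; 0, 1, v 2], by simpa [Matrix.det_fin_three] using hk,
      fun i => by fin_cases i <;> rfl⟩
  · exact ⟨!![1, 0, v 0; 0, 1, v 1; 0, 0, v 2], by simpa [Matrix.det_fin_three] using hk,
      fun i => by fin_cases i <;> rfl⟩

/-- Makes the linear relation w the first component of the conjugated map while fixing the last
basis vector, so that independence of the last variable survives. Such a T maps the last basis
vector into the kernel of w, whence the condition on `w 2`. -/
lemma exists_gl_vecMul_eq {w : Fin 3 → K} (hw : w ≠ 0) (hw2 : w 2 = 0) :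
    ∃ T : GL (Fin 3) K, (∀ j, (T⁻¹).val 0 j = w j) ∧ ∀ i, T.val i 2 = ![0, 0, 1] i := by
  suffices h : ∃ T : Matrix (Fin 3) (Fin 3) K, T.det ≠ 0 ∧ Matrix.vecMul w T = ![1, 0, 0] ∧
      ∀ i, T i 2 = ![0, 0, 1] i by
    obtain ⟨T, hT, h, h'⟩ := h
    refine ⟨Matrix.GeneralLinearGroup.mkOfDetNeZero T hT, fun j => ?_, h'⟩
    set U := Matrix.GeneralLinearGroup.mkOfDetNeZero T hT
    have h1 : Matrix.vecMul (Matrix.vecMul w U.val) (U⁻¹).val = w := by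
      rw [Matrix.vecMul_vecMul, ← Units.val_mul, mul_inv_cancel, Units.val_one, Matrix.vecMul_one]
    rw [← h1, show Matrix.vecMul w U.val = ![1, 0, 0] from h]
    simp [Matrix.vecMul, dotProduct, Fin.sum_univ_three]
  by_cases h0 : w 0 = 0
  · have h1 : w 1 ≠ 0 := fun h1 => hw (by ext i; fin_cases i <;> assumption)
    refine ⟨!![0, 1, 0; (w 1)⁻¹, 0, 0; 0, 0, 1], by simpa [Matrix.det_fin_three] using h1, ?_,
      fun i => by fin_cases i <;> rfl⟩
    ext j
    fin_cases j <;> simp [Matrix.vecMul, dotProduct, Fin.sum_univ_three, h0, h1, hw2]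
  · refine ⟨!![(w 0)⁻¹, -w 1, 0; 0, w 0, 0; 0, 0, 1], by simp [Matrix.det_fin_three, h0], ?_,
      fun i => by fin_cases i <;> rfl⟩
    ext j
    fin_cases j <;> simp [Matrix.vecMul, dotProduct, Fin.sum_univ_three, h0, hw2]
    ring

/-- Cayley–Hamilton with all three characteristic coefficients equal to zero. -/
lemma pow_three_eq_zero_of_isNilpotent {R : Type*} [CommRing R] [IsDomain R] (h2 : (2 : R) ≠ 0)
    {N : Matrix (Fin 3) (Fin 3) R} (hN : IsNilpotent N) : N * (N * N) = 0 := by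
  obtain ⟨h1, h2, h3⟩ := charpoly_coeffs_of_isNilpotent h2 hN
  rw [Matrix.det_fin_three] at h3
  have key : ∀ i j, (N * (N * N)) i j = (N 0 0 + N 1 1 + N 2 2) * (N * N) i j
      - (N 0 0 * N 1 1 - N 0 1 * N 1 0 + (N 0 0 * N 2 2 - N 0 2 * N 2 0)
      + (N 1 1 * N 2 2 - N 1 2 * N 2 1)) * N i j
      + (N 0 0 * N 1 1 * N 2 2 - N 0 0 * N 1 2 * N 2 1 - N 0 1 * N 1 0 * N 2 2
      + N 0 1 * N 1 2 * N 2 0 + N 0 2 * N 1 0 * N 2 1 - N 0 2 * N 1 1 * N 2 0)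
        * (1 : Matrix (Fin 3) (Fin 3) R) i j := fun i j => by
    fin_cases i <;> fin_cases j <;> simp [Matrix.mul_apply, Fin.sum_univ_three] <;> ring
  ext i j
  rw [key, h1, h2, h3]
  simp

/-- A cyclic vector of a nilpotent `3 × 3` matrix yields a basis in which the matrix is the
shift. -/
lemma exists_gl_conj_eq_shift {N : Matrix (Fin 3) (Fin 3) K} (hN : N * (N * N) = 0)
    {f : Fin 3 → K} (hf : N.mulVec (N.mulVec f) ≠ 0) :
    ∃ T : GL (Fin 3) K, T.val.mulVec ![1, 0, 0] = f ∧ T.val.mulVec ![0, 1, 0] = N.mulVec f ∧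
      (T⁻¹).val * N * T.val = !![0, 0, 0; 1, 0, 0; 0, 1, 0] := by
  have h3 : ∀ g : Fin 3 → K, N.mulVec (N.mulVec (N.mulVec g)) = 0 := fun g => by
    rw [Matrix.mulVec_mulVec, Matrix.mulVec_mulVec, Matrix.mul_assoc, hN, Matrix.zero_mulVec]
  let T : Matrix (Fin 3) (Fin 3) K := (Matrix.of ![f, N.mulVec f, N.mulVec (N.mulVec f)]).transpose
  have hTw : ∀ w : Fin 3 → K,
      T.mulVec w = w 0 • f + w 1 • N.mulVec f + w 2 • N.mulVec (N.mulVec f) := fun w => by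
    ext i
    simp [T, Matrix.mulVec, dotProduct, Fin.sum_univ_three, mul_comm]
  -- Applying N², then N, to a linear relation between f, Nf and N²f kills its coefficients one at a
  -- time.
  have hdet : T.det ≠ 0 := by
    intro h
    obtain ⟨w, hw, hw0⟩ := Matrix.exists_mulVec_eq_zero_iff.2 h
    rw [hTw] at hw0
    have e1 := congrArg (fun g => N.mulVec (N.mulVec g)) hw0
    have e2 := congrArg (fun g => N.mulVec g) hw0
    simp only [Matrix.mulVec_add, Matrix.mulVec_smul, h3, Matrix.mulVec_zero, smul_zero,
      add_zero] at e1 e2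
    have w0 : w 0 = 0 := (smul_eq_zero.1 e1).resolve_right hf
    rw [w0, zero_smul, zero_add] at e2
    have w1 : w 1 = 0 := (smul_eq_zero.1 e2).resolve_right hf
    rw [w0, w1, zero_smul, zero_smul, zero_add, zero_add] at hw0
    have w2 : w 2 = 0 := (smul_eq_zero.1 hw0).resolve_right hf
    exact hw (by ext i; fin_cases i <;> assumption)
  have hNT : N * T = T * !![0, 0, 0; 1, 0, 0; 0, 1, 0] := by
    refine Matrix.ext_of_mulVec_single fun j => ?_
    rw [← Matrix.mulVec_mulVec, ← Matrix.mulVec_mulVec, hTw, hTw]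
    fin_cases j <;> simp [hN]
  refine ⟨Matrix.GeneralLinearGroup.mkOfDetNeZero T hdet, ?_, ?_, ?_⟩
  · exact (hTw _).trans (by simp)
  · exact (hTw _).trans (by simp)
  · set U := Matrix.GeneralLinearGroup.mkOfDetNeZero T hdet
    rw [Matrix.mul_assoc, show N * U.val = U.val * !![0, 0, 0; 1, 0, 0; 0, 1, 0] from hNT,
      ← Matrix.mul_assoc, ← Units.val_mul, inv_mul_cancel, Units.val_one, Matrix.one_mul]

/-- If `N ^ 2 ≠ 0` for a nilpotent `3 × 3` matrix, the kernel of `N ^ 2` is the range of `N`. -/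
lemma exists_mulVec_eq_of_mulVec_mulVec_eq_zero {N : Matrix (Fin 3) (Fin 3) K}
    (hN : N * (N * N) = 0) (hN2 : N * N ≠ 0) {a : Fin 3 → K}
    (ha2 : N.mulVec (N.mulVec a) = 0) : ∃ f, N.mulVec f = a := by
  obtain ⟨g, hg⟩ : ∃ g, N.mulVec (N.mulVec g) ≠ 0 := by
    by_contra! h
    refine hN2 (Matrix.ext_of_mulVec_single fun j => ?_)
    rw [← Matrix.mulVec_mulVec, h, Matrix.zero_mulVec]
  obtain ⟨T, h0, h1, h2⟩ := exists_gl_conj_eq_shift hN hg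
  have hNT : N * T.val = T.val * !![0, 0, 0; 1, 0, 0; 0, 1, 0] := by
    rw [← h2, Matrix.mul_assoc, ← Matrix.mul_assoc T.val, ← Units.val_mul, mul_inv_cancel,
      Units.val_one, Matrix.one_mul]
  set b := (T⁻¹).val.mulVec a with hb
  have hTb : T.val.mulVec b = a := by
    rw [hb, Matrix.mulVec_mulVec, ← Units.val_mul, mul_inv_cancel, Units.val_one,
      Matrix.one_mulVec]
  have hNa : ∀ c, N.mulVec (T.val.mulVec c) = T.val.mulVec ![0, c 0, c 1] := fun c => by
    rw [Matrix.mulVec_mulVec, hNT, ← Matrix.mulVec_mulVec]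
    congr 1
    ext i
    fin_cases i <;> simp [Matrix.mulVec, dotProduct, Fin.sum_univ_three]
  have hinj : ∀ c, T.val.mulVec c = 0 → c = 0 := fun c hc => by
    have := congrArg (T⁻¹).val.mulVec hc
    rwa [Matrix.mulVec_mulVec, ← Units.val_mul, inv_mul_cancel, Units.val_one,
      Matrix.one_mulVec, Matrix.mulVec_zero] at this
  rw [← hTb, hNa, hNa] at ha2
  have hb0 : b 0 = 0 := by simpa using congrFun (hinj _ ha2) 2
  -- In the cyclic basis N sends (c₀, c₁, c₂) to (0, c₀, c₁), and N²a = 0 says that the first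
  -- coordinate of a is zero. Shifting back gives the preimage.
  refine ⟨T.val.mulVec ![b 1, b 2, 0], ?_⟩
  rw [hNa, ← hTb]
  congr 1
  ext i
  fin_cases i <;> simp [hb0]

end LinearAlgebra

/-! ### Descent of linear relations from an extension field -/

section Descent

/-- A nontrivial linear relation between polynomials over an extension field descends. -/
lemma exists_sum_eq_zero_of_map {K L ι σ κ : Type*} [Field K] [Field L] [Algebra K L] [Fintype κ]
    (f : κ → ι → MvPolynomial σ K) {v : κ → L} (hv : v ≠ 0)
    (h : ∀ i, ∑ j, C (v j) * map (algebraMap K L) (f j i) = 0) :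
    ∃ w : κ → K, w ≠ 0 ∧ ∀ i, ∑ j, C (w j) * f j i = 0 := by
  obtain ⟨k, hk⟩ := Function.ne_iff.1 hv
  -- A K-linear functional on L applied to the scalars of the relation preserves it, since the
  -- polynomials have coefficients in K. Choosing it nonzero at `v k` keeps the relation nontrivial.
  obtain ⟨φ, hφ⟩ : ∃ φ : Module.Dual K L, φ (v k) ≠ 0 := by
    by_contra! hc
    exact hk ((Module.forall_dual_apply_eq_zero_iff K (v k)).1 hc)
  refine ⟨fun j => φ (v j), fun h0 => hφ (congrFun h0 k), fun i => ?_⟩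
  ext d
  have h1 := congrArg (fun p => φ (coeff d p)) (h i)
  simp only [coeff_sum, coeff_C_mul, coeff_map, coeff_zero, map_zero, map_sum] at h1 ⊢
  rw [← h1]
  refine Finset.sum_congr rfl fun j _ => ?_
  rw [mul_comm (v j), ← Algebra.smul_def, map_smul, smul_eq_mul, mul_comm]

end Descent

/-! ### Rational points, Euler's identity and rank-one Jacobians -/

section Classification

variable {K : Type*} [Field K]

/-- `H` is linearly conjugate to one of the two families of normal forms. -/
def HasNormalForm (H : Fin 3 → MvPolynomial (Fin 3) K) : Prop :=
  ∃ T : GL (Fin 3) K,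
    (∃ u v w : K, linConj T H =
      ![0,
        C (1 / 4) * X 0 ^ 4,
        X 0 ^ 3 * X 1 + C u * (X 0 ^ 2 * X 1 ^ 2) + C v * (X 0 * X 1 ^ 3) + C w * X 1 ^ 4]) ∨
    (∃ u v w : K, linConj T H =
      ![0,
        C (1 / 4) * X 0 ^ 4 + C u * (X 0 ^ 2 * X 2 ^ 2) + C v * (X 0 * X 2 ^ 3) + C w * X 2 ^ 4,
        0])

lemma HasNormalForm.of_linConj {T : GL (Fin 3) K} {H : Fin 3 → MvPolynomial (Fin 3) K}
    (h : HasNormalForm (linConj T H)) : HasNormalForm H := by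
  obtain ⟨S, h⟩ := h
  rw [linConj_linConj] at h
  exact ⟨T * S, h⟩

lemma four_le_card (h6 : (6 : K) ≠ 0) : (4 : Cardinal) ≤ Cardinal.mk K := by
  have h2 : (2 : K) ≠ 0 := fun h => h6 (by linear_combination 3 * h)
  have h3 : (3 : K) ≠ 0 := fun h => h6 (by linear_combination 2 * h)
  have hinj : Function.Injective (![0, 1, -1, 2] : Fin 4 → K) := by
    intro i j hij
    fin_cases i <;> fin_cases j <;> first | rfl | skip
    all_goals
      exfalso
      first
      | (simp at hij; done)
      | exact h2 (by simpa using hij)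
      | exact h2 (by simpa using hij.symm)
      | exact one_ne_zero (by simpa using hij)
      | exact one_ne_zero (by simpa using hij.symm)
      | exact h2 (by have : (1 : K) = -1 := hij; linear_combination this)
      | exact h2 (by have : (-1 : K) = 1 := hij; linear_combination -this)
      | exact one_ne_zero (by have : (1 : K) = 2 := hij; linear_combination -this)
      | exact one_ne_zero (by have : (2 : K) = 1 := hij; linear_combination this)
      | exact h3 (by have : (-1 : K) = 2 := hij; linear_combination -this)
      | exact h3 (by have : (2 : K) = -1 := hij; linear_combination this)
  have := Cardinal.lift_mk_le_lift_mk_of_injective hinj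
  simpa using this

/-- A form of degree d vanishing at all rational points is zero once the field has at least d
elements. The elements 0, 1, −1, 2 are distinct, so the case N² = 0 can be settled over K itself,
finite or not. -/
lemma exists_eval_ne_zero_of_isHomogeneous (h6 : (6 : K) ≠ 0) {p : MvPolynomial (Fin 3) K}
    (hp : p.IsHomogeneous 4) (h0 : p ≠ 0) : ∃ a, eval a p ≠ 0 := by
  by_contra! h
  exact h0 (hp.eq_zero_of_forall_eval_eq_zero_of_le_card h (by simpa using four_le_card h6))

lemma jacobian_mulVec_X {H : Fin 3 → MvPolynomial (Fin 3) K} (hH : ∀ i, (H i).IsHomogeneous 4) :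
    (jacobian H).mulVec X = (4 : MvPolynomial (Fin 3) K) • H := by
  ext1 i
  have := (hH i).sum_X_mul_pderiv
  simp only [Matrix.mulVec, dotProduct, jacobian, Matrix.of_apply, Pi.smul_apply, smul_eq_mul]
  rw [nsmul_eq_mul, Nat.cast_ofNat] at this
  rw [← this]
  exact Finset.sum_congr rfl fun j _ => mul_comm _ _

/-- Euler's identity at a point ties a to the value of the map there. It is what makes a itself a
useful vector for the matrix N(a). -/
lemma eval_jacobian_mulVec {H : Fin 3 → MvPolynomial (Fin 3) K}
    (hH : ∀ i, (H i).IsHomogeneous 4) (a : Fin 3 → K) :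
    ((jacobian H).map (eval a)).mulVec a = fun i => 4 * eval a (H i) := by
  ext i
  have := congrArg (eval a) (congrFun (jacobian_mulVec_X hH) i)
  simpa [Matrix.mulVec, dotProduct, map_sum] using this

/-- The `2 × 2` minors of a `3 × 3` matrix `N` with `N ^ 2 = 0` vanish if the first two elementary
symmetric functions of its eigenvalues do. -/
lemma mul_apply_eq_of_sq_eq_zero {R : Type*} [CommRing R] {N : Matrix (Fin 3) (Fin 3) R}
    (htr : N 0 0 + N 1 1 + N 2 2 = 0)
    (he2 : N 0 0 * N 1 1 - N 0 1 * N 1 0 + (N 0 0 * N 2 2 - N 0 2 * N 2 0)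
      + (N 1 1 * N 2 2 - N 1 2 * N 2 1) = 0)
    (hsq : N * N = 0) (i j k l : Fin 3) : N i k * N j l = N i l * N j k := by
  have hs : ∀ i j, N i 0 * N 0 j + N i 1 * N 1 j + N i 2 * N 2 j = 0 := fun i j => by
    simpa [Matrix.mul_apply, Fin.sum_univ_three] using congrFun (congrFun hsq i) j
  -- These nine equations are the entries of adj N = N² − (tr N)·N + e₂·1, whose right-hand side is
  -- zero.
  have a00 : N 1 1 * N 2 2 - N 1 2 * N 2 1 = 0 := by
    linear_combination hs 0 0 - N 0 0 * htr + he2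
  have a11 : N 0 0 * N 2 2 - N 0 2 * N 2 0 = 0 := by
    linear_combination hs 1 1 - N 1 1 * htr + he2
  have a22 : N 0 0 * N 1 1 - N 0 1 * N 1 0 = 0 := by
    linear_combination hs 2 2 - N 2 2 * htr + he2
  have a01 : N 0 2 * N 2 1 - N 0 1 * N 2 2 = 0 := by
    linear_combination hs 0 1 - N 0 1 * htr
  have a02 : N 0 1 * N 1 2 - N 0 2 * N 1 1 = 0 := by
    linear_combination hs 0 2 - N 0 2 * htr
  have a10 : N 1 2 * N 2 0 - N 1 0 * N 2 2 = 0 := by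
    linear_combination hs 1 0 - N 1 0 * htr
  have a12 : N 0 2 * N 1 0 - N 0 0 * N 1 2 = 0 := by
    linear_combination hs 1 2 - N 1 2 * htr
  have a20 : N 1 0 * N 2 1 - N 1 1 * N 2 0 = 0 := by
    linear_combination hs 2 0 - N 2 0 * htr
  have a21 : N 0 1 * N 2 0 - N 0 0 * N 2 1 = 0 := by
    linear_combination hs 2 1 - N 2 1 * htr
  have hkl : ∀ k l, N 0 k * N 1 l = N 0 l * N 1 k ∧ N 0 k * N 2 l = N 0 l * N 2 k ∧
      N 1 k * N 2 l = N 1 l * N 2 k := by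
    intro k l
    fin_cases k <;> fin_cases l <;> simp only [Fin.mk_one, Fin.reduceFinMk, Fin.zero_eta] <;>
      refine ⟨?_, ?_, ?_⟩ <;> grind
  obtain ⟨h1, h2, h3⟩ := hkl k l
  fin_cases i <;> fin_cases j <;> simp only [Fin.mk_one, Fin.reduceFinMk, Fin.zero_eta] <;> grind

/-- If the Jacobian matrix has square zero, any two components have vanishing Wronskian. -/
lemma mul_pderiv_eq_of_jacobian_sq_eq_zero (h6 : (6 : K) ≠ 0)
    {H : Fin 3 → MvPolynomial (Fin 3) K} (hH : ∀ i, (H i).IsHomogeneous 4)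
    (hnil : IsNilpotent (jacobian H)) (hsq : jacobian H * jacobian H = 0) (i j k : Fin 3) :
    H j * pderiv k (H i) = H i * pderiv k (H j) := by
  have h2 : (2 : MvPolynomial (Fin 3) K) ≠ 0 := by
    rw [← map_ofNat (C : K →+* MvPolynomial (Fin 3) K)]
    exact fun h => h6 (by linear_combination 3 * C_injective _ _ (h.trans C_0.symm))
  have h4 : (4 : MvPolynomial (Fin 3) K) ≠ 0 := fun h =>
    mul_ne_zero h2 h2 (by linear_combination h)
  set N := jacobian H with hN
  obtain ⟨htr, he2, -⟩ := charpoly_coeffs_of_isNilpotent h2 hnil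
  have hNk : ∀ i k, pderiv k (H i) = N i k := fun _ _ => rfl
  have hE : ∀ i, 4 * H i = N i 0 * X 0 + N i 1 * X 1 + N i 2 * X 2 := fun i => by
    have := congrFun (jacobian_mulVec_X hH) i
    simp only [Matrix.mulVec, dotProduct, Fin.sum_univ_three, Pi.smul_apply, smul_eq_mul] at this
    rw [← this]
  have hm := mul_apply_eq_of_sq_eq_zero htr he2 hsq
  refine mul_left_cancel₀ h4 ?_
  rw [hNk, hNk]
  -- After both components are replaced by their Euler expressions, the Wronskian is a combination
  -- of 2 × 2 minors of N.
  linear_combination (N i k) * hE j - (N j k) * hE i + X 0 * hm i j k 0 + X 1 * hm i j k 1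
    + X 2 * hm i j k 2

end Classification

/-! ### The case of square zero -/

section SquareZero

variable {K : Type*} [Field K]

/-- Over any field, a quartic form whose Wronskian with a form not vanishing at `(1, 0, 0)`
is zero vanishes as soon as it vanishes at `(1, 0, 0)`. -/
lemma eq_zero_of_mul_pderiv_eq (h6 : (6 : K) ≠ 0) {f g : MvPolynomial (Fin 3) K}
    (hf : f.IsHomogeneous 4) (hg : g.IsHomogeneous 4) (hf1 : eval ![1, 0, 0] f = 0)
    (hg1 : eval ![1, 0, 0] g ≠ 0) (h : g * pderiv 0 f = f * pderiv 0 g) : f = 0 := by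
  -- The pointwise argument for the Wronskian needs an infinite field, so both forms are viewed over
  -- the algebraic closure.
  let φ := algebraMap K (AlgebraicClosure K)
  have hev : ∀ p : MvPolynomial (Fin 3) K,
      eval ![1, 0, 0] (map φ p) = φ (eval ![1, 0, 0] p) := fun p => by
    rw [← eval₂_id p, eval₂_comp_left φ, RingHom.comp_id, eval_map]
    congr 1
    ext i
    fin_cases i <;> simp
  refine map_injective φ φ.injective ?_
  rw [map_zero]
  refine eq_zero_of_wronskian_eq_zero (g := map φ g) ?_ (hf.map φ) (hg.map φ) ?_ ?_ ?_
  · rw [← map_ofNat φ]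
    exact fun h => h6 (φ.injective (h.trans (map_zero φ).symm))
  · rw [hev, hf1, map_zero]
  · rw [hev]
    exact fun h => hg1 (φ.injective (h.trans (map_zero φ).symm))
  · rw [pderiv_map, pderiv_map, ← map_mul, ← map_mul, h]

/-- Substituting x₀ − e·x₂ for x₀ makes x₀⁴/4 contribute −e·x₀³x₂, which completes the fourth power
and removes the unwanted monomial. -/
lemma hasNormalForm_of_eq_quartic (h6 : (6 : K) ≠ 0) {H : Fin 3 → MvPolynomial (Fin 3) K}
    (h0 : H 0 = 0) (h2 : H 2 = 0) {e u v w : K}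
    (h1 : H 1 = C (1 / 4) * X 0 ^ 4 + C e * (X 0 ^ 3 * X 2) + C u * (X 0 ^ 2 * X 2 ^ 2) +
      C v * (X 0 * X 2 ^ 3) + C w * X 2 ^ 4) : HasNormalForm H := by
  have h4 : (4 : K) ≠ 0 := fun h => by
    have : (2 : K) = 0 := mul_self_eq_zero.1 (by linear_combination h)
    exact h6 (by linear_combination 3 * this)
  obtain ⟨k, hk⟩ : ∃ k : K, k = 1 / 4 := ⟨_, rfl⟩
  have hk4 : 4 * C k = (1 : MvPolynomial (Fin 3) K) := by
    rw [← map_ofNat C 4, ← C_mul, hk, mul_one_div_cancel h4, C_1]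
  rw [← hk] at h1
  refine ⟨Matrix.GeneralLinearGroup.mkOfDetNeZero !![1, 0, -e; 0, 1, 0; 0, 0, 1]
    (by simp [Matrix.det_fin_three]), Or.inr ⟨6 * k * e ^ 2 - 3 * e ^ 2 + u,
    -4 * k * e ^ 3 + 3 * e ^ 3 - 2 * e * u + v,
    k * e ^ 4 - e ^ 4 + u * e ^ 2 - v * e + w, ?_⟩⟩
  rw [linConj_eq_iff, ← hk]
  intro i
  fin_cases i
  · simp [h0, substLin, Matrix.GeneralLinearGroup.mkOfDetNeZero, Fin.sum_univ_three]
  · simp [h1, substLin, Matrix.GeneralLinearGroup.mkOfDetNeZero, Fin.sum_univ_three]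
    simp only [map_ofNat]
    linear_combination (-C e * X 0 ^ 3 * X 2) * hk4
  · simp [h2, substLin, Matrix.GeneralLinearGroup.mkOfDetNeZero, Fin.sum_univ_three]

/-- With a ↦ e₀ and N(a)a = 4H(a) ↦ e₁ the map takes the value (0, 1/4, 0) at e₀. The vanishing
Wronskians make the outer components zero, and the trace removes x₁ from the middle one. -/
lemma hasNormalForm_of_jacobian_sq_eq_zero (h6 : (6 : K) ≠ 0)
    {H : Fin 3 → MvPolynomial (Fin 3) K} (hH : IsHomogeneousOfDegree H 4)
    (hnil : IsNilpotent (jacobian H)) (hsq : jacobian H * jacobian H = 0) :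
    HasNormalForm H := by
  have h4 : (4 : K) ≠ 0 := fun h => by
    have : (2 : K) = 0 := mul_self_eq_zero.1 (by linear_combination h)
    exact h6 (by linear_combination 3 * this)
  obtain ⟨i, hi⟩ := Function.ne_iff.1 hH.1
  obtain ⟨a, ha⟩ := exists_eval_ne_zero_of_isHomogeneous h6 (hH.2 i) hi
  set N := (jacobian H).map (eval a) with hN
  have hNN : N * N = 0 := by
    rw [hN, ← Matrix.map_mul, hsq]
    ext; simp
  set b := N.mulVec a with hb
  have hbi : b i ≠ 0 := by
    rw [hb, hN, eval_jacobian_mulVec hH.2]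
    exact mul_ne_zero h4 ha
  have hNb : N.mulVec b = 0 := by rw [hb, Matrix.mulVec_mulVec, hNN, Matrix.zero_mulVec]
  -- N maps a to b ≠ 0 and b to 0.
  have hab : LinearIndependent K ![a, b] := by
    rw [LinearIndependent.pair_iff]
    intro s t hst
    have h1 := congrArg N.mulVec hst
    rw [Matrix.mulVec_add, Matrix.mulVec_smul, Matrix.mulVec_smul, hNb, ← hb, smul_zero, add_zero,
      Matrix.mulVec_zero] at h1
    have hs : s = 0 := (mul_eq_zero.1 (congrFun h1 i)).resolve_right hbi
    rw [hs, zero_smul, zero_add] at hst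
    exact ⟨hs, (mul_eq_zero.1 (congrFun hst i)).resolve_right hbi⟩
  obtain ⟨T, hTa, hTb⟩ := exists_gl_of_linearIndependent hab
  refine HasNormalForm.of_linConj (T := T) ?_
  have hval : ∀ i, eval ![1, 0, 0] (linConj T H i) = ![0, 1 / 4, 0] i := by
    have h1 : T.val.mulVec (fun j => eval ![1, 0, 0] (linConj T H j)) =
        T.val.mulVec ![0, 1 / 4, 0] := by
      have : (![0, 1 / 4, 0] : Fin 3 → K) = (1 / 4 : K) • ![0, 1, 0] := by simp
      rw [this, Matrix.mulVec_smul, hTb]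
      ext i
      have := congrArg (eval ![1, 0, 0]) (sum_C_mul_linConj T H i)
      rw [eval_substLin, hTa, map_sum] at this
      simp only [map_mul, eval_C] at this
      rw [Matrix.mulVec, dotProduct, this, Pi.smul_apply, hb, hN, eval_jacobian_mulVec hH.2,
        smul_eq_mul, ← mul_assoc,
        one_div_mul_cancel h4, one_mul]
    have h2 := congrArg (T⁻¹).val.mulVec h1
    rw [Matrix.mulVec_mulVec, Matrix.mulVec_mulVec, ← Units.val_mul, inv_mul_cancel,
      Units.val_one, Matrix.one_mulVec, Matrix.one_mulVec] at h2
    exact congrFun h2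
  have hG := isHomogeneous_linConj T hH.2
  have hGnil := isNilpotent_jacobian_linConj T hnil
  have hGsq : jacobian (linConj T H) * jacobian (linConj T H) = 0 := by
    rw [← pow_two, jacobian_linConj_pow, pow_two, hsq]
    ext; simp
  generalize linConj T H = G at *
  have hW := fun i => mul_pderiv_eq_of_jacobian_sq_eq_zero h6 hG hGnil hGsq i 1 0
  have hG1 : eval ![1, 0, 0] (G 1) ≠ 0 := by
    rw [hval]
    simpa using h4
  have hG0 : G 0 = 0 := eq_zero_of_mul_pderiv_eq h6 (hG 0) (hG 1) (hval 0) hG1 (hW 0)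
  have hG2 : G 2 = 0 := eq_zero_of_mul_pderiv_eq h6 (hG 2) (hG 1) (hval 2) hG1 (hW 2)
  have hd : pderiv 1 (G 1) = 0 := by
    have h2 : (2 : MvPolynomial (Fin 3) K) ≠ 0 := by
      rw [← map_ofNat (C : K →+* MvPolynomial (Fin 3) K)]
      exact fun h => h6 (by linear_combination 3 * C_injective _ _ (h.trans C_0.symm))
    simpa [jacobian, hG0, hG2] using (charpoly_coeffs_of_isNilpotent h2 hGnil).1
  have hc : ∀ k, quarticExp k 1 ≠ 0 → coeff (quarticExp k) (G 1) = 0 := fun k hk =>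
    coeff_eq_zero_of_pderiv_eq_zero h6 (hG 1) hd hk
  have hq := eq_quartic (hG 1)
  have hv1 := hval 1
  rw [hq, eval_quartic] at hv1
  refine hasNormalForm_of_eq_quartic h6 hG0 hG2 (e := coeff (quarticExp 2) (G 1))
    (u := coeff (quarticExp 5) (G 1)) (v := coeff (quarticExp 9) (G 1))
    (w := coeff (quarticExp 14) (G 1)) (hq.trans ?_)
  have hk : coeff (quarticExp 0) (G 1) = 1 / 4 := by simpa [quarticEval] using hv1
  have c1 := hc 1 (by simp [quarticExp])
  have c3 := hc 3 (by simp [quarticExp])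
  have c4 := hc 4 (by simp [quarticExp])
  have c6 := hc 6 (by simp [quarticExp])
  have c7 := hc 7 (by simp [quarticExp])
  have c8 := hc 8 (by simp [quarticExp])
  have c10 := hc 10 (by simp [quarticExp])
  have c11 := hc 11 (by simp [quarticExp])
  have c12 := hc 12 (by simp [quarticExp])
  have c13 := hc 13 (by simp [quarticExp])
  simp only [quartic, c1, c3, c4, c6, c7, c8, c10, c11, c12, c13, hk, C_0, zero_mul, add_zero]

end SquareZero

/-! ### Transport of linear relations under conjugation -/

section Relations

variable {K : Type*} [Field K] {n : ℕ}

lemma eq_zero_of_substLin_eq_zero (T : GL (Fin n) K) {p : MvPolynomial (Fin n) K}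
    (h : substLin T.val p = 0) : p = 0 := by
  have h2 := congrArg (substLin (T⁻¹).val) h
  rwa [substLin_comp, ← Units.val_mul, mul_inv_cancel, Units.val_one, substLin_one, map_zero] at h2

lemma linConj_apply_eq_substLin (T : GL (Fin n) K) (H : Fin n → MvPolynomial (Fin n) K)
    (i : Fin n) : linConj T H i = substLin T.val (∑ j, C ((T⁻¹).val i j) * H j) := by
  simp [linConj_apply]

lemma pderiv_substLin_eq_substLin (T : Matrix (Fin n) (Fin n) K) (l : Fin n)
    (p : MvPolynomial (Fin n) K) :
    pderiv l (substLin T p) = substLin T (∑ k, C (T k l) * pderiv k p) := by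
  simp [pderiv_substLin, mul_comm]

lemma pderiv_linConj_eq_zero {T : GL (Fin n) K} {H : Fin n → MvPolynomial (Fin n) K} {l : Fin n}
    (h : ∀ i, ∑ k, C (T.val k l) * pderiv k (H i) = 0) (i : Fin n) :
    pderiv l (linConj T H i) = 0 := by
  simp [linConj_apply, pderiv_substLin_eq_substLin, h]

lemma sum_pderiv_eq_zero_of_linConj {T : GL (Fin n) K} {H : Fin n → MvPolynomial (Fin n) K}
    {l : Fin n} (h : ∀ i, pderiv l (linConj T H i) = 0) (i : Fin n) :
    ∑ k, C (T.val k l) * pderiv k (H i) = 0 := by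
  refine eq_zero_of_substLin_eq_zero T ?_
  rw [← pderiv_substLin_eq_substLin, ← sum_C_mul_linConj]
  simp [h]

lemma jacobian_linConj_mulVec (T : GL (Fin n) K) (H : Fin n → MvPolynomial (Fin n) K) :
    (jacobian (linConj T H)).mulVec (linConj T H) =
      ((T⁻¹).val.map C).mulVec fun i => substLin T.val ((jacobian H).mulVec H i) := by
  have h : linConj T H = ((T⁻¹).val.map C).mulVec fun i => substLin T.val (H i) := rfl
  rw [jacobian_linConj, h, Matrix.mulVec_mulVec, Matrix.mul_assoc, map_inv_mul_map,
    Matrix.mul_one, ← Matrix.mulVec_mulVec]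
  congr 1
  ext1 i
  simp [Matrix.mulVec, dotProduct, map_sum]

end Relations

/-! ### Normalising at a general point over an infinite field -/

section InfiniteField

variable {F : Type*} [Field F] [Infinite F] {H : Fin 3 → MvPolynomial (Fin 3) F}

/-- If NH = 0 but N² ≠ 0, a general a satisfies N(a)²a = 0 while N(a)² ≠ 0, so a = N(a)f for some f.
Since N(a)²f = 4H(a) ≠ 0, this f is cyclic, and in its basis a becomes (0, 1, 0) with the shift as
Jacobian, which is impossible. -/
lemma jacobian_sq_eq_zero_of_jacobian_mulVec_self_eq_zero (h6 : (6 : F) ≠ 0)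
    (hH : IsHomogeneousOfDegree H 4) (hnil : IsNilpotent (jacobian H))
    (h0 : (jacobian H).mulVec H = 0) : jacobian H * jacobian H = 0 := by
  have h2 : (2 : F) ≠ 0 := fun h => h6 (by linear_combination 3 * h)
  have h4 : (4 : F) ≠ 0 := fun h => mul_ne_zero h2 h2 (by linear_combination h)
  by_contra hsq
  obtain ⟨i, hi⟩ := Function.ne_iff.1 hH.1
  obtain ⟨j, k, hjk⟩ : ∃ j k, (jacobian H * jacobian H) j k ≠ 0 := by
    by_contra! h
    exact hsq (Matrix.ext h)
  obtain ⟨a, ha⟩ : ∃ a, eval a (H i * (jacobian H * jacobian H) j k) ≠ 0 := by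
    by_contra! h
    exact mul_ne_zero hi hjk (MvPolynomial.funext fun a => by rw [h, map_zero])
  rw [map_mul] at ha
  set N := (jacobian H).map (eval a) with hN
  have hNN : N * N ≠ 0 := fun h => right_ne_zero_of_mul ha <| by
    have := congrFun (congrFun h j) k
    rwa [hN, ← Matrix.map_mul, Matrix.map_apply] at this
  have hNnil : N * (N * N) = 0 :=
    pow_three_eq_zero_of_isNilpotent h2 (hnil.map (eval a).mapMatrix)
  have hNa := eval_jacobian_mulVec hH.2 a
  have hNNa : N.mulVec (N.mulVec a) = 0 := by
    rw [hNa]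
    ext l
    have := congrArg (fun p => 4 * eval a p) (congrFun h0 l)
    simp only [Matrix.mulVec, dotProduct, map_sum, map_mul, Pi.zero_apply, map_zero, mul_zero,
      Finset.mul_sum] at this ⊢
    rw [← this]
    exact Finset.sum_congr rfl fun m _ => by rw [hN, Matrix.map_apply]; ring
  obtain ⟨f, hf⟩ := exists_mulVec_eq_of_mulVec_mulVec_eq_zero hNnil hNN hNNa
  have hff : N.mulVec (N.mulVec f) ≠ 0 := fun h => by
    rw [hf, hNa] at h
    exact mul_ne_zero h4 (left_ne_zero_of_mul ha) (congrFun h i)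
  obtain ⟨T, -, hT1, hT⟩ := exists_gl_conj_eq_shift hNnil hff
  refine jacobian_mulVec_self_ne_zero_of_jacobian_eq_shift h6 (isHomogeneous_linConj T hH.2)
    (isNilpotent_jacobian_linConj T hnil) ?_ ?_
  · rw [eval_jacobian_linConj, hT1, hf, hT]
  · rw [jacobian_linConj_mulVec, h0]
    simp only [Pi.zero_apply, map_zero]
    exact Matrix.mulVec_zero _

/-- At a point where NH ≠ 0, N(a)²a = 4(NH)(a) is nonzero, so a is cyclic for N(a) and becomes (1,
0, 0) with the shift as Jacobian. The vanishing first component and the absent last variable, pulled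
back through T, are the two relations. They are stated without coordinates so that they can descend
to a smaller field. -/
lemma exists_relations_of_infinite (h6 : (6 : F) ≠ 0)
    (hH : ∀ i, (H i).IsHomogeneous 4) (hnil : IsNilpotent (jacobian H))
    (h0 : (jacobian H).mulVec H ≠ 0) :
    (∃ w : Fin 3 → F, w ≠ 0 ∧ ∑ j, C (w j) * H j = 0) ∧
      ∃ v : Fin 3 → F, v ≠ 0 ∧ ∀ i, ∑ k, C (v k) * pderiv k (H i) = 0 := by
  have h2 : (2 : F) ≠ 0 := fun h => h6 (by linear_combination 3 * h)
  have h4 : (4 : F) ≠ 0 := fun h => mul_ne_zero h2 h2 (by linear_combination h)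
  obtain ⟨i, hi⟩ := Function.ne_iff.1 h0
  obtain ⟨a, ha⟩ : ∃ a, eval a ((jacobian H).mulVec H i) ≠ 0 := by
    by_contra! h
    exact hi (MvPolynomial.funext fun a => by rw [h, Pi.zero_apply, map_zero])
  set N := (jacobian H).map (eval a) with hN
  have hNnil : N * (N * N) = 0 :=
    pow_three_eq_zero_of_isNilpotent h2 (hnil.map (eval a).mapMatrix)
  have hNNa : N.mulVec (N.mulVec a) ≠ 0 := fun h => by
    rw [eval_jacobian_mulVec hH] at h
    refine mul_ne_zero h4 ha ((Eq.trans ?_ (congrFun h i)))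
    simp only [Matrix.mulVec, dotProduct, map_sum, map_mul, Finset.mul_sum]
    exact Finset.sum_congr rfl fun m _ => by rw [hN, Matrix.map_apply]; ring
  obtain ⟨T, hT0, -, hT⟩ := exists_gl_conj_eq_shift hNnil hNNa
  obtain ⟨hz, hd⟩ := eq_zero_and_pderiv_eq_zero_of_jacobian_eq_shift h6
    (isHomogeneous_linConj T hH) (isNilpotent_jacobian_linConj T hnil)
    (by rw [eval_jacobian_linConj, hT0, hT])
  -- The first row of T⁻¹ gives the dependence between the components, the last column of T the
  -- direction of vanishing derivative. Neither is zero, because T⁻¹T = 1.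
  refine ⟨⟨(T⁻¹).val 0, fun h => ?_, ?_⟩, ⟨fun k => T.val k 2, fun h => ?_, ?_⟩⟩
  · have := congrFun (congrFun (Units.inv_mul T) 0) 0
    change ((T⁻¹).val * T.val) 0 0 = _ at this
    rw [Matrix.mul_apply, Matrix.one_apply_eq] at this
    simp only [h, Pi.zero_apply, zero_mul, Finset.sum_const_zero, zero_ne_one] at this
  · rw [linConj_apply_eq_substLin] at hz
    exact eq_zero_of_substLin_eq_zero T hz
  · have := congrFun (congrFun (Units.inv_mul T) 2) 2
    change ((T⁻¹).val * T.val) 2 2 = _ at this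
    rw [Matrix.mul_apply, Matrix.one_apply_eq] at this
    have h' : ∀ k, T.val k 2 = 0 := congrFun h
    simp only [h', mul_zero, Finset.sum_const_zero, zero_ne_one] at this
  · exact sum_pderiv_eq_zero_of_linConj hd

end InfiniteField

/-! ### From an infinite extension back to the ground field -/

section BaseChange

variable {K : Type*} [Field K] (L : Type*) [Field L] [Algebra K L]
  {H : Fin 3 → MvPolynomial (Fin 3) K}

lemma jacobian_map (H : Fin 3 → MvPolynomial (Fin 3) K) :
    jacobian (fun i => map (algebraMap K L) (H i)) = (jacobian H).map (map (algebraMap K L)) := by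
  ext1 i j
  simp [jacobian, pderiv_map]

lemma isNilpotent_jacobian_map (hnil : IsNilpotent (jacobian H)) :
    IsNilpotent (jacobian fun i => map (algebraMap K L) (H i)) := by
  rw [jacobian_map]
  exact hnil.map (map (algebraMap K L)).mapMatrix

lemma jacobian_map_mulVec (H : Fin 3 → MvPolynomial (Fin 3) K) :
    ((jacobian fun i => map (algebraMap K L) (H i)).mulVec fun i => map (algebraMap K L) (H i)) =
      fun i => map (algebraMap K L) ((jacobian H).mulVec H i) := by
  rw [jacobian_map]
  ext1 i
  simp [Matrix.mulVec, dotProduct]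

lemma ofNat_six_ne_zero_of_algebra (h6 : (6 : K) ≠ 0) : (6 : L) ≠ 0 := by
  rw [← map_ofNat (algebraMap K L)]
  exact fun h => h6 ((algebraMap K L).injective (h.trans (map_zero _).symm))

lemma jacobian_mulVec_self_ne_zero_of_extension [Infinite L] (h6 : (6 : K) ≠ 0)
    (hH : IsHomogeneousOfDegree H 4)
    (hnil : IsNilpotent (jacobian H)) (hsq : jacobian H * jacobian H ≠ 0) :
    (jacobian H).mulVec H ≠ 0 := by
  have hinj := map_injective (σ := Fin 3) (algebraMap K L) (algebraMap K L).injective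
  intro h0
  have h := jacobian_sq_eq_zero_of_jacobian_mulVec_self_eq_zero
    (H := fun i => map (algebraMap K L) (H i)) (ofNat_six_ne_zero_of_algebra L h6)
    ⟨fun h => hH.1 (funext fun i => hinj ((congrFun h i).trans (map_zero _).symm)),
      fun i => (hH.2 i).map _⟩ (isNilpotent_jacobian_map L hnil)
    (by rw [jacobian_map_mulVec, h0]; ext1 i; simp)
  refine hsq (Matrix.ext fun i j => hinj ?_)
  rw [jacobian_map, ← Matrix.map_mul] at h
  exact (congrFun (congrFun h i) j).trans (map_zero _).symm

/-- The point used over L need not be rational over K, nor need T be. Only the two linear relations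
are brought down. -/
lemma exists_relations_of_extension [Infinite L] (h6 : (6 : K) ≠ 0)
    (hH : ∀ i, (H i).IsHomogeneous 4)
    (hnil : IsNilpotent (jacobian H)) (h0 : (jacobian H).mulVec H ≠ 0) :
    (∃ w : Fin 3 → K, w ≠ 0 ∧ ∑ j, C (w j) * H j = 0) ∧
      ∃ v : Fin 3 → K, v ≠ 0 ∧ ∀ i, ∑ k, C (v k) * pderiv k (H i) = 0 := by
  have hinj := map_injective (σ := Fin 3) (algebraMap K L) (algebraMap K L).injective
  obtain ⟨⟨w, hw, hwH⟩, v, hv, hvH⟩ := exists_relations_of_infinite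
    (H := fun i => map (algebraMap K L) (H i)) (ofNat_six_ne_zero_of_algebra L h6)
    (fun i => (hH i).map _) (isNilpotent_jacobian_map L hnil)
    (by
      rw [jacobian_map_mulVec]
      refine fun h => h0 (funext fun i => hinj ?_)
      rw [Pi.zero_apply, map_zero]
      exact congrFun h i)
  constructor
  · have hf : ∀ _ : Unit, ∑ j, C (w j) * map (algebraMap K L) (H j) = 0 := fun _ => hwH
    obtain ⟨w', hw', h⟩ := exists_sum_eq_zero_of_map (K := K) (κ := Fin 3) (fun j _ => H j) hw hf
    exact ⟨w', hw', h ()⟩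
  · refine exists_sum_eq_zero_of_map (fun k i => pderiv k (H i)) hv fun i => ?_
    simpa only [pderiv_map] using hvH i

lemma jacobian_mulVec_self_ne_zero (h6 : (6 : K) ≠ 0) (hH : IsHomogeneousOfDegree H 4)
    (hnil : IsNilpotent (jacobian H)) (hsq : jacobian H * jacobian H ≠ 0) :
    (jacobian H).mulVec H ≠ 0 :=
  jacobian_mulVec_self_ne_zero_of_extension (AlgebraicClosure K) h6 hH hnil hsq

lemma exists_relations (h6 : (6 : K) ≠ 0) (hH : ∀ i, (H i).IsHomogeneous 4)
    (hnil : IsNilpotent (jacobian H)) (h0 : (jacobian H).mulVec H ≠ 0) :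
    (∃ w : Fin 3 → K, w ≠ 0 ∧ ∑ j, C (w j) * H j = 0) ∧
      ∃ v : Fin 3 → K, v ≠ 0 ∧ ∀ i, ∑ k, C (v k) * pderiv k (H i) = 0 :=
  exists_relations_of_extension (AlgebraicClosure K) h6 hH hnil h0

end BaseChange

/-! ### The triangular case and the final reduction -/

section Triangular

variable {K : Type*} [Field K] {H : Fin 3 → MvPolynomial (Fin 3) K}

/-- Let f be the third component, a binary form. Replacing x₁ by s·x₀ + 4c·x₁ makes the coefficient
of x₀³x₁ equal to 4cB with B = ∂₁f(1, s), so s is needed with B ≠ 0. The rest is scaling and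
subtracting a multiple of the second component. -/
lemma hasNormalForm_of_eq_binary (h6 : (6 : K) ≠ 0) {a b c u v w : K} (hc : c ≠ 0)
    (hb : ¬ (b = 0 ∧ u = 0 ∧ v = 0 ∧ w = 0)) (h0 : H 0 = 0) (h1 : H 1 = C c * X 0 ^ 4)
    (h2 : H 2 = C a * X 0 ^ 4 + C b * (X 0 ^ 3 * X 1) + C u * (X 0 ^ 2 * X 1 ^ 2) +
      C v * (X 0 * X 1 ^ 3) + C w * X 1 ^ 4) : HasNormalForm H := by
  have hn2 : (2 : K) ≠ 0 := fun h => h6 (by linear_combination 3 * h)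
  have hn3 : (3 : K) ≠ 0 := fun h => h6 (by linear_combination 2 * h)
  have hn4 : (4 : K) ≠ 0 := fun h => mul_ne_zero hn2 hn2 (by linear_combination h)
  -- A cubic in s vanishing at 0, 1, −1 and 2 is zero when 6 is invertible, and then so are b, u, v,
  -- w.
  obtain ⟨s, hs⟩ : ∃ s, b + 2 * u * s + 3 * v * s ^ 2 + 4 * w * s ^ 3 ≠ 0 := by
    by_contra! h
    have e0 := h 0
    have e1 := h 1
    have e2 := h (-1)
    have e3 := h 2
    have hb0 : b = 0 := by linear_combination e0
    have hv0 : v = 0 := (mul_eq_zero.1 (by linear_combination e1 + e2 - 2 * hb0 :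
      6 * v = 0)).resolve_left h6
    have hw0 : w = 0 := (mul_eq_zero.1 (by linear_combination e3 - 2 * e1 + hb0 - 6 * hv0 :
      (6 * 4) * w = 0)).resolve_left (mul_ne_zero h6 hn4)
    have hu0 : u = 0 := (mul_eq_zero.1 (by linear_combination e1 - hb0 - 3 * hv0 - 4 * hw0 :
      2 * u = 0)).resolve_left hn2
    exact hb ⟨hb0, hu0, hv0, hw0⟩
  obtain ⟨B, hB⟩ : ∃ B, B = b + 2 * u * s + 3 * v * s ^ 2 + 4 * w * s ^ 3 := ⟨_, rfl⟩
  rw [← hB] at hs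
  obtain ⟨q, hq⟩ : ∃ q : K, q = 1 / 4 := ⟨_, rfl⟩
  have hq4 : 4 * C q = (1 : MvPolynomial (Fin 3) K) := by
    rw [← map_ofNat C 4, ← C_mul, hq, mul_one_div_cancel hn4, C_1]
  obtain ⟨r, hr⟩ : ∃ r : K, r = 1 / B := ⟨_, rfl⟩
  have hrB : C B * C r = (1 : MvPolynomial (Fin 3) K) := by
    rw [← C_mul, hr, mul_one_div_cancel hs, C_1]
  have hBC := congrArg (C : K → MvPolynomial (Fin 3) K) hB
  simp only [map_add, map_mul, map_pow, map_ofNat] at hBC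
  -- The diagonal entries 4c and 4cB normalise x₀⁴ to 1/4 and x₀³x₁ to 1. The entry 4·f(1, s) below
  -- the diagonal absorbs the x₀⁴ term of the third component.
  refine ⟨Matrix.GeneralLinearGroup.mkOfDetNeZero
    !![1, 0, 0; s, 4 * c, 0; 0, 4 * (a + b * s + u * s ^ 2 + v * s ^ 3 + w * s ^ 4), 4 * c * B]
    (by simp [Matrix.det_fin_three, hs, hn4, hc]), Or.inl
    ⟨4 * c * (u + 3 * v * s + 6 * w * s ^ 2) * r, 16 * c ^ 2 * (v + 4 * w * s) * r,
      64 * c ^ 3 * w * r, ?_⟩⟩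
  rw [linConj_eq_iff, ← hq]
  intro i
  fin_cases i
  · simp [h0, substLin, Matrix.GeneralLinearGroup.mkOfDetNeZero, Fin.sum_univ_three]
  · simp [h1, substLin, Matrix.GeneralLinearGroup.mkOfDetNeZero, Fin.sum_univ_three]
    simp only [map_ofNat]
    linear_combination (-C c * X 0 ^ 4) * hq4
  · simp [h2, substLin, Matrix.GeneralLinearGroup.mkOfDetNeZero, Fin.sum_univ_three]
    simp only [map_ofNat]
    linear_combination (-(C a + C b * C s + C u * C s ^ 2 + C v * C s ^ 3 + C w * C s ^ 4)
      * X 0 ^ 4) * hq4 - 4 * C c * X 0 ^ 3 * X 1 * hBC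
      - (16 * C c ^ 2 * (C u + 3 * C v * C s + 6 * C w * C s ^ 2) * X 0 ^ 2 * X 1 ^ 2
      + 64 * C c ^ 3 * (C v + 4 * C w * C s) * X 0 * X 1 ^ 3
      + 256 * C c ^ 4 * C w * X 1 ^ 4) * hrB

/-- With first row and last column zero, the trace makes ∂₁`H 1` vanish, so `H 1` is a multiple of
x₀⁴ and `H 2` is a form in x₀, x₁. -/
lemma hasNormalForm_of_pderiv_two_eq_zero (h6 : (6 : K) ≠ 0) (hH : IsHomogeneousOfDegree H 4)
    (hnil : IsNilpotent (jacobian H)) (h0 : H 0 = 0) (hd : ∀ i, pderiv 2 (H i) = 0) :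
    HasNormalForm H := by
  by_cases hsq : jacobian H * jacobian H = 0
  · exact hasNormalForm_of_jacobian_sq_eq_zero h6 hH hnil hsq
  have hd1 : pderiv 1 (H 1) = 0 := by
    have h2 : (2 : MvPolynomial (Fin 3) K) ≠ 0 := by
      rw [← map_ofNat (C : K →+* MvPolynomial (Fin 3) K)]
      exact fun h => h6 (by linear_combination 3 * C_injective _ _ (h.trans C_0.symm))
    simpa [jacobian, h0, hd] using (charpoly_coeffs_of_isNilpotent h2 hnil).1
  have hc1 : ∀ k, quarticExp k 1 ≠ 0 → coeff (quarticExp k) (H 1) = 0 := fun k hk =>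
    coeff_eq_zero_of_pderiv_eq_zero h6 (hH.2 1) hd1 hk
  have hc2 : ∀ i k, quarticExp k 2 ≠ 0 → coeff (quarticExp k) (H i) = 0 := fun i k hk =>
    coeff_eq_zero_of_pderiv_eq_zero h6 (hH.2 i) (hd i) hk
  have c2 := fun i => hc2 i 2 (by simp [quarticExp])
  have c4 := fun i => hc2 i 4 (by simp [quarticExp])
  have c5 := fun i => hc2 i 5 (by simp [quarticExp])
  have c7 := fun i => hc2 i 7 (by simp [quarticExp])
  have c8 := fun i => hc2 i 8 (by simp [quarticExp])
  have c9 := fun i => hc2 i 9 (by simp [quarticExp])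
  have c11 := fun i => hc2 i 11 (by simp [quarticExp])
  have c12 := fun i => hc2 i 12 (by simp [quarticExp])
  have c13 := fun i => hc2 i 13 (by simp [quarticExp])
  have c14 := fun i => hc2 i 14 (by simp [quarticExp])
  have b1 := hc1 1 (by simp [quarticExp])
  have b3 := hc1 3 (by simp [quarticExp])
  have b6 := hc1 6 (by simp [quarticExp])
  have b10 := hc1 10 (by simp [quarticExp])
  have q1 := eq_quartic (hH.2 1)
  have q2 := eq_quartic (hH.2 2)
  simp only [quartic, c2, c4, c5, c7, c8, c9, c11, c12, c13, c14, b1, b3, b6, b10, C_0, zero_mul,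
    add_zero] at q1 q2
  -- The product of these two derivatives is the only entry of N² that can be nonzero.
  have hprod : pderiv 0 (H 1) ≠ 0 ∧ pderiv 1 (H 2) ≠ 0 := by
    by_contra h
    rw [not_and_or, not_not, not_not] at h
    refine hsq ?_
    ext1 i j
    rw [Matrix.mul_apply, Fin.sum_univ_three]
    fin_cases i <;> fin_cases j <;> simp [jacobian, h0, hd, hd1, or_comm.1 h]
  refine hasNormalForm_of_eq_binary h6 (fun h => hprod.1 ?_) (fun h => hprod.2 ?_) h0 q1 q2
  · rw [q1, h]
    simp
  · rw [q2, h.1, h.2.1, h.2.2.1, h.2.2.2]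
    simp [pderiv_X]

/-- The last column is zero, so the upper left 2 × 2 block has trace and determinant zero and hence
square zero. As `w 2 ≠ 0`, the last row is a combination of the first two, so N² vanishes there too.
-/
lemma jacobian_sq_eq_zero_of_relation (h6 : (6 : K) ≠ 0) (hnil : IsNilpotent (jacobian H))
    (hd : ∀ i, pderiv 2 (H i) = 0) {w : Fin 3 → K} (hw2 : w 2 ≠ 0)
    (hw : ∑ j, C (w j) * H j = 0) : jacobian H * jacobian H = 0 := by
  have h2 : (2 : MvPolynomial (Fin 3) K) ≠ 0 := by
    rw [← map_ofNat (C : K →+* MvPolynomial (Fin 3) K)]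
    exact fun h => h6 (by linear_combination 3 * C_injective _ _ (h.trans C_0.symm))
  have hC : (C (w 2) : MvPolynomial (Fin 3) K) ≠ 0 := fun h =>
    hw2 (C_injective _ _ (h.trans C_0.symm))
  obtain ⟨htr, he2, -⟩ := charpoly_coeffs_of_isNilpotent h2 hnil
  set N := jacobian H with hN
  have hN2 : ∀ i, N i 2 = 0 := hd
  have hr : ∀ j, C (w 0) * N 0 j + C (w 1) * N 1 j + C (w 2) * N 2 j = 0 := fun j => by
    have := congrArg (pderiv j) hw
    rw [Fin.sum_univ_three] at this
    simpa [hN, jacobian] using this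
  simp only [hN2, zero_mul, mul_zero, add_zero, sub_zero] at htr he2
  have hs0 : ∀ j, N 0 0 * N 0 j + N 0 1 * N 1 j = 0 := by
    intro j
    fin_cases j <;> simp only [Fin.mk_one, Fin.reduceFinMk, Fin.zero_eta]
    · linear_combination N 0 0 * htr - he2
    · linear_combination N 0 1 * htr
    · simp [hN2]
  have hs1 : ∀ j, N 1 0 * N 0 j + N 1 1 * N 1 j = 0 := by
    intro j
    fin_cases j <;> simp only [Fin.mk_one, Fin.reduceFinMk, Fin.zero_eta]
    · linear_combination N 1 0 * htr
    · linear_combination N 1 1 * htr - he2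
    · simp [hN2]
  ext1 i j
  rw [Matrix.mul_apply, Fin.sum_univ_three, hN2, zero_mul, add_zero, Matrix.zero_apply]
  fin_cases i <;> simp only [Fin.mk_one, Fin.reduceFinMk, Fin.zero_eta]
  · exact hs0 j
  · exact hs1 j
  · refine (mul_eq_zero.1 ?_).resolve_left hC
    linear_combination N 0 j * hr 0 + N 1 j * hr 1 - C (w 0) * hs0 j - C (w 1) * hs1 j

lemma hasNormalForm_of_jacobian_mulVec_self_ne_zero (h6 : (6 : K) ≠ 0)
    (hH : IsHomogeneousOfDegree H 4) (hnil : IsNilpotent (jacobian H))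
    (h0 : (jacobian H).mulVec H ≠ 0) : HasNormalForm H := by
  obtain ⟨⟨w, hw, hwH⟩, v, hv, hvH⟩ := exists_relations h6 hH.2 hnil h0
  obtain ⟨T, hT⟩ := exists_gl_mulVec_last hv
  refine HasNormalForm.of_linConj (T := T) ?_
  have hd : ∀ i, pderiv 2 (linConj T H i) = 0 :=
    pderiv_linConj_eq_zero fun i => by simpa only [hT] using hvH i
  have hw' : Matrix.vecMul w T.val ≠ 0 := fun h => hw <| by
    have := congrArg (fun u => Matrix.vecMul u (T⁻¹).val) h
    simpa only [Matrix.vecMul_vecMul, ← Units.val_mul, mul_inv_cancel, Units.val_one,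
      Matrix.vecMul_one, Matrix.zero_vecMul] using this
  have hwH' : ∑ j, C (Matrix.vecMul w T.val j) * linConj T H j = 0 := by
    have := congrArg (substLin T.val) hwH
    simp only [map_sum, map_mul, substLin_C, map_zero, ← sum_C_mul_linConj, Finset.mul_sum] at this
    rw [Finset.sum_comm] at this
    simpa only [Matrix.vecMul, dotProduct, map_sum, map_mul, Finset.sum_mul, mul_assoc] using this
  have hG := hH.linConj T
  have hGnil := isNilpotent_jacobian_linConj T hnil
  -- If the relation does not involve the last component, it can become the first component without
  -- disturbing the missing variable. Otherwise the Jacobian has square zero.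
  by_cases hw2 : Matrix.vecMul w T.val 2 = 0
  · obtain ⟨S, hS, hS2⟩ := exists_gl_vecMul_eq hw' hw2
    refine HasNormalForm.of_linConj (T := S) (hasNormalForm_of_pderiv_two_eq_zero h6
      (hG.linConj S) (isNilpotent_jacobian_linConj S hGnil) ?_ ?_)
    · rw [linConj_apply_eq_substLin]
      simp only [hS]
      rw [hwH', map_zero]
    · refine pderiv_linConj_eq_zero fun i => ?_
      simp [hS2, Fin.sum_univ_three, hd]
  · exact hasNormalForm_of_jacobian_sq_eq_zero h6 hG hGnil
      (jacobian_sq_eq_zero_of_relation h6 hGnil hd hw2 hwH')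

end Triangular

end PolyMap

open MvPolynomial in
theorem mainTheorem6 {K : Type*} [Field K] (h6 : (6 : K) ≠ 0)
    (H : Fin 3 → MvPolynomial (Fin 3) K) (hH : PolyMap.IsHomogeneousOfDegree H 4)
    (hnil : IsNilpotent (PolyMap.jacobian H)) :
    ∃ T : GL (Fin 3) K,
      (∃ u v w : K, PolyMap.linConj T H =
        ![0,
          C (1 / 4) * X 0 ^ 4,
          X 0 ^ 3 * X 1 + C u * (X 0 ^ 2 * X 1 ^ 2) + C v * (X 0 * X 1 ^ 3) + C w * X 1 ^ 4]) ∨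
      (∃ u v w : K, PolyMap.linConj T H =
        ![0,
          C (1 / 4) * X 0 ^ 4 + C u * (X 0 ^ 2 * X 2 ^ 2) + C v * (X 0 * X 2 ^ 3) + C w * X 2 ^ 4,
          0]) := by
  by_cases hsq : PolyMap.jacobian H * PolyMap.jacobian H = 0
  · exact PolyMap.hasNormalForm_of_jacobian_sq_eq_zero h6 hH hnil hsq
  · exact PolyMap.hasNormalForm_of_jacobian_mulVec_self_ne_zero h6 hH hnil
      (PolyMap.jacobian_mulVec_self_ne_zero h6 hH hnil hsq)
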